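/- Let $M$ be a smooth $n$-dimensional manifold. A flat Fedosov structure on $M$ is a pair $(\omega,\nabla)$ of a symplectic form $\omega=\tfrac12\omega_{ij}\,du^i\wedge du^j$ and a smooth, torsion-free, flat connection $\nabla$ with $\nabla\omega=0$. In local coordinates $u^i$ let $\Gamma^k_{ij}$ be its Christoffel symbols, $\omega^{ij}$ the inverse matrix ($\omega_{ir}\omega^{rj}=\delta_i^j$), $\Gamma^{ij}_k=-\omega^{ir}\Gamma^j_{rk}$, and $$c^{ij}_{kl}=\Gamma^{ij}_{(k,l)}-\omega_{pr}\Gamma^{ri}_{(k}\Gamma^{pj}_{l)},$$ where round brackets denote the symmetric part in $k,l$. The associated operator on the loop space $L(M)$ is $$P^{ij}=\omega^{ij}\Big(\frac{d}{dx}\Big)^2+2\Gamma^{ij}_ku^k_x\frac{d}{dx}+c^{ij}_{kl}u^k_xu^l_x+\Gamma^{ij}_ku^k_{xx}.$$ A matrix differential operator $P^{ij}$ is called Hamiltonian if $\{f,g\}=\int_{S^1}\frac{\delta f}{\delta u^i}P^{ij}\big(\frac{\delta g}{\delta u^j}\big)dx$ is skew-symmetric and satisfies the Jacobi identity on local functionals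 $f[u]=\int_{S^1}h(x,u,u_x,\dots,u^{(m)})\,dx$ ($h$ smooth) of the loops in each coordinate domain. Let $(\omega_1,\nabla^1)$ and $(\omega_2,\nabla^2)$ be two flat Fedosov structures on $M$ with associated operators $P_1,P_2$. Call $P_1$ and $P_2$ compatible if $\mu P_1+\nu P_2$ is Hamiltonian for all $\mu,\nu\in\mathbb R$. Put $$\Delta^{sjk}=\omega_2^{jr}{\Gamma_1}^{sk}_r-\omega_1^{sr}{\Gamma_2}^{jk}_r,\qquad \Delta^{jk}_i=\omega_{2is}\Delta^{sjk},\qquad (\alpha\circ\beta)_i=\alpha_j\beta_k\Delta^{jk}_i,\qquad (\alpha,\beta)_2=\alpha_r\beta_s\omega_2^{rs}$$ for covectors $\alpha,\beta$ on $M$. Then $P_1$ and $P_2$ are compatible if and only if $$(I,J\circ K)_2=(J,I\circ K)_2\qquad\text{and}\qquad (I\circ J)\circ K=0$$ for all covectors $I,J,K$ at every point of $M$. Moreover, if $P_1$ and $P_2$ are compatible, then $$\nabla^2_l\Delta^{ij}_k=\nabla^2_k\Delta^{ij}_l ,$$ where $\nabla^2_l$ denotes the covariant derivative with respect to the connection $\nabla^2$.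 -/

import Mathlib

open scoped Manifold ContDiff

noncomputable section

namespace Degree2

/-- The model space `ℝⁿ`; the coordinates of a point `x` are `x i`. -/
abbrev Coord (n : ℕ) : Type := EuclideanSpace ℝ (Fin n)

/-! ### Poisson brackets of local functionals on a loop space

`U ⊆ ℝⁿ` is an open set (the range of a coordinate system), `x` is the coordinate on the circle
`ℝ / ℤ`, and a loop is a smooth 1-periodic map. -/

/-- `u` is a smooth loop in `U`. -/
def IsLoop {n : ℕ} (U : Set (Coord n)) (u : ℝ → Coord n) : Prop :=
  ContDiff ℝ ∞ u ∧ Function.Periodic u 1 ∧ ∀ x, u x ∈ U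

/-- `F` is a local functional on the loops in `U`: `F[u] = ∫ h(x, u, u_x, …, u^{(k)}) dx`, with a
density `h` which is smooth and 1-periodic in `x`. -/
def IsLocalFunctional {n : ℕ} (U : Set (Coord n)) (F : (ℝ → Coord n) → ℝ) : Prop :=
  ∃ (k : ℕ) (h : ℝ × (Fin (k + 1) → Coord n) → ℝ),
    ContDiffOn ℝ ∞ h {q | q.2 0 ∈ U} ∧
    (∀ x w, h (x + 1, w) = h (x, w)) ∧
    ∀ u, IsLoop U u → F u = ∫ x in (0 : ℝ)..1, h (x, fun s => iteratedDeriv (s : ℕ) u x)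

/-- `g = (δF/δu^i)` at the loop `u`: `g` is smooth and periodic, and
`d/dε F[u + ε v] = ∫ g_i v^i dx` at `ε = 0` for every smooth periodic `v`. -/
def IsVarDeriv {n : ℕ} (F : (ℝ → Coord n) → ℝ) (u : ℝ → Coord n) (g : ℝ → Fin n → ℝ) : Prop :=
  ContDiff ℝ ∞ g ∧ Function.Periodic g 1 ∧
    ∀ v : ℝ → Coord n, IsLoop Set.univ v →
      HasDerivAt (fun ε : ℝ => F (u + ε • v)) (∫ x in (0 : ℝ)..1, ∑ i, g x i * v x i) 0

open Classical in
/-- The variational derivative `δF/δu^i` at the loop `u` (zero if there is none; every local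
functional has exactly one at every loop). -/
def varDeriv {n : ℕ} (F : (ℝ → Coord n) → ℝ) (u : ℝ → Coord n) : ℝ → Fin n → ℝ :=
  if h : ∃ g, IsVarDeriv F u g then h.choose else 0

/-- A matrix `P^{ij}` of operators whose coefficients depend on the loop: `P u ξ` is the function
`x ↦ (P^{ij} ξ_j)(x)`. Linear combinations of operators are the pointwise ones. -/
abbrev LoopOperator (n : ℕ) : Type :=
  (ℝ → Coord n) → (ℝ → Fin n → ℝ) → ℝ → Fin n → ℝ

/-- `{F, G} = ∫ (δF/δu^i) P^{ij} (δG/δu^j) dx`. -/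
def bracket {n : ℕ} (P : LoopOperator n) (F G : (ℝ → Coord n) → ℝ) : (ℝ → Coord n) → ℝ :=
  fun u => ∫ x in (0 : ℝ)..1, ∑ i, varDeriv F u x i * P u (varDeriv G u) x i

/-- `P` is a Hamiltonian operator on the loop space of `U`: its bracket of local functionals is
skew-symmetric and satisfies the Jacobi identity. -/
def IsHamiltonian {n : ℕ} (U : Set (Coord n)) (P : LoopOperator n) : Prop :=
  (∀ F G, IsLocalFunctional U F → IsLocalFunctional U G →
    ∀ u, IsLoop U u → bracket P F G u = -bracket P G F u) ∧
  (∀ F G H, IsLocalFunctional U F → IsLocalFunctional U G → IsLocalFunctional U H →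
    ∀ u, IsLoop U u →
      bracket P (bracket P F G) H u + bracket P (bracket P G H) F u
        + bracket P (bracket P H F) G u = 0)

/-! ### Components in coordinates -/

/-- `∂f/∂x^i`. -/
def pd {n : ℕ} (i : Fin n) (f : Coord n → ℝ) (x : Coord n) : ℝ :=
  fderiv ℝ f x (EuclideanSpace.single i 1)

section Components

variable {n : ℕ} {M : Type*} [TopologicalSpace M] [ChartedSpace (Coord n) M]

/-- The coordinate vector field `∂_i` of the chart `e` (meaningful on `e.source`), characterised by
`de (∂_i) = ` the `i`-th standard basis vector. -/
def coordField (e : OpenPartialHomeomorph M (Coord n)) (i : Fin n) (p : M) :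
    TangentSpace (𝓡 n) p :=
  (mfderiv (𝓡 n) 𝓘(ℝ, Coord n) e p).inverse (EuclideanSpace.single i (1 : ℝ) : Coord n)

/-- The `k`-th component in the chart `e` of a tangent vector at `p`. -/
def vecComp (e : OpenPartialHomeomorph M (Coord n)) (p : M) (v : TangentSpace (𝓡 n) p)
    (k : Fin n) : ℝ :=
  (EuclideanSpace.proj k : Coord n →L[ℝ] ℝ) (mfderiv (𝓡 n) 𝓘(ℝ, Coord n) e p v)

/-- The components `B(∂_i, ∂_j)` of a bilinear form as functions of the coordinates. -/
def formComp
    (B : ∀ p : M, TangentSpace (𝓡 n) p →L[ℝ] TangentSpace (𝓡 n) p →L[ℝ] ℝ)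
    (e : OpenPartialHomeomorph M (Coord n)) (x : Coord n) : Matrix (Fin n) (Fin n) ℝ :=
  Matrix.of fun i j => B (e.symm x) (coordField e i (e.symm x)) (coordField e j (e.symm x))

/-- The Christoffel symbols `Γ^k_{ij}`, where `∇_{∂_i} ∂_j = Γ^k_{ij} ∂_k`; they are written
`christoffel cov e x k i j`. -/
def christoffel [IsManifold (𝓡 n) 1 M]
    (cov : CovariantDerivative (𝓡 n) (Coord n) (TangentSpace (𝓡 n) : M → Type _))
    (e : OpenPartialHomeomorph M (Coord n)) (x : Coord n) (k i j : Fin n) : ℝ :=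
  vecComp e (e.symm x) (cov (coordField e j) (e.symm x) (coordField e i (e.symm x))) k

end Components

/-! ### Fedosov structures -/

/-- A Fedosov structure on `M`: a symplectic form and a symplectic connection (smooth, torsion-free,
`∇ω = 0`). The conditions are imposed on the components in all charts of the smooth structure. -/
structure FedosovStructure (n : ℕ) (M : Type*) [TopologicalSpace M] [ChartedSpace (Coord n) M]
    [IsManifold (𝓡 n) ∞ M] where
  form : ∀ p : M, TangentSpace (𝓡 n) p →L[ℝ] TangentSpace (𝓡 n) p →L[ℝ] ℝ
  conn : CovariantDerivative (𝓡 n) (Coord n) (TangentSpace (𝓡 n) : M → Type _)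
  form_smooth : ∀ e ∈ IsManifold.maximalAtlas (𝓡 n) ∞ M, ∀ i j,
    ContDiffOn ℝ ∞ (fun x => formComp form e x i j) e.target
  form_antisymm : ∀ p v w, form p v w = -form p w v
  form_nondegenerate : ∀ p v, (∀ w, form p v w = 0) → v = 0
  form_closed : ∀ e ∈ IsManifold.maximalAtlas (𝓡 n) ∞ M, ∀ x ∈ e.target, ∀ i j k,
    pd i (fun y => formComp form e y j k) x + pd j (fun y => formComp form e y k i) x
      + pd k (fun y => formComp form e y i j) x = 0
  conn_smooth : ∀ e ∈ IsManifold.maximalAtlas (𝓡 n) ∞ M, ∀ k i j,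
    ContDiffOn ℝ ∞ (fun x => christoffel conn e x k i j) e.target
  conn_torsionFree : ∀ e ∈ IsManifold.maximalAtlas (𝓡 n) ∞ M, ∀ x ∈ e.target, ∀ k i j,
    christoffel conn e x k i j = christoffel conn e x k j i
  conn_compat : ∀ e ∈ IsManifold.maximalAtlas (𝓡 n) ∞ M, ∀ x ∈ e.target, ∀ k i j,
    pd k (fun y => formComp form e y i j) x
      - ∑ r, christoffel conn e x r k i * formComp form e x r j
      - ∑ r, christoffel conn e x r k j * formComp form e x i r = 0

namespace FedosovStructure

variable {n : ℕ} {M : Type*} [TopologicalSpace M] [ChartedSpace (Coord n) M]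
  [IsManifold (𝓡 n) ∞ M]

/-- The components `ω_{ij}`. -/
def lower (S : FedosovStructure n M) (e : OpenPartialHomeomorph M (Coord n)) (x : Coord n) :
    Matrix (Fin n) (Fin n) ℝ :=
  formComp S.form e x

/-- The components `ω^{ij}`, with `ω_{ir} ω^{rj} = δ_i^j`. -/
def upper (S : FedosovStructure n M) (e : OpenPartialHomeomorph M (Coord n)) (x : Coord n) :
    Matrix (Fin n) (Fin n) ℝ :=
  (S.lower e x)⁻¹

/-- The Christoffel symbols `Γ^k_{ij}`, written `S.Γ e x k i j`. -/
def Γ (S : FedosovStructure n M) (e : OpenPartialHomeomorph M (Coord n)) (x : Coord n)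
    (k i j : Fin n) : ℝ :=
  christoffel S.conn e x k i j

/-- The connection is flat:
`R^k_{slt} = ∂_s Γ^k_{lt} - ∂_l Γ^k_{st} + Γ^k_{sr} Γ^r_{lt} - Γ^k_{lr} Γ^r_{st} = 0`. -/
def IsFlat (S : FedosovStructure n M) : Prop :=
  ∀ e ∈ IsManifold.maximalAtlas (𝓡 n) ∞ M, ∀ x ∈ e.target, ∀ k s l t,
    pd s (fun y => S.Γ e y k l t) x - pd l (fun y => S.Γ e y k s t) x
      + ∑ r, S.Γ e x k s r * S.Γ e x r l t - ∑ r, S.Γ e x k l r * S.Γ e x r s t = 0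

/-- The contravariant Christoffel symbols `Γ^{ij}_k = -ω^{ir} Γ^j_{rk}`, written
`S.Γup e x i j k`. -/
def Γup (S : FedosovStructure n M) (e : OpenPartialHomeomorph M (Coord n)) (x : Coord n)
    (i j k : Fin n) : ℝ :=
  -∑ r, S.upper e x i r * S.Γ e x j r k

/-- `c^{ij}_{kl} = Γ^{ij}_{(k,l)} - ω_{pr} Γ^{ri}_{(k} Γ^{pj}_{l)}`, written `S.c e x i j k l`; round
brackets denote the symmetric part. -/
def c (S : FedosovStructure n M) (e : OpenPartialHomeomorph M (Coord n)) (x : Coord n)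
    (i j k l : Fin n) : ℝ :=
  (pd l (fun y => S.Γup e y i j k) x + pd k (fun y => S.Γup e y i j l) x) / 2
    - ∑ p, ∑ r, S.lower e x p r *
        ((S.Γup e x r i k * S.Γup e x p j l + S.Γup e x r i l * S.Γup e x p j k) / 2)

/-- The degree 2 operator in the coordinates of the chart `e`,
`P^{ij} = ω^{ij} (d/dx)² + 2 Γ^{ij}_k u^k_x d/dx + c^{ij}_{kl} u^k_x u^l_x + Γ^{ij}_k u^k_{xx}`. -/
def operator (S : FedosovStructure n M) (e : OpenPartialHomeomorph M (Coord n)) :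
    LoopOperator n :=
  fun u ξ x i => ∑ j,
    (S.upper e (u x) i j * iteratedDeriv 2 (fun y => ξ y j) x
      + 2 * (∑ k, S.Γup e (u x) i j k * deriv (fun y => u y k) x) * deriv (fun y => ξ y j) x
      + ((∑ k, ∑ l, S.c e (u x) i j k l * deriv (fun y => u y k) x * deriv (fun y => u y l) x)
          + ∑ k, S.Γup e (u x) i j k * iteratedDeriv 2 (fun y => u y k) x) * ξ x j)

end FedosovStructure

section Pencil

variable {n : ℕ} {M : Type*} [TopologicalSpace M] [ChartedSpace (Coord n) M]
  [IsManifold (𝓡 n) ∞ M]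

/-- The operators `P₁`, `P₂` of two Fedosov structures are compatible: every linear combination of
them is a Hamiltonian operator (in every coordinate system of `M`). -/
def Compatible (S₁ S₂ : FedosovStructure n M) : Prop :=
  ∀ e ∈ IsManifold.maximalAtlas (𝓡 n) ∞ M, ∀ μ ν : ℝ,
    IsHamiltonian e.target (μ • S₁.operator e + ν • S₂.operator e)

/-- `Δ^{sjk} = ω₂^{jr} Γ₁^{sk}_r - ω₁^{sr} Γ₂^{jk}_r`. -/
def Δup (S₁ S₂ : FedosovStructure n M) (e : OpenPartialHomeomorph M (Coord n)) (x : Coord n)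
    (s j k : Fin n) : ℝ :=
  ∑ r, (S₂.upper e x j r * S₁.Γup e x s k r - S₁.upper e x s r * S₂.Γup e x j k r)

/-- `Δ^{jk}_i = ω_{2is} Δ^{sjk}`, written `Δ S₁ S₂ e x j k i`. -/
def Δ (S₁ S₂ : FedosovStructure n M) (e : OpenPartialHomeomorph M (Coord n)) (x : Coord n)
    (j k i : Fin n) : ℝ :=
  ∑ s, S₂.lower e x i s * Δup S₁ S₂ e x s j k

/-- The multiplication of covectors, `(α ∘ β)_i = α_j β_k Δ^{jk}_i`. -/
def circ (S₁ S₂ : FedosovStructure n M) (e : OpenPartialHomeomorph M (Coord n)) (x : Coord n)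
    (α β : Fin n → ℝ) : Fin n → ℝ :=
  fun i => ∑ j, ∑ k, α j * β k * Δ S₁ S₂ e x j k i

/-- The bilinear form on covectors `(α, β) = α_r β_s ω^{rs}`. -/
def pairing (S : FedosovStructure n M) (e : OpenPartialHomeomorph M (Coord n)) (x : Coord n)
    (α β : Fin n → ℝ) : ℝ :=
  ∑ r, ∑ s, α r * β s * S.upper e x r s

/-- The covariant derivative `∇²_l Δ^{ij}_k` with respect to the connection of `S₂`, written
`covΔ S₁ S₂ e x l i j k`. -/
def covΔ (S₁ S₂ : FedosovStructure n M) (e : OpenPartialHomeomorph M (Coord n)) (x : Coord n)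
    (l i j k : Fin n) : ℝ :=
  pd l (fun y => Δ S₁ S₂ e y i j k) x
    + ∑ r, S₂.Γ e x i l r * Δ S₁ S₂ e x r j k
    + ∑ r, S₂.Γ e x j l r * Δ S₁ S₂ e x i r k
    - ∑ r, S₂.Γ e x r l k * Δ S₁ S₂ e x i j r

end Pencil

end Degree2

end

/-! Write W for the bivector ω^{ij}, ♯ for the map from covectors to vectors that it defines, and
∇_x for the covariant derivative of covectors along a loop. For a flat Fedosov structure the
operator is ♯∇_x∇_x (`operator_eq_flatOp`). Since W is parallel, one integration by parts turns its
bilinear form into -∫ W(∇_x ξ, ∇_x η) dx, which is of first order and visibly skew.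

The variation of a bracket {F, G} contains second variations of F and G. These are symmetric, so
they cancel in the cyclic Jacobi sum (`IsFirstOrderForm.jacobi_sum`). What survives is the
derivative of ∫ ξ P η in the loop, with ξ and η frozen, in the direction P ζ. Every smooth periodic
covector function is a variational derivative, so the Jacobi identity becomes an identity in
arbitrary ξ, η, ζ (`IsFirstOrderForm.isHamiltonian_iff`). Flatness makes that derivative algebraic
in the direction of variation (`FlatData.hasDerivAt_opForm`). For the pencil, the coefficients of μ²
and ν² then vanish because the connections are torsion-free, and compatibility means that the
coefficient of μν integrates to zero (`pencil_isHamiltonian_iff`). This coefficient is built from A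
= Γ₁ - Γ₂ through T(p, q, ξ) = ⟨A(♯₁p)ξ, ♯₂q⟩, which is `obstruction`.

The link with the multiplication is (I, J ∘ K)₂ = -T(I, J, K). The first identity of the theorem is
therefore the symmetry of T in p and q, and it implies J ∘ K = A(♯₁J)K, so that the second identity
reads A(♯₁ A(v)J)K = 0.

Sufficiency: the two identities make all covectors A(v)J mutually orthogonal for W₂
(`AlgebraicConditions.form_eq_zero`). Modulo such covectors, ∇¹_x∇¹_x η and ∇²_x∇²_x η differ by one
derivative term. Differentiating the orthogonality and using both curvature identities shows that
its pairing with q ∘ ξ is symmetric in η and ξ (`AlgebraicConditions.form_diffDeriv_symm`). The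
Jacobi integrand then cancels pointwise.

Necessity: constant loops with cosine test functions give the symmetry of T
(`MixedVanish.obstruction_symm`). Loops x₀ + δ s(x) v, expanded to first order in δ and tested on
trigonometric functions, give T(A(v)J, K, I) = 0 (`MixedVanish.obstruction_diff_eq_zero`), which is
the second identity because ♯₂ is onto.

The symmetry of ∇²Δ follows by differentiating Δ^{ij}_k = (A(♯₁e^i)e^j)_k. The nilpotency identity
replaces Γ₂ by Γ₁ where necessary, and the torsion-free and flatness equations of both connections
do the rest (`AlgebraicConditions.dot_covDeriv_prod_symm`). -/

noncomputable section

namespace Degree2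

open MeasureTheory Filter Topology Set

/-! ### Smooth periodic functions -/

/-- `f` is smooth and 1-periodic. -/
def SmoothPeriodic {F : Type*} [NormedAddCommGroup F] [NormedSpace ℝ F] (f : ℝ → F) : Prop :=
  ContDiff ℝ ∞ f ∧ Function.Periodic f 1

section SmoothPeriodic

variable {F : Type*} [NormedAddCommGroup F] [NormedSpace ℝ F]
variable {S : Type*} [NormedAddCommGroup S] [NormedSpace ℝ S]

theorem periodic_deriv {f : ℝ → F} {c : ℝ} (hf : Function.Periodic f c) :
    Function.Periodic (deriv f) c := by
  intro x
  have h : (fun y => f (y + c)) = f := funext hf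
  rw [← deriv_comp_add_const, h]

theorem contDiff_deriv {f : ℝ → F} (hf : ContDiff ℝ ∞ f) : ContDiff ℝ ∞ (deriv f) :=
  (contDiff_infty_iff_deriv.1 hf).2

namespace SmoothPeriodic

theorem differentiable {f : ℝ → F} (hf : SmoothPeriodic f) : Differentiable ℝ f :=
  hf.1.differentiable (by simp)

theorem continuous {f : ℝ → F} (hf : SmoothPeriodic f) : Continuous f := hf.1.continuous

theorem hasDerivAt {f : ℝ → F} (hf : SmoothPeriodic f) (x : ℝ) : HasDerivAt f (deriv f x) x :=
  (hf.differentiable x).hasDerivAt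

theorem deriv {f : ℝ → F} (hf : SmoothPeriodic f) : SmoothPeriodic (deriv f) :=
  ⟨contDiff_deriv hf.1, periodic_deriv hf.2⟩

theorem iteratedDeriv {f : ℝ → F} (hf : SmoothPeriodic f) (k : ℕ) :
    SmoothPeriodic (iteratedDeriv k f) := by
  induction k with
  | zero => simpa using hf
  | succ k ih => rw [iteratedDeriv_succ]; exact ih.deriv

theorem const (c : F) : SmoothPeriodic (fun _ : ℝ => c) := ⟨contDiff_const, fun _ => rfl⟩

theorem add {f g : ℝ → F} (hf : SmoothPeriodic f) (hg : SmoothPeriodic g) :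
    SmoothPeriodic (fun x => f x + g x) :=
  ⟨hf.1.add hg.1, fun x => by simp only [hf.2 x, hg.2 x]⟩

theorem sub {f g : ℝ → F} (hf : SmoothPeriodic f) (hg : SmoothPeriodic g) :
    SmoothPeriodic (fun x => f x - g x) :=
  ⟨hf.1.sub hg.1, fun x => by simp only [hf.2 x, hg.2 x]⟩

theorem smul {f : ℝ → ℝ} {g : ℝ → F} (hf : SmoothPeriodic f) (hg : SmoothPeriodic g) :
    SmoothPeriodic (fun x => f x • g x) :=
  ⟨hf.1.smul hg.1, fun x => by simp only [hf.2 x, hg.2 x]⟩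

theorem mul {f g : ℝ → ℝ} (hf : SmoothPeriodic f) (hg : SmoothPeriodic g) :
    SmoothPeriodic (fun x => f x * g x) :=
  ⟨hf.1.mul hg.1, fun x => by simp only [hf.2 x, hg.2 x]⟩

theorem sum {ι : Type*} {s : Finset ι} {f : ι → ℝ → F} (hf : ∀ i ∈ s, SmoothPeriodic (f i)) :
    SmoothPeriodic (fun x => ∑ i ∈ s, f i x) :=
  ⟨ContDiff.sum fun i hi => (hf i hi).1, fun x => Finset.sum_congr rfl fun i hi => (hf i hi).2 x⟩

theorem clm_comp {G : Type*} [NormedAddCommGroup G] [NormedSpace ℝ G] (L : F →L[ℝ] G) {f : ℝ → F}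
    (hf : SmoothPeriodic f) : SmoothPeriodic (fun x => L (f x)) :=
  ⟨L.contDiff.comp hf.1, fun x => by simp only [hf.2 x]⟩

theorem clm_apply {G : Type*} [NormedAddCommGroup G] [NormedSpace ℝ G] {L : ℝ → F →L[ℝ] G}
    {f : ℝ → F} (hL : SmoothPeriodic L) (hf : SmoothPeriodic f) :
    SmoothPeriodic (fun x => L x (f x)) :=
  ⟨hL.1.clm_apply hf.1, fun x => by simp only [hf.2 x, hL.2 x]⟩

theorem pi_iff {ι : Type*} [Fintype ι] {f : ℝ → ι → F} :
    SmoothPeriodic f ↔ ∀ i, SmoothPeriodic (fun x => f x i) := by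
  constructor
  · intro h i
    exact ⟨contDiff_pi.1 h.1 i, fun x => congrFun (h.2 x) i⟩
  · intro h
    exact ⟨contDiff_pi.2 fun i => (h i).1, fun x => funext fun i => (h i).2 x⟩

/-- The integral of a derivative over the circle vanishes. -/
theorem integral_deriv_eq_zero [CompleteSpace F] {f : ℝ → F} (hf : SmoothPeriodic f) :
    ∫ x in (0 : ℝ)..1, _root_.deriv f x = 0 := by
  rw [intervalIntegral.integral_deriv_eq_sub (fun x _ => hf.differentiable x)
    (hf.deriv.continuous.intervalIntegrable _ _)]
  have := hf.2 0
  rw [zero_add] at this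
  rw [this, sub_self]

theorem integral_mul_deriv {f g : ℝ → ℝ} (hf : SmoothPeriodic f) (hg : SmoothPeriodic g) :
    ∫ x in (0 : ℝ)..1, f x * _root_.deriv g x = -∫ x in (0 : ℝ)..1, _root_.deriv f x * g x := by
  have h := (hf.mul hg).integral_deriv_eq_zero
  have h2 : _root_.deriv (fun x => f x * g x)
      = fun x => _root_.deriv f x * g x + f x * _root_.deriv g x := by
    funext x
    exact ((hf.hasDerivAt x).mul (hg.hasDerivAt x)).deriv
  rw [h2, intervalIntegral.integral_add] at h
  · linarith
  · exact (hf.deriv.mul hg).continuous.intervalIntegrable _ _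
  · exact (hf.mul hg.deriv).continuous.intervalIntegrable _ _

theorem integral_mul_iteratedDeriv {f g : ℝ → ℝ} (hf : SmoothPeriodic f) (hg : SmoothPeriodic g)
    (k : ℕ) : ∫ x in (0 : ℝ)..1, f x * _root_.iteratedDeriv k g x
      = ∫ x in (0 : ℝ)..1, (-1) ^ k * _root_.iteratedDeriv k f x * g x := by
  induction k generalizing f with
  | zero => simp
  | succ k ih =>
    simp_rw [iteratedDeriv_succ (f := g)]
    rw [integral_mul_deriv hf (hg.iteratedDeriv k), ih hf.deriv, ← intervalIntegral.integral_neg]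
    simp_rw [iteratedDeriv_succ' (f := f)]
    congr 1
    funext x
    ring

/-- The test function v = f - g makes the integral of a sum of squares vanish. This gives uniqueness
of variational derivatives. -/
theorem eq_of_integral_mul_eq {ι : Type*} [Fintype ι] {f g : ℝ → ι → ℝ}
    (hf : SmoothPeriodic f) (hg : SmoothPeriodic g)
    (h : ∀ v : ℝ → ι → ℝ, SmoothPeriodic v →
      ∫ x in (0 : ℝ)..1, ∑ i, f x i * v x i = ∫ x in (0 : ℝ)..1, ∑ i, g x i * v x i) : f = g := by
  have hd := hf.sub hg
  have hi : ∀ {a b : ℝ → ι → ℝ}, SmoothPeriodic a → SmoothPeriodic b →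
      SmoothPeriodic (fun x => ∑ i, a x i * b x i) := fun ha hb =>
    SmoothPeriodic.sum fun i _ => ((pi_iff.1 ha) i).mul ((pi_iff.1 hb) i)
  have h0 : ∫ x in (0 : ℝ)..1, ∑ i, (f x - g x) i * (f x - g x) i = 0 := by
    have := h _ hd
    rw [← sub_eq_zero, ← intervalIntegral.integral_sub
      ((hi hf hd).continuous.intervalIntegrable _ _)
      ((hi hg hd).continuous.intervalIntegrable _ _)] at this
    rw [← this]
    congr 1
    funext x
    rw [← Finset.sum_sub_distrib]
    refine Finset.sum_congr rfl fun i _ => ?_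
    simp only [Pi.sub_apply]
    ring
  have hc := (hi hd hd).continuous
  have hper := (hi hd hd).2
  have hnn : ∀ x, 0 ≤ ∑ i, (f x - g x) i * (f x - g x) i := fun x =>
    Finset.sum_nonneg fun i _ => mul_self_nonneg _
  have hz : ∀ x ∈ Icc (0 : ℝ) 1, ∑ i, (f x - g x) i * (f x - g x) i = 0 := by
    intro x hx
    by_contra hne
    have hpos : 0 < ∑ i, (f x - g x) i * (f x - g x) i := lt_of_le_of_ne (hnn x) (Ne.symm hne)
    have := intervalIntegral.integral_pos (zero_lt_one (α := ℝ)) hc.continuousOn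
      (fun y _ => hnn y) ⟨x, hx, hpos⟩
    linarith
  have hall : ∀ x, ∑ i, (f x - g x) i * (f x - g x) i = 0 := by
    intro x
    obtain ⟨y, hy, hxy⟩ := hper.exists_mem_Ico₀ zero_lt_one x
    rw [hxy]
    exact hz y ⟨hy.1, hy.2.le⟩
  funext x i
  have := (Finset.sum_eq_zero_iff_of_nonneg fun i _ => mul_self_nonneg _).1 (hall x) i
    (Finset.mem_univ i)
  have := mul_self_eq_zero.1 this
  simpa [sub_eq_zero] using this

end SmoothPeriodic

/-! ### Dependence on parameters -/

/-- Differentiation under the integral sign for a jointly smooth integrand. -/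
theorem hasFDerivAt_integral_param [ProperSpace S] {Φ : S × ℝ → ℝ} (hΦ : ContDiff ℝ 1 Φ) (s₀ : S) :
    HasFDerivAt (fun s => ∫ x in (0 : ℝ)..1, Φ (s, x))
      (∫ x in (0 : ℝ)..1, (fderiv ℝ Φ (s₀, x)).comp (ContinuousLinearMap.inl ℝ S ℝ)) s₀ := by
  have hfc : Continuous (fderiv ℝ Φ) := hΦ.continuous_fderiv (by simp)
  have hF' : Continuous fun z : S × ℝ =>
      (fderiv ℝ Φ z).comp (ContinuousLinearMap.inl ℝ S ℝ) := hfc.clm_comp continuous_const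
  obtain ⟨C, hC⟩ := ((isCompact_closedBall s₀ 1).prod
    (isCompact_Icc (a := (0 : ℝ)) (b := 1))).exists_bound_of_continuousOn hF'.continuousOn
  refine intervalIntegral.hasFDerivAt_integral_of_dominated_of_fderiv_le
    (F' := fun s x => (fderiv ℝ Φ (s, x)).comp (ContinuousLinearMap.inl ℝ S ℝ))
    (bound := fun _ => C) (Metric.closedBall_mem_nhds s₀ zero_lt_one) ?_ ?_ ?_ ?_ ?_ ?_
  · refine Eventually.of_forall fun s => ?_
    exact (hΦ.continuous.comp (by fun_prop : Continuous fun x : ℝ => (s, x))).aestronglyMeasurable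
  · exact (hΦ.continuous.comp
      (by fun_prop : Continuous fun x : ℝ => (s₀, x))).intervalIntegrable _ _
  · exact (hF'.comp (by fun_prop : Continuous fun x : ℝ => (s₀, x))).aestronglyMeasurable
  · refine Eventually.of_forall fun t ht s hs => hC (s, t) ⟨hs, ?_⟩
    rw [uIoc_of_le zero_le_one] at ht
    exact ⟨ht.1.le, ht.2⟩
  · exact intervalIntegrable_const
  · refine Eventually.of_forall fun t _ s _ => ?_
    have h1 : HasFDerivAt Φ (fderiv ℝ Φ (s, t)) (s, t) :=
      (hΦ.differentiable (by simp) _).hasFDerivAt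
    exact h1.comp s (hasFDerivAt_prodMk_left s t)

theorem hasDerivAt_integral_param {Φ : ℝ × ℝ → ℝ} (hΦ : ContDiff ℝ 1 Φ) (s₀ : ℝ) :
    HasDerivAt (fun s => ∫ x in (0 : ℝ)..1, Φ (s, x))
      (∫ x in (0 : ℝ)..1, deriv (fun s => Φ (s, x)) s₀) s₀ := by
  have h := (hasFDerivAt_integral_param hΦ s₀).hasDerivAt
  convert h using 1
  have hF' : Continuous fun x : ℝ =>
      (fderiv ℝ Φ (s₀, x)).comp (ContinuousLinearMap.inl ℝ ℝ ℝ) :=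
    ((hΦ.continuous_fderiv (by simp)).comp
      (by fun_prop : Continuous fun x : ℝ => (s₀, x))).clm_comp continuous_const
  rw [ContinuousLinearMap.intervalIntegral_apply (hF'.intervalIntegrable _ _)]
  congr 1
  funext x
  have h1 : HasFDerivAt Φ (fderiv ℝ Φ (s₀, x)) (s₀, x) :=
    (hΦ.differentiable (by simp) _).hasFDerivAt
  exact (h1.comp s₀ (hasFDerivAt_prodMk_left s₀ x)).hasDerivAt.deriv

/-- A partial derivative is the total derivative evaluated on a constant vector, hence smooth
jointly in parameter and variable. -/
theorem contDiff_deriv_param {Φ : S × ℝ → F} (hΦ : ContDiff ℝ ∞ Φ) :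
    ContDiff ℝ ∞ fun z : S × ℝ => deriv (fun y => Φ (z.1, y)) z.2 := by
  have h : (fun z : S × ℝ => deriv (fun y => Φ (z.1, y)) z.2)
      = fun z => fderiv ℝ Φ z ((0 : S), (1 : ℝ)) := by
    funext z
    have h1 : HasFDerivAt Φ (fderiv ℝ Φ z) (z.1, z.2) :=
      (hΦ.differentiable (by simp) _).hasFDerivAt
    simpa [Function.comp_def] using
      (h1.comp z.2 (hasFDerivAt_prodMk_right z.1 z.2)).hasDerivAt.deriv
  rw [h]
  exact (hΦ.fderiv_right (by simp)).clm_apply contDiff_const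

theorem contDiff_deriv_param_left {Φ : ℝ × S → F} (hΦ : ContDiff ℝ ∞ Φ) :
    ContDiff ℝ ∞ fun z : ℝ × S => deriv (fun y => Φ (y, z.2)) z.1 := by
  have h : (fun z : ℝ × S => deriv (fun y => Φ (y, z.2)) z.1)
      = fun z => fderiv ℝ Φ z ((1 : ℝ), (0 : S)) := by
    funext z
    have h1 : HasFDerivAt Φ (fderiv ℝ Φ z) (z.1, z.2) :=
      (hΦ.differentiable (by simp) _).hasFDerivAt
    simpa [Function.comp_def] using
      (h1.comp z.1 (hasFDerivAt_prodMk_left z.1 z.2)).hasDerivAt.deriv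
  rw [h]
  exact (hΦ.fderiv_right (by simp)).clm_apply contDiff_const

theorem contDiff_iteratedDeriv_param {Φ : S × ℝ → F} (hΦ : ContDiff ℝ ∞ Φ) (k : ℕ) :
    ContDiff ℝ ∞ fun z : S × ℝ => iteratedDeriv k (fun y => Φ (z.1, y)) z.2 := by
  induction k generalizing Φ with
  | zero => simpa using hΦ
  | succ k ih =>
    simp_rw [iteratedDeriv_succ']
    exact ih (contDiff_deriv_param hΦ)

end SmoothPeriodic

/-! ### Loops in open sets -/

section Cutoff

variable {E : Type*} [NormedAddCommGroup E] [NormedSpace ℝ E]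

theorem isCompact_range_of_periodic {E : Type*} [TopologicalSpace E] {u : ℝ → E} (hu : Continuous u)
    (hp : Function.Periodic u 1) : IsCompact (range u) := by
  have h : range u = u '' Icc 0 1 := by
    ext y
    constructor
    · rintro ⟨x, rfl⟩
      obtain ⟨z, hz, hxz⟩ := hp.exists_mem_Ico₀ zero_lt_one x
      exact ⟨z, ⟨hz.1, hz.2.le⟩, hxz.symm⟩
    · rintro ⟨x, _, rfl⟩
      exact ⟨x, rfl⟩
  rw [h]
  exact isCompact_Icc.image hu

/-- Small perturbations of a loop in an open set remain in that set. -/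
theorem eventually_forall_add_smul_mem {V : Set E} (hV : IsOpen V) {u v : ℝ → E}
    (hu : SmoothPeriodic u) (hv : SmoothPeriodic v) (huV : ∀ x, u x ∈ V) :
    ∀ᶠ s in 𝓝 (0 : ℝ), ∀ x, u x + s • v x ∈ V := by
  have hc : Continuous fun z : ℝ × ℝ => u z.2 + z.1 • v z.2 := by
    have := hu.continuous
    have := hv.continuous
    fun_prop
  -- Compactness of one period makes the bound on s uniform in x.
  have h := (isCompact_Icc (a := (0 : ℝ)) (b := 1)).eventually_forall_of_forall_eventually
    (x₀ := (0 : ℝ)) (P := fun s x => u x + s • v x ∈ V) (fun x _ => by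
      refine (hV.preimage hc).mem_nhds ?_
      simpa using huV x)
  filter_upwards [h] with s hs x
  have hp : Function.Periodic (fun x => u x + s • v x) 1 := fun x => by
    simp only [hu.2 x, hv.2 x]
  obtain ⟨y, hy, hxy⟩ := hp.exists_mem_Ico₀ zero_lt_one x
  rw [hxy]
  exact hs y ⟨hy.1, hy.2.le⟩

/-- A smooth function equal to one near a compact subset of an open set `U` and supported in
`U`. -/
theorem exists_cutoff [FiniteDimensional ℝ E] {K U : Set E} (hK : IsCompact K) (hU : IsOpen U)
    (hKU : K ⊆ U) : ∃ (V : Set E) (χ : E → ℝ), IsOpen V ∧ K ⊆ V ∧ V ⊆ U ∧ ContDiff ℝ ∞ χ ∧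
      (∀ x ∈ V, χ x = 1) ∧ tsupport χ ⊆ U := by
  obtain ⟨δ, hδ, hδU⟩ := hK.exists_cthickening_subset_open hU hKU
  obtain ⟨χ, hχ, -, hs, ht⟩ := exists_contMDiff_support_eq_eq_one_iff (n := ⊤) 𝓘(ℝ, E)
    (Metric.isOpen_thickening (δ := δ) (E := K))
    (Metric.isClosed_cthickening (δ := δ / 2) (E := K))
    (Metric.cthickening_subset_thickening' hδ (by linarith) K)
  refine ⟨Metric.thickening (δ / 2) K, χ, Metric.isOpen_thickening,
    Metric.self_subset_thickening (by linarith) K, ?_, hχ.contDiff, fun x hx => ?_, ?_⟩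
  · exact (Metric.thickening_subset_cthickening _ _).trans
      ((Metric.cthickening_mono (by linarith) K).trans hδU)
  · exact (ht x).1 (Metric.thickening_subset_cthickening _ _ hx)
  · rw [tsupport, hs]
    exact (Metric.closure_thickening_subset_cthickening δ K).trans hδU

/-- Over U both factors are smooth; off U the cutoff vanishes in a neighbourhood, so the values of
`h` there are irrelevant. Densities known only over U thereby extend to globally smooth ones. -/
theorem contDiff_cutoff_smul {X F : Type*} [NormedAddCommGroup X] [NormedSpace ℝ X]
    [NormedAddCommGroup F] [NormedSpace ℝ F] {U : Set E} (hU : IsOpen U) {χ : E → ℝ}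
    (hχ : ContDiff ℝ ∞ χ) (hs : tsupport χ ⊆ U) {π : X → E} (hπ : ContDiff ℝ ∞ π) {h : X → F}
    (hh : ContDiffOn ℝ ∞ h {q | π q ∈ U}) : ContDiff ℝ ∞ fun q => χ (π q) • h q := by
  rw [contDiff_iff_contDiffAt]
  intro q
  by_cases hq : π q ∈ U
  · exact (hχ.comp hπ).contDiffAt.smul
      (hh.contDiffAt ((hU.preimage hπ.continuous).mem_nhds hq))
  · have hq' : π q ∈ (tsupport χ)ᶜ := fun hc => hq (hs hc)
    have : ∀ᶠ p in 𝓝 q, χ (π p) • h p = 0 := by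
      filter_upwards [((isClosed_tsupport χ).isOpen_compl.preimage hπ.continuous).mem_nhds hq']
        with p hp
      rw [image_eq_zero_of_notMem_tsupport hp, zero_smul]
    exact (contDiffAt_const (c := (0 : F))).congr_of_eventuallyEq this

end Cutoff

/-! ### Variational derivatives of local functionals -/

theorem iteratedDeriv_clm_comp {F G : Type*} [NormedAddCommGroup F] [NormedSpace ℝ F]
    [NormedAddCommGroup G] [NormedSpace ℝ G] (L : F →L[ℝ] G) {f : ℝ → F} (hf : ContDiff ℝ ∞ f)
    (k : ℕ) : iteratedDeriv k (fun x => L (f x)) = fun x => L (iteratedDeriv k f x) := by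
  induction k generalizing f with
  | zero => simp
  | succ k ih =>
    rw [iteratedDeriv_succ', iteratedDeriv_succ', ← ih (contDiff_deriv hf)]
    congr 1
    funext x
    exact (L.hasFDerivAt.comp_hasDerivAt x
      (hf.differentiable (by simp) x).hasDerivAt).deriv

section Functional

variable {n : ℕ}

theorem isLoop_univ_iff {v : ℝ → Coord n} : IsLoop univ v ↔ SmoothPeriodic v := by
  simp [IsLoop, SmoothPeriodic]

theorem IsLoop.smoothPeriodic {U : Set (Coord n)} {u : ℝ → Coord n} (hu : IsLoop U u) :
    SmoothPeriodic u := ⟨hu.1, hu.2.1⟩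

theorem IsLoop.mono {U V : Set (Coord n)} (h : V ⊆ U) {u : ℝ → Coord n} (hu : IsLoop V u) :
    IsLoop U u := ⟨hu.1, hu.2.1, fun x => h (hu.2.2 x)⟩

theorem eventually_isLoop {V : Set (Coord n)} (hV : IsOpen V) {u v : ℝ → Coord n}
    (hu : IsLoop V u) (hv : SmoothPeriodic v) : ∀ᶠ s in 𝓝 (0 : ℝ), IsLoop V (u + s • v) := by
  filter_upwards [eventually_forall_add_smul_mem hV hu.smoothPeriodic hv hu.2.2] with s hs
  have h := hu.smoothPeriodic.add ((SmoothPeriodic.const s).smul hv)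
  exact ⟨h.1, h.2, hs⟩

/-- The jet `(u, u_x, …, u^{(k)})`. -/
def jet (k : ℕ) (u : ℝ → Coord n) (x : ℝ) : Fin (k + 1) → Coord n :=
  fun s => iteratedDeriv (s : ℕ) u x

theorem smoothPeriodic_jet (k : ℕ) {u : ℝ → Coord n} (hu : SmoothPeriodic u) :
    SmoothPeriodic (jet k u) :=
  SmoothPeriodic.pi_iff.2 fun s => hu.iteratedDeriv s

theorem jet_add_smul (k : ℕ) {u v : ℝ → Coord n} (hu : SmoothPeriodic u) (hv : SmoothPeriodic v)
    (s x : ℝ) : jet k (u + s • v) x = jet k u x + s • jet k v x := by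
  funext j
  have h1 : ContDiffAt ℝ (j : ℕ) u x := (hu.1.of_le (by exact_mod_cast le_top)).contDiffAt
  have h2 : ContDiffAt ℝ (j : ℕ) v x := (hv.1.of_le (by exact_mod_cast le_top)).contDiffAt
  simp only [jet, Pi.add_apply, Pi.smul_apply]
  have h3 : iteratedDeriv (j : ℕ) (s • v) x = s • iteratedDeriv (j : ℕ) v x :=
    iteratedDeriv_const_smul h2 s
  rw [← h3]
  exact iteratedDeriv_add h1 (h2.const_smul s)

/-- `h` is the density of a local functional, smooth on the whole jet space. -/
structure IsDensity (k : ℕ) (h : ℝ × (Fin (k + 1) → Coord n) → ℝ) : Prop where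
  contDiff : ContDiff ℝ ∞ h
  periodic : ∀ x w, h (x + 1, w) = h (x, w)

/-- `∫ h(x, u, u_x, …, u^{(k)}) dx`. -/
def localFunctional (k : ℕ) (h : ℝ × (Fin (k + 1) → Coord n) → ℝ) (u : ℝ → Coord n) : ℝ :=
  ∫ x in (0 : ℝ)..1, h (x, jet k u x)

/-- The partial derivative `∂h/∂u^i_{(s)}`. -/
def partialDensity {k : ℕ} (h : ℝ × (Fin (k + 1) → Coord n) → ℝ) (s : Fin (k + 1)) (i : Fin n)
    (q : ℝ × (Fin (k + 1) → Coord n)) : ℝ :=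
  fderiv ℝ h q (0, Pi.single s (EuclideanSpace.single i 1))

/-- The Euler–Lagrange expression `∑ (-d/dx)^s (∂h/∂u^i_{(s)})`. -/
def eulerLagrange (k : ℕ) (h : ℝ × (Fin (k + 1) → Coord n) → ℝ) (u : ℝ → Coord n) (x : ℝ)
    (i : Fin n) : ℝ :=
  ∑ s : Fin (k + 1), (-1) ^ (s : ℕ) *
    iteratedDeriv (s : ℕ) (fun y => partialDensity h s i (y, jet k u y)) x

/-- The first variation of `localFunctional k h` at `u` in the direction `v`. -/
def firstVariation (k : ℕ) (h : ℝ × (Fin (k + 1) → Coord n) → ℝ) (u v : ℝ → Coord n) : ℝ :=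
  ∫ x in (0 : ℝ)..1, fderiv ℝ h (x, jet k u x) (0, jet k v x)

/-- The second variation of `localFunctional k h` at `u`. -/
def secondVariation (k : ℕ) (h : ℝ × (Fin (k + 1) → Coord n) → ℝ) (u v w : ℝ → Coord n) : ℝ :=
  ∫ x in (0 : ℝ)..1, fderiv ℝ (fderiv ℝ h) (x, jet k u x) (0, jet k v x) (0, jet k w x)

variable {k : ℕ} {h : ℝ × (Fin (k + 1) → Coord n) → ℝ} {u v w : ℝ → Coord n}

theorem fderiv_periodic {F : Type*} [NormedAddCommGroup F] [NormedSpace ℝ F]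
    {X : Type*} [NormedAddCommGroup X] [NormedSpace ℝ X] {g : ℝ × X → F}
    (hg : ∀ x w, g (x + 1, w) = g (x, w)) (x : ℝ) (w : X) :
    fderiv ℝ g (x + 1, w) = fderiv ℝ g (x, w) := by
  have h1 : (fun z : ℝ × X => g (z + (1, 0))) = g := by
    funext z
    have := hg z.1 z.2
    simpa [Prod.add_def] using this
  have h2 := fderiv_comp_add_right (𝕜 := ℝ) (f := g) (x := (x, w)) ((1, 0) : ℝ × X)
  rw [h1] at h2
  rw [h2]
  simp

theorem smoothPeriodic_comp_jet {F : Type*} [NormedAddCommGroup F] [NormedSpace ℝ F]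
    {g : ℝ × (Fin (k + 1) → Coord n) → F} (hg : ContDiff ℝ ∞ g)
    (hp : ∀ x w, g (x + 1, w) = g (x, w)) (hu : SmoothPeriodic u) :
    SmoothPeriodic fun x => g (x, jet k u x) := by
  refine ⟨hg.comp (contDiff_id.prodMk (smoothPeriodic_jet k hu).1), fun x => ?_⟩
  simp only [(smoothPeriodic_jet k hu).2 x, hp]

theorem IsDensity.partialDensity (hh : IsDensity k h) (s : Fin (k + 1)) (i : Fin n) :
    IsDensity k (partialDensity h s i) where
  contDiff := (hh.contDiff.fderiv_right (by simp)).clm_apply contDiff_const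
  periodic x w := by simp only [Degree2.partialDensity, fderiv_periodic hh.periodic]

theorem IsDensity.firstVariation (hh : IsDensity k h) (hw : SmoothPeriodic w) :
    IsDensity k fun q => fderiv ℝ h q (0, jet k w q.1) where
  contDiff := (hh.contDiff.fderiv_right (by simp)).clm_apply
    (contDiff_const.prodMk ((smoothPeriodic_jet k hw).1.comp contDiff_fst))
  periodic x v := by
    simp only [fderiv_periodic hh.periodic, (smoothPeriodic_jet k hw).2 x]

theorem smoothPeriodic_eulerLagrange (hh : IsDensity k h) (hu : SmoothPeriodic u) :
    SmoothPeriodic (eulerLagrange k h u) := by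
  refine SmoothPeriodic.pi_iff.2 fun i => SmoothPeriodic.sum fun s _ =>
    (SmoothPeriodic.const _).mul (SmoothPeriodic.iteratedDeriv ?_ _)
  exact smoothPeriodic_comp_jet (hh.partialDensity s i).contDiff (hh.partialDensity s i).periodic hu

theorem fderiv_jet (q : ℝ × (Fin (k + 1) → Coord n)) (hv : SmoothPeriodic v) (x : ℝ) :
    fderiv ℝ h q (0, jet k v x) = ∑ i, ∑ s : Fin (k + 1),
      partialDensity h s i q * iteratedDeriv (s : ℕ) (fun y => v y i) x := by
  have h1 : ((0 : ℝ), jet k v x) = ∑ i, ∑ s : Fin (k + 1),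
      iteratedDeriv (s : ℕ) (fun y => v y i) x •
        ((0 : ℝ), (Pi.single s (EuclideanSpace.single i (1 : ℝ)) : Fin (k + 1) → Coord n)) := by
    ext1
    · simp [Prod.fst_sum]
    · funext s
      ext j
      have hj : iteratedDeriv (s : ℕ) (fun y => v y j) x = iteratedDeriv (s : ℕ) v x j := by
        have := iteratedDeriv_clm_comp (EuclideanSpace.proj j : Coord n →L[ℝ] ℝ) hv.1 (s : ℕ)
        exact congrFun this x
      simp only [Prod.snd_sum, Prod.smul_snd, Finset.sum_apply, Pi.smul_apply, WithLp.ofLp_sum,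
        WithLp.ofLp_smul, jet]
      rw [Finset.sum_eq_single j, Finset.sum_eq_single s]
      · simp [hj]
      · intro b _ hb
        simp [Pi.single_eq_of_ne hb.symm]
      · simp
      · intro b _ hb
        refine Finset.sum_eq_zero fun c _ => ?_
        by_cases hc : s = c
        · subst hc
          simp [hb.symm]
        · simp [Pi.single_eq_of_ne hc]
      · simp
  rw [h1, map_sum]
  refine Finset.sum_congr rfl fun i _ => ?_
  rw [map_sum]
  refine Finset.sum_congr rfl fun s _ => ?_
  rw [map_smul, smul_eq_mul, mul_comm]
  rfl

/-- Each ∂h/∂u_{(s)} is paired with the s-th derivative of the variation; s integrations by parts on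
the circle have no boundary terms and produce the sign (-1)^s. -/
theorem integral_eulerLagrange_mul (hh : IsDensity k h) (hu : SmoothPeriodic u)
    (hv : SmoothPeriodic v) :
    ∫ x in (0 : ℝ)..1, ∑ i, eulerLagrange k h u x i * v x i = firstVariation k h u v := by
  have hvi : ∀ i, SmoothPeriodic fun x => v x i := fun i =>
    hv.clm_comp (EuclideanSpace.proj i : Coord n →L[ℝ] ℝ)
  have hp : ∀ i s, SmoothPeriodic fun y => partialDensity h s i (y, jet k u y) := fun i s =>
    smoothPeriodic_comp_jet (hh.partialDensity s i).contDiff (hh.partialDensity s i).periodic hu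
  simp only [firstVariation, fderiv_jet _ hv, eulerLagrange, Finset.sum_mul]
  have hc1 : ∀ i (s : Fin (k + 1)), SmoothPeriodic fun x => (-1) ^ (s : ℕ) * iteratedDeriv (s : ℕ)
      (fun y => partialDensity h s i (y, jet k u y)) x * v x i := fun i s =>
    ((SmoothPeriodic.const _).mul ((hp i s).iteratedDeriv s)).mul (hvi i)
  have hc2 : ∀ i (s : Fin (k + 1)), SmoothPeriodic fun x =>
      partialDensity h s i (x, jet k u x) * iteratedDeriv (s : ℕ) (fun y => v y i) x := fun i s =>
    (hp i s).mul ((hvi i).iteratedDeriv s)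
  rw [intervalIntegral.integral_finsetSum fun i _ =>
      (SmoothPeriodic.sum fun s _ => hc1 i s).continuous.intervalIntegrable _ _,
    intervalIntegral.integral_finsetSum fun i _ =>
      (SmoothPeriodic.sum fun s _ => hc2 i s).continuous.intervalIntegrable _ _]
  refine Finset.sum_congr rfl fun i _ => ?_
  rw [intervalIntegral.integral_finsetSum fun s _ =>
      (hc1 i s).continuous.intervalIntegrable _ _,
    intervalIntegral.integral_finsetSum fun s _ =>
      (hc2 i s).continuous.intervalIntegrable _ _]
  refine Finset.sum_congr rfl fun s _ => ?_
  rw [(hp i s).integral_mul_iteratedDeriv (hvi i)]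

theorem hasDerivAt_localFunctional (hh : IsDensity k h) (hu : SmoothPeriodic u)
    (hv : SmoothPeriodic v) :
    HasDerivAt (fun s : ℝ => localFunctional k h (u + s • v)) (firstVariation k h u v) 0 := by
  have hΦ : ContDiff ℝ ∞ fun z : ℝ × ℝ => h (z.2, jet k u z.2 + z.1 • jet k v z.2) := by
    have h1 := (smoothPeriodic_jet k hu).1
    have h2 := (smoothPeriodic_jet k hv).1
    exact hh.contDiff.comp (contDiff_snd.prodMk ((h1.comp contDiff_snd).add
      (contDiff_fst.smul (h2.comp contDiff_snd))))
  have hd := hasDerivAt_integral_param (hΦ.of_le (by simp)) 0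
  simp only [localFunctional, jet_add_smul k hu hv]
  convert hd using 1
  simp only [firstVariation]
  congr 1
  funext x
  have h1 : HasFDerivAt h (fderiv ℝ h (x, jet k u x)) (x, jet k u x + (0 : ℝ) • jet k v x) := by
    simpa using (hh.contDiff.differentiable (by simp) (x, jet k u x)).hasFDerivAt
  have h2 : HasDerivAt (fun s : ℝ => (x, jet k u x + s • jet k v x)) (0, jet k v x) 0 := by
    refine (hasDerivAt_const _ _).prodMk ?_
    simpa using ((hasDerivAt_id (0 : ℝ)).smul_const (jet k v x)).const_add (jet k u x)
  exact (h1.comp_hasDerivAt 0 h2).deriv.symm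

/-- For a fixed direction `w` the first variation is itself a local functional, with a density
depending on x through `w`. Its own first variation is the second variation, since varying the loop
leaves x, and hence the jet of `w`, unchanged. -/
theorem hasDerivAt_firstVariation (hh : IsDensity k h) (hu : SmoothPeriodic u)
    (hv : SmoothPeriodic v) (hw : SmoothPeriodic w) :
    HasDerivAt (fun s : ℝ => firstVariation k h (u + s • v) w) (secondVariation k h u v w) 0 := by
  have := hasDerivAt_localFunctional (hh.firstVariation hw) hu hv
  suffices h0 : secondVariation k h u v w
      = firstVariation k (fun q => fderiv ℝ h q (0, jet k w q.1)) u v by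
    rw [h0]
    exact this
  simp only [secondVariation, firstVariation]
  congr 1
  funext x
  have h1 : HasFDerivAt (fderiv ℝ h) (fderiv ℝ (fderiv ℝ h) (x, jet k u x)) (x, jet k u x) :=
    ((hh.contDiff.fderiv_right (m := ∞) (by simp)).differentiable (by simp) _).hasFDerivAt
  have h2 : HasFDerivAt (fun q : ℝ × (Fin (k + 1) → Coord n) => ((0 : ℝ), jet k w q.1))
      ((0 : (ℝ × (Fin (k + 1) → Coord n)) →L[ℝ] ℝ).prod
        ((fderiv ℝ (jet k w) x).comp (ContinuousLinearMap.fst ℝ _ _))) (x, jet k u x) := by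
    refine (hasFDerivAt_const _ _).prodMk ?_
    have h3 : HasFDerivAt (jet k w) (fderiv ℝ (jet k w) x) (x, jet k u x).1 :=
      ((smoothPeriodic_jet k hw).differentiable x).hasFDerivAt
    exact h3.comp (x, jet k u x) hasFDerivAt_fst
  rw [(h1.clm_apply h2).fderiv]
  have h4 : ((0 : ℝ), (0 : Fin (k + 1) → Coord n)) = 0 := rfl
  simp [h4]

theorem secondVariation_symm (hh : IsDensity k h) (u v w : ℝ → Coord n) :
    secondVariation k h u v w = secondVariation k h u w v := by
  simp only [secondVariation]
  congr 1
  funext x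
  have : IsSymmSndFDerivAt ℝ h (x, jet k u x) :=
    hh.contDiff.contDiffAt.isSymmSndFDerivAt
      (by rw [minSmoothness_of_isRCLikeNormedField]; exact WithTop.coe_le_coe.2 le_top)
  exact this.eq _ _

/-- The Euler–Lagrange expression along `u + s v` depends smoothly on `(s, x)`. -/
theorem contDiff_eulerLagrange_param (hh : IsDensity k h) (hu : SmoothPeriodic u)
    (hv : SmoothPeriodic v) :
    ContDiff ℝ ∞ fun z : ℝ × ℝ => eulerLagrange k h (u + z.1 • v) z.2 := by
  refine contDiff_pi.2 fun i => ContDiff.sum fun s _ => contDiff_const.mul ?_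
  have hΦ : ContDiff ℝ ∞ fun z : ℝ × ℝ =>
      partialDensity h s i (z.2, jet k u z.2 + z.1 • jet k v z.2) := by
    have h1 := (smoothPeriodic_jet k hu).1
    have h2 := (smoothPeriodic_jet k hv).1
    exact (hh.partialDensity s i).contDiff.comp (contDiff_snd.prodMk ((h1.comp contDiff_snd).add
      (contDiff_fst.smul (h2.comp contDiff_snd))))
  simp only [jet_add_smul k hu hv]
  exact contDiff_iteratedDeriv_param hΦ s

theorem IsVarDeriv.unique {F : (ℝ → Coord n) → ℝ} {g g' : ℝ → Fin n → ℝ}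
    (hg : IsVarDeriv F u g) (hg' : IsVarDeriv F u g') : g = g' := by
  refine SmoothPeriodic.eq_of_integral_mul_eq ⟨hg.1, hg.2.1⟩ ⟨hg'.1, hg'.2.1⟩ fun v hv => ?_
  have hl : IsLoop univ fun x => (WithLp.toLp 2 (v x) : Coord n) := isLoop_univ_iff.2
    (hv.clm_comp (PiLp.continuousLinearEquiv 2 ℝ fun _ : Fin n => ℝ).symm.toContinuousLinearMap)
  exact (hg.2.2 _ hl).unique (hg'.2.2 _ hl)

/-- `varDeriv` is an arbitrary choice; uniqueness identifies it with any known representative. -/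
theorem IsVarDeriv.varDeriv_eq {F : (ℝ → Coord n) → ℝ} {g : ℝ → Fin n → ℝ}
    (hg : IsVarDeriv F u g) : varDeriv F u = g := by
  have hex : ∃ g, IsVarDeriv F u g := ⟨g, hg⟩
  rw [varDeriv, dif_pos hex]
  exact hex.choose_spec.unique hg

theorem isVarDeriv_of_eq_localFunctional {V : Set (Coord n)} (hV : IsOpen V)
    {F : (ℝ → Coord n) → ℝ} (hh : IsDensity k h)
    (hF : ∀ u, IsLoop V u → F u = localFunctional k h u) (hu : IsLoop V u) :
    IsVarDeriv F u (eulerLagrange k h u) := by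
  have hs := smoothPeriodic_eulerLagrange hh hu.smoothPeriodic
  refine ⟨hs.1, hs.2, fun v hv => ?_⟩
  rw [isLoop_univ_iff] at hv
  rw [integral_eulerLagrange_mul hh hu.smoothPeriodic hv]
  refine (hasDerivAt_localFunctional hh hu.smoothPeriodic hv).congr_of_eventuallyEq ?_
  filter_upwards [eventually_isLoop hV hu hv] with s hs
  exact hF _ hs

/-- Near a given loop, a local functional has a density which is smooth on the whole jet space. -/
theorem IsLocalFunctional.exists_density {U : Set (Coord n)} (hU : IsOpen U)
    {F : (ℝ → Coord n) → ℝ} (hF : IsLocalFunctional U F) (hu : IsLoop U u) :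
    ∃ (V : Set (Coord n)) (k : ℕ) (h : ℝ × (Fin (k + 1) → Coord n) → ℝ), IsOpen V ∧ V ⊆ U ∧
      IsLoop V u ∧ IsDensity k h ∧ ∀ u, IsLoop V u → F u = localFunctional k h u := by
  obtain ⟨k, h, hh, hp, hFh⟩ := hF
  obtain ⟨V, χ, hV, hKV, hVU, hχ, hχ1, hχs⟩ := exists_cutoff
    (isCompact_range_of_periodic hu.1.continuous hu.2.1) hU (range_subset_iff.2 hu.2.2)
  refine ⟨V, k, fun q => χ (q.2 0) • h q, hV, hVU,
    ⟨hu.1, hu.2.1, range_subset_iff.1 hKV⟩, ⟨?_, fun x w => ?_⟩, fun u hu => ?_⟩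
  · exact contDiff_cutoff_smul hU hχ hχs (π := fun q : ℝ × (Fin (k + 1) → Coord n) => q.2 0)
      ((contDiff_apply ℝ (Coord n) 0).comp contDiff_snd) hh
  · simp only [hp]
  · rw [hFh u (hu.mono hVU), localFunctional]
    congr 1
    funext x
    have : χ (jet k u x 0) = 1 := hχ1 _ (by simpa [jet] using hu.2.2 x)
    simp only [this, one_smul]
    rfl

theorem IsLocalFunctional.smoothPeriodic_varDeriv {U : Set (Coord n)} (hU : IsOpen U)
    {F : (ℝ → Coord n) → ℝ} (hF : IsLocalFunctional U F) (hu : IsLoop U u) :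
    SmoothPeriodic (varDeriv F u) := by
  obtain ⟨V, k, h, hV, -, huV, hh, hFh⟩ := hF.exists_density hU hu
  rw [(isVarDeriv_of_eq_localFunctional hV hh hFh huV).varDeriv_eq]
  exact smoothPeriodic_eulerLagrange hh hu.smoothPeriodic

end Functional

/-! ### The Jacobi identity for a differential operator -/

section Jacobi

variable {n : ℕ}

/-- A function with values in `Fin n → ℝ`, viewed as a vector field along a loop. -/
def toVec (ξ : ℝ → Fin n → ℝ) (x : ℝ) : Coord n := WithLp.toLp 2 (ξ x)

theorem SmoothPeriodic.toVec {ξ : ℝ → Fin n → ℝ} (hξ : SmoothPeriodic ξ) :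
    SmoothPeriodic (toVec ξ) :=
  hξ.clm_comp (PiLp.continuousLinearEquiv 2 ℝ fun _ : Fin n => ℝ).symm.toContinuousLinearMap

/-- The bilinear form `∫ ξ_i P^{ij} η_j dx` as a functional of the loop. -/
def opForm (P : LoopOperator n) (ξ η : ℝ → Fin n → ℝ) (u : ℝ → Coord n) : ℝ :=
  ∫ x in (0 : ℝ)..1, ∑ i, ξ x i * P u η x i

/-- The operator `P` is skew-adjoint, preserves smoothness, and its bilinear form is
`∫ q(u, u_x, ξ, ξ_x, η, η_x) dx`. -/
structure IsFirstOrderForm (U : Set (Coord n)) (P : LoopOperator n)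
    (q : Coord n × Coord n × (Fin n → ℝ) × (Fin n → ℝ) × (Fin n → ℝ) × (Fin n → ℝ) → ℝ) :
    Prop where
  contDiffOn : ContDiffOn ℝ ∞ q {z | z.1 ∈ U}
  smoothPeriodic : ∀ u ξ, IsLoop U u → SmoothPeriodic ξ → SmoothPeriodic (P u ξ)
  form_eq : ∀ u ξ η, IsLoop U u → SmoothPeriodic ξ → SmoothPeriodic η →
    opForm P ξ η u = ∫ x in (0 : ℝ)..1, q (u x, deriv u x, ξ x, deriv ξ x, η x, deriv η x)
  skew : ∀ u ξ η, IsLoop U u → SmoothPeriodic ξ → SmoothPeriodic η →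
    opForm P ξ η u = -opForm P η ξ u

theorem bracket_eq_opForm (P : LoopOperator n) (F G : (ℝ → Coord n) → ℝ) (u : ℝ → Coord n) :
    bracket P F G u = opForm P (varDeriv F u) (varDeriv G u) u := rfl

variable {U : Set (Coord n)} {P : LoopOperator n}
  {q : Coord n × Coord n × (Fin n → ℝ) × (Fin n → ℝ) × (Fin n → ℝ) × (Fin n → ℝ) → ℝ}
  {u v : ℝ → Coord n}

/-- With ξ and η frozen, the form depends only on the 1-jet of the loop and explicitly on x.
Densities are allowed to depend on x precisely so that this is a local functional, with a
variational derivative. -/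
theorem IsFirstOrderForm.isLocalFunctional (hP : IsFirstOrderForm U P q)
    {ξ η : ℝ → Fin n → ℝ} (hξ : SmoothPeriodic ξ) (hη : SmoothPeriodic η) :
    IsLocalFunctional U (opForm P ξ η) := by
  refine ⟨1, fun z => q (z.2 0, z.2 1, ξ z.1, deriv ξ z.1, η z.1, deriv η z.1), ?_, ?_, ?_⟩
  · refine hP.contDiffOn.comp (ContDiff.contDiffOn ?_) fun z hz => hz
    have h1 := hξ.1
    have h2 := hξ.deriv.1
    have h3 := hη.1
    have h4 := hη.deriv.1
    fun_prop
  · intro x w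
    simp only [hξ.2 x, hξ.deriv.2 x, hη.2 x, hη.deriv.2 x]
  · intro u hu
    rw [hP.form_eq u ξ η hu hξ hη]
    simp

theorem deriv_add_smul (hu : SmoothPeriodic u) (hv : SmoothPeriodic v) (s x : ℝ) :
    deriv (u + s • v) x = deriv u x + s • deriv v x :=
  ((hu.hasDerivAt x).add ((hv.hasDerivAt x).const_smul s)).deriv

theorem firstVariation_toVec {k : ℕ} {f : ℝ × (Fin (k + 1) → Coord n) → ℝ} (hf : IsDensity k f)
    (hu : SmoothPeriodic u) {θ : ℝ → Fin n → ℝ} (hθ : SmoothPeriodic θ) :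
    ∫ x in (0 : ℝ)..1, ∑ i, eulerLagrange k f u x i * θ x i = firstVariation k f u (toVec θ) :=
  integral_eulerLagrange_mul hf hu hθ.toVec

theorem smoothPeriodic_add_smul (hu : SmoothPeriodic u) (hv : SmoothPeriodic v) (s : ℝ) :
    SmoothPeriodic (u + s • v) := hu.add ((SmoothPeriodic.const s).smul hv)

theorem contDiff_comp_three_params {E F G : Type*} [NormedAddCommGroup E] [NormedSpace ℝ E]
    [NormedAddCommGroup F] [NormedSpace ℝ F] [NormedAddCommGroup G] [NormedSpace ℝ G]
    {r : E × E × F × F × F × F → G} (hr : ContDiff ℝ ∞ r) {a a' : ℝ × ℝ → E}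
    {b b' c c' : ℝ × ℝ → F} (ha : ContDiff ℝ ∞ a) (ha' : ContDiff ℝ ∞ a') (hb : ContDiff ℝ ∞ b)
    (hb' : ContDiff ℝ ∞ b') (hc : ContDiff ℝ ∞ c) (hc' : ContDiff ℝ ∞ c') :
    ContDiff ℝ ∞ fun z : (ℝ × ℝ × ℝ) × ℝ => r (a (z.1.2.1, z.2), a' (z.1.2.1, z.2),
      b (z.1.1, z.2), b' (z.1.1, z.2), c (z.1.2.2, z.2), c' (z.1.2.2, z.2)) := by
  have p0 : ContDiff ℝ ∞ fun z : (ℝ × ℝ × ℝ) × ℝ => (z.1.2.1, z.2) := by fun_prop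
  have p1 : ContDiff ℝ ∞ fun z : (ℝ × ℝ × ℝ) × ℝ => (z.1.1, z.2) := by fun_prop
  have p2 : ContDiff ℝ ∞ fun z : (ℝ × ℝ × ℝ) × ℝ => (z.1.2.2, z.2) := by fun_prop
  exact hr.comp ((ha.comp p0).prodMk ((ha'.comp p0).prodMk
      ((hb.comp p1).prodMk ((hb'.comp p1).prodMk ((hc.comp p2).prodMk (hc'.comp p2))))))

/-- The derivative of the bracket of two local functionals along `u + s v`. -/
theorem IsFirstOrderForm.hasDerivAt_bracket (hU : IsOpen U) (hP : IsFirstOrderForm U P q)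
    {F G : (ℝ → Coord n) → ℝ} {V : Set (Coord n)} (hV : IsOpen V) (hVU : V ⊆ U)
    {k l : ℕ} {f : ℝ × (Fin (k + 1) → Coord n) → ℝ} {g : ℝ × (Fin (l + 1) → Coord n) → ℝ}
    (hf : IsDensity k f) (hg : IsDensity l g)
    (hF : ∀ u, IsLoop V u → F u = localFunctional k f u)
    (hG : ∀ u, IsLoop V u → G u = localFunctional l g u)
    (hu : IsLoop V u) (hv : SmoothPeriodic v) :
    HasDerivAt (fun s : ℝ => bracket P F G (u + s • v))
      (secondVariation k f u v (toVec (P u (eulerLagrange l g u)))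
        - secondVariation l g u v (toVec (P u (eulerLagrange k f u)))
        + deriv (fun s : ℝ =>
            opForm P (eulerLagrange k f u) (eulerLagrange l g u) (u + s • v)) 0) 0 := by
  have hup := hu.smoothPeriodic
  have huU := hu.mono hVU
  obtain ⟨V', χ, hV', hKV', hV'U, hχ, hχ1, hχs⟩ := exists_cutoff
    (isCompact_range_of_periodic hu.1.continuous hu.2.1) hU (range_subset_iff.2 huU.2.2)
  have huV' : IsLoop V' u := ⟨hu.1, hu.2.1, range_subset_iff.1 hKV'⟩
  set ξ := eulerLagrange k f u with hξ_def
  set η := eulerLagrange l g u with hη_def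
  have hξ : ∀ s : ℝ, SmoothPeriodic (eulerLagrange k f (u + s • v)) := fun s =>
    smoothPeriodic_eulerLagrange hf (smoothPeriodic_add_smul hup hv s)
  have hη : ∀ s : ℝ, SmoothPeriodic (eulerLagrange l g (u + s • v)) := fun s =>
    smoothPeriodic_eulerLagrange hg (smoothPeriodic_add_smul hup hv s)
  have hξ0 : SmoothPeriodic ξ := smoothPeriodic_eulerLagrange hf hup
  have hη0 : SmoothPeriodic η := smoothPeriodic_eulerLagrange hg hup
  have hq : ContDiff ℝ ∞ fun z => χ z.1 • q z :=
    contDiff_cutoff_smul hU hχ hχs contDiff_fst hP.contDiffOn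
  have cξ := contDiff_eulerLagrange_param hf hup hv
  have cη := contDiff_eulerLagrange_param hg hup hv
  have cξ' := contDiff_deriv_param cξ
  have cη' := contDiff_deriv_param cη
  have cu := hup.1
  have cv := hv.1
  have cu' := hup.deriv.1
  have cv' := hv.deriv.1
  have ca : ContDiff ℝ ∞ fun z : ℝ × ℝ => u z.2 + z.1 • v z.2 := by fun_prop
  have ca' : ContDiff ℝ ∞ fun z : ℝ × ℝ => deriv u z.2 + z.1 • deriv v z.2 := by fun_prop
  have hΦ := contDiff_comp_three_params hq ca ca' cξ cξ' cη cη'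
  -- The bracket along u + s v depends on s through δF/δu, through the coefficients of P and through
  -- δG/δu. Three independent parameters separate these; the derivative along the diagonal is the
  -- sum of the three partial ones.
  set Φ : (ℝ × ℝ × ℝ) × ℝ → ℝ := fun z =>
    χ (u z.2 + z.1.2.1 • v z.2) • q (u z.2 + z.1.2.1 • v z.2, deriv u z.2 + z.1.2.1 • deriv v z.2,
      eulerLagrange k f (u + z.1.1 • v) z.2,
      deriv (fun y => eulerLagrange k f (u + z.1.1 • v) y) z.2,
      eulerLagrange l g (u + z.1.2.2 • v) z.2,
      deriv (fun y => eulerLagrange l g (u + z.1.2.2 • v) y) z.2) with hΦ_def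
  replace hΦ : ContDiff ℝ ∞ Φ := hΦ
  have hΨ := hasFDerivAt_integral_param (hΦ.of_le (by simp)) (0 : ℝ × ℝ × ℝ)
  set L := ∫ x in (0 : ℝ)..1,
    (fderiv ℝ Φ ((0 : ℝ × ℝ × ℝ), x)).comp (ContinuousLinearMap.inl ℝ (ℝ × ℝ × ℝ) ℝ)
  have key : ∀ a b c : ℝ, IsLoop U (u + b • v) → IsLoop V' (u + b • v) →
      ∫ x in (0 : ℝ)..1, Φ ((a, b, c), x)
        = opForm P (eulerLagrange k f (u + a • v)) (eulerLagrange l g (u + c • v))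
            (u + b • v) := by
    intro a b c h1 h2
    rw [hP.form_eq _ _ _ h1 (hξ a) (hη c)]
    congr 1
    funext x
    have : χ (u x + b • v x) = 1 := hχ1 _ (h2.2.2 x)
    simp only [hΦ_def, this, one_smul, deriv_add_smul hup hv]
    rfl
  have hline : ∀ d : ℝ × ℝ × ℝ,
      HasDerivAt (fun s : ℝ => ∫ x in (0 : ℝ)..1, Φ (s • d, x)) (L d) 0 := by
    intro d
    have h1 : HasDerivAt (fun s : ℝ => s • d) d 0 := by
      simpa using (hasDerivAt_id (0 : ℝ)).smul_const d
    have h2 : HasFDerivAt (fun s => ∫ x in (0 : ℝ)..1, Φ (s, x)) L ((0 : ℝ) • d) := by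
      rw [zero_smul]
      exact hΨ
    exact h2.comp_hasDerivAt 0 h1
  have hzero : u + (0 : ℝ) • v = u := by simp
  have e1 : L (1, 0, 0) = secondVariation k f u v (toVec (P u η)) := by
    refine (hline (1, 0, 0)).unique ?_
    refine (hasDerivAt_firstVariation hf hup hv
      (hP.smoothPeriodic u η huU hη0).toVec).congr_of_eventuallyEq (Eventually.of_forall fun s => ?_)
    have := key s 0 0 (by rwa [hzero]) (by rwa [hzero])
    simp only [Prod.smul_mk, smul_eq_mul, mul_one, mul_zero]
    rw [this, hzero]
    exact firstVariation_toVec hf (smoothPeriodic_add_smul hup hv s)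
      (hP.smoothPeriodic u η huU hη0)
  -- Skew-adjointness moves P from the varying δG/δu onto the frozen ξ; this is the source of the
  -- minus sign.
  have e3 : L (0, 0, 1) = -secondVariation l g u v (toVec (P u ξ)) := by
    refine (hline (0, 0, 1)).unique ?_
    refine (hasDerivAt_firstVariation hg hup hv
      (hP.smoothPeriodic u ξ huU hξ0).toVec).neg.congr_of_eventuallyEq
        (Eventually.of_forall fun s => ?_)
    have := key 0 0 s (by rwa [hzero]) (by rwa [hzero])
    simp only [Prod.smul_mk, smul_eq_mul, mul_one, mul_zero]
    rw [this, hzero, hP.skew u _ _ huU hξ0 (hη s), Pi.neg_apply]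
    exact congrArg Neg.neg (firstVariation_toVec hg (smoothPeriodic_add_smul hup hv s)
      (hP.smoothPeriodic u ξ huU hξ0))
  have e2 : deriv (fun s : ℝ => opForm P ξ η (u + s • v)) 0 = L (0, 1, 0) := by
    refine HasDerivAt.deriv ((hline (0, 1, 0)).congr_of_eventuallyEq ?_)
    filter_upwards [eventually_isLoop hU huU hv, eventually_isLoop hV' huV' hv] with s h1 h2
    have := key 0 s 0 h1 h2
    simp only [Prod.smul_mk, smul_eq_mul, mul_one, mul_zero]
    rw [this, hzero]
  have hsum : L (1, 1, 1) = secondVariation k f u v (toVec (P u η))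
      - secondVariation l g u v (toVec (P u ξ))
      + deriv (fun s : ℝ => opForm P ξ η (u + s • v)) 0 := by
    have : ((1, 1, 1) : ℝ × ℝ × ℝ) = (1, 0, 0) + (0, 1, 0) + (0, 0, 1) := by simp
    rw [this, map_add, map_add, e1, e3, e2]
    ring
  rw [← hsum]
  refine (hline (1, 1, 1)).congr_of_eventuallyEq ?_
  filter_upwards [eventually_isLoop hV hu hv, eventually_isLoop hV' huV' hv] with s h1 h2
  have := key s s s (h1.mono hVU) h2
  simp only [Prod.smul_mk, smul_eq_mul, mul_one]
  rw [this, bracket_eq_opForm,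
    (isVarDeriv_of_eq_localFunctional hV hf hF h1).varDeriv_eq,
    (isVarDeriv_of_eq_localFunctional hV hg hG h1).varDeriv_eq]

/-- The second variation in the direction of a fixed vector field is represented by a smooth
periodic function. -/
theorem secondVariation_eq_integral {k : ℕ} {f : ℝ × (Fin (k + 1) → Coord n) → ℝ}
    (hf : IsDensity k f) {w : ℝ → Coord n} (hu : SmoothPeriodic u) (hw : SmoothPeriodic w) :
    ∃ a : ℝ → Fin n → ℝ, SmoothPeriodic a ∧ ∀ v, SmoothPeriodic v →
      secondVariation k f u v w = ∫ x in (0 : ℝ)..1, ∑ i, a x i * v x i := by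
  have hc := contDiff_eulerLagrange_param hf hu hw
  refine ⟨fun x i => deriv (fun s : ℝ => eulerLagrange k f (u + s • w) x i) 0, ?_,
    fun v hv => ?_⟩
  · refine SmoothPeriodic.pi_iff.2 fun i => ⟨?_, fun x => ?_⟩
    · have h1 := contDiff_deriv_param_left (contDiff_pi.1 hc i)
      exact h1.comp (contDiff_const.prodMk contDiff_id : ContDiff ℝ ∞ fun x : ℝ => ((0 : ℝ), x))
    · simp only [(smoothPeriodic_eulerLagrange hf (smoothPeriodic_add_smul hu hw _)).2 x]
  -- After exchanging the directions, the loop varies along the fixed `w`, so the derivative falls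
  -- on the Euler–Lagrange expression and `v` enters only as a factor.
  · rw [secondVariation_symm hf]
    refine (hasDerivAt_firstVariation hf hu hw hv).unique ?_
    have hvi : ∀ i, ContDiff ℝ ∞ fun x => v x i := fun i =>
      (hv.clm_comp (EuclideanSpace.proj i : Coord n →L[ℝ] ℝ)).1
    have hΦ : ContDiff ℝ ∞ fun z : ℝ × ℝ => ∑ i, eulerLagrange k f (u + z.1 • w) z.2 i * v z.2 i :=
      ContDiff.sum fun i _ => (contDiff_pi.1 hc i).mul ((hvi i).comp contDiff_snd)
    have hd := hasDerivAt_integral_param (hΦ.of_le (by simp)) 0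
    refine (hd.congr_of_eventuallyEq (Eventually.of_forall fun s =>
      (integral_eulerLagrange_mul hf (smoothPeriodic_add_smul hu hw s) hv).symm)).congr_deriv ?_
    congr 1
    funext x
    have hdi : ∀ i, HasDerivAt (fun s : ℝ => eulerLagrange k f (u + s • w) x i)
        (deriv (fun s : ℝ => eulerLagrange k f (u + s • w) x i) 0) 0 := fun i =>
      DifferentiableAt.hasDerivAt (((contDiff_pi.1 hc i).comp
        (contDiff_id.prodMk contDiff_const : ContDiff ℝ ∞ fun s : ℝ => (s, x))).differentiable
          (by simp) 0)
    exact (HasDerivAt.fun_sum fun i _ => (hdi i).mul_const (v x i)).deriv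

/-- The Jacobi sum of three local functionals reduces to the derivative of the bilinear form of the
operator with respect to the loop. -/
theorem IsFirstOrderForm.jacobi_sum (hU : IsOpen U) (hP : IsFirstOrderForm U P q)
    {F G H : (ℝ → Coord n) → ℝ} (hF : IsLocalFunctional U F) (hG : IsLocalFunctional U G)
    (hH : IsLocalFunctional U H) (hu : IsLoop U u) :
    bracket P (bracket P F G) H u + bracket P (bracket P G H) F u + bracket P (bracket P H F) G u
      = deriv (fun s : ℝ => opForm P (varDeriv F u) (varDeriv G u)
            (u + s • toVec (P u (varDeriv H u)))) 0
        + deriv (fun s : ℝ => opForm P (varDeriv G u) (varDeriv H u)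
            (u + s • toVec (P u (varDeriv F u)))) 0
        + deriv (fun s : ℝ => opForm P (varDeriv H u) (varDeriv F u)
            (u + s • toVec (P u (varDeriv G u)))) 0 := by
  have main : ∀ {F G : (ℝ → Coord n) → ℝ} {V W : Set (Coord n)} (_ : IsOpen V) (_ : IsOpen W)
      (_ : V ⊆ U) {k l : ℕ} {f : ℝ × (Fin (k + 1) → Coord n) → ℝ}
      {g : ℝ × (Fin (l + 1) → Coord n) → ℝ} (_ : IsDensity k f) (_ : IsDensity l g)
      (_ : ∀ u, IsLoop V u → F u = localFunctional k f u)
      (_ : ∀ u, IsLoop W u → G u = localFunctional l g u)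
      (_ : IsLoop V u) (_ : IsLoop W u) {H : (ℝ → Coord n) → ℝ} (_ : IsLocalFunctional U H),
      bracket P (bracket P F G) H u
        = secondVariation k f u (toVec (P u (varDeriv H u))) (toVec (P u (varDeriv G u)))
        - secondVariation l g u (toVec (P u (varDeriv H u))) (toVec (P u (varDeriv F u)))
        + deriv (fun s : ℝ => opForm P (varDeriv F u) (varDeriv G u)
            (u + s • toVec (P u (varDeriv H u)))) 0 := by
    intro F G V W hV hW hVU k l f g hf hg hF hG huV huW H hH
    have hup := hu.smoothPeriodic
    have hVW : IsLoop (V ∩ W) u := ⟨hu.1, hu.2.1, fun x => ⟨huV.2.2 x, huW.2.2 x⟩⟩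
    have hder := fun v (hv : SmoothPeriodic v) => hP.hasDerivAt_bracket hU (hV.inter hW)
      (inter_subset_left.trans hVU) hf hg (fun u hu => hF u (hu.mono inter_subset_left))
      (fun u hu => hG u (hu.mono inter_subset_right)) hVW hv
    rw [(isVarDeriv_of_eq_localFunctional hV hf hF huV).varDeriv_eq,
      (isVarDeriv_of_eq_localFunctional hW hg hG huW).varDeriv_eq]
    have hξ := smoothPeriodic_eulerLagrange hf hup
    have hη := smoothPeriodic_eulerLagrange hg hup
    obtain ⟨a, ha, ha'⟩ := secondVariation_eq_integral hf hup (hP.smoothPeriodic _ _ hu hη).toVec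
    obtain ⟨b, hb, hb'⟩ := secondVariation_eq_integral hg hup (hP.smoothPeriodic _ _ hu hξ).toVec
    obtain ⟨V', m, e, hV', -, huV', he, hee⟩ :=
      (hP.isLocalFunctional hξ hη).exists_density hU hu
    have hce := isVarDeriv_of_eq_localFunctional hV' he hee huV'
    have hc := smoothPeriodic_eulerLagrange he hup
    -- Each of the three contributions to the derivative of {F, G} is the integral of `v` against a
    -- smooth periodic function, so the bracket has a variational derivative. Pairing it with P
    -- δH/δu differentiates {F, G} along that field.
    have hvd : IsVarDeriv (bracket P F G) u (fun x => a x - b x + eulerLagrange m e u x) := by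
      have hs := (ha.sub hb).add hc
      refine ⟨hs.1, hs.2, fun v hv => ?_⟩
      have hvp := isLoop_univ_iff.1 hv
      refine (hder v hvp).congr_deriv ?_
      rw [ha' v hvp, hb' v hvp, (hce.2.2 v hv).deriv]
      have hi : ∀ {a : ℝ → Fin n → ℝ}, SmoothPeriodic a →
          IntervalIntegrable (fun x => ∑ i, a x i * v x i) volume 0 1 := fun ha =>
        (SmoothPeriodic.sum fun i _ => ((SmoothPeriodic.pi_iff.1 ha) i).mul
          (hvp.clm_comp (EuclideanSpace.proj i : Coord n →L[ℝ] ℝ))).continuous.intervalIntegrable _ _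
      rw [← intervalIntegral.integral_sub (hi ha) (hi hb),
        ← intervalIntegral.integral_add ((hi ha).sub (hi hb)) (hi hc)]
      congr 1
      funext x
      rw [← Finset.sum_sub_distrib, ← Finset.sum_add_distrib]
      refine Finset.sum_congr rfl fun i _ => ?_
      simp only [Pi.add_apply, Pi.sub_apply]
      ring
    have hz := (hP.smoothPeriodic _ _ hu (hH.smoothPeriodic_varDeriv hU hu)).toVec
    have h1 := hvd.2.2 _ (isLoop_univ_iff.2 hz)
    rw [bracket_eq_opForm, hvd.varDeriv_eq]
    exact h1.unique (hder _ hz)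
  obtain ⟨V₁, k₁, f₁, hV₁, hVU₁, huV₁, hf₁, hF₁⟩ := hF.exists_density hU hu
  obtain ⟨V₂, k₂, f₂, hV₂, hVU₂, huV₂, hf₂, hF₂⟩ := hG.exists_density hU hu
  obtain ⟨V₃, k₃, f₃, hV₃, hVU₃, huV₃, hf₃, hF₃⟩ := hH.exists_density hU hu
  rw [main hV₁ hV₂ hVU₁ hf₁ hf₂ hF₁ hF₂ huV₁ huV₂ hH,
    main hV₂ hV₃ hVU₂ hf₂ hf₃ hF₂ hF₃ huV₂ huV₃ hF,
    main hV₃ hV₁ hVU₃ hf₃ hf₁ hF₃ hF₁ huV₃ huV₁ hG]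
  -- Each of the three functionals contributes two second variations with opposite signs and
  -- exchanged directions; they cancel.
  rw [secondVariation_symm hf₁ u (toVec (P u (varDeriv G u))),
    secondVariation_symm hf₂ u (toVec (P u (varDeriv H u))),
    secondVariation_symm hf₃ u (toVec (P u (varDeriv F u)))]
  ring

/-- Every smooth periodic function is the variational derivative of a local functional. -/
theorem exists_varDeriv_eq (U : Set (Coord n)) {ξ : ℝ → Fin n → ℝ} (hξ : SmoothPeriodic ξ) :
    ∃ F, IsLocalFunctional U F ∧ ∀ u, IsLoop U u → varDeriv F u = ξ := by
  have hξi := SmoothPeriodic.pi_iff.1 hξ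
  refine ⟨fun u => ∫ x in (0 : ℝ)..1, ∑ i, ξ x i * u x i, ⟨0, fun z => ∑ i, ξ z.1 i * z.2 0 i,
    ?_, ?_, ?_⟩, ?_⟩
  · refine ContDiff.contDiffOn (ContDiff.sum fun i _ => ((hξi i).1.comp contDiff_fst).mul ?_)
    exact (EuclideanSpace.proj i : Coord n →L[ℝ] ℝ).contDiff.comp
      ((contDiff_apply ℝ (Coord n) 0).comp contDiff_snd)
  · intro x w
    simp only [hξ.2 x]
  · intro u _
    simp
  · intro u hu
    refine IsVarDeriv.varDeriv_eq ⟨hξ.1, hξ.2, fun v hv => ?_⟩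
    have hi : ∀ {w : ℝ → Coord n}, SmoothPeriodic w →
        IntervalIntegrable (fun x => ∑ i, ξ x i * w x i) volume 0 1 := fun hw =>
      (SmoothPeriodic.sum fun i _ => (hξi i).mul
        (hw.clm_comp (EuclideanSpace.proj i : Coord n →L[ℝ] ℝ))).continuous.intervalIntegrable _ _
    have hv' := isLoop_univ_iff.1 hv
    have h1 : ∀ s : ℝ, ∫ x in (0 : ℝ)..1, ∑ i, ξ x i * (u + s • v) x i
        = (∫ x in (0 : ℝ)..1, ∑ i, ξ x i * u x i)
          + s * ∫ x in (0 : ℝ)..1, ∑ i, ξ x i * v x i := by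
      intro s
      rw [← intervalIntegral.integral_const_mul,
        ← intervalIntegral.integral_add (hi hu.smoothPeriodic) ((hi hv').const_mul s)]
      congr 1
      funext x
      rw [Finset.mul_sum, ← Finset.sum_add_distrib]
      refine Finset.sum_congr rfl fun i _ => ?_
      simp only [Pi.add_apply, Pi.smul_apply, PiLp.add_apply, PiLp.smul_apply, smul_eq_mul]
      ring
    simp only [h1]
    simpa using ((hasDerivAt_id (0 : ℝ)).mul_const
      (∫ x in (0 : ℝ)..1, ∑ i, ξ x i * v x i)).const_add (∫ x in (0 : ℝ)..1, ∑ i, ξ x i * u x i)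

/-- Linear functionals of the loop realise every smooth periodic ξ, η, ζ as variational derivatives,
so the functionals disappear from the Jacobi identity. Skew-symmetry of the bracket is part of
`IsFirstOrderForm`. -/
theorem IsFirstOrderForm.isHamiltonian_iff (hU : IsOpen U) (hP : IsFirstOrderForm U P q) :
    IsHamiltonian U P ↔ ∀ u ξ η ζ, IsLoop U u → SmoothPeriodic ξ → SmoothPeriodic η →
      SmoothPeriodic ζ →
      deriv (fun s : ℝ => opForm P ξ η (u + s • toVec (P u ζ))) 0
        + deriv (fun s : ℝ => opForm P η ζ (u + s • toVec (P u ξ))) 0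
        + deriv (fun s : ℝ => opForm P ζ ξ (u + s • toVec (P u η))) 0 = 0 := by
  constructor
  · rintro ⟨-, hJ⟩ u ξ η ζ hu hξ hη hζ
    obtain ⟨F, hF, hFξ⟩ := exists_varDeriv_eq U hξ
    obtain ⟨G, hG, hGη⟩ := exists_varDeriv_eq U hη
    obtain ⟨H, hH, hHζ⟩ := exists_varDeriv_eq U hζ
    have := hJ F G H hF hG hH u hu
    rwa [hP.jacobi_sum hU hF hG hH hu, hFξ u hu, hGη u hu, hHζ u hu] at this
  · intro h
    refine ⟨fun F G hF hG u hu => ?_, fun F G H hF hG hH u hu => ?_⟩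
    · exact hP.skew _ _ _ hu (hF.smoothPeriodic_varDeriv hU hu) (hG.smoothPeriodic_varDeriv hU hu)
    · rw [hP.jacobi_sum hU hF hG hH hu]
      exact h _ _ _ _ hu (hF.smoothPeriodic_varDeriv hU hu) (hG.smoothPeriodic_varDeriv hU hu)
        (hH.smoothPeriodic_varDeriv hU hu)

end Jacobi

/-! ### Flat symplectic connections on an open subset of `ℝⁿ` -/

/-- Covectors of `ℝⁿ`. -/
abbrev Covec (n : ℕ) : Type := Fin n → ℝ

section Algebra

variable {n : ℕ}

/-- The pairing of covectors and vectors. -/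
def dot (ξ : Covec n) (v : Coord n) : ℝ := ∑ i, ξ i * v i

theorem dot_add_left (ξ η : Covec n) (v : Coord n) : dot (ξ + η) v = dot ξ v + dot η v := by
  simp [dot, add_mul, Finset.sum_add_distrib]

theorem dot_sub_left (ξ η : Covec n) (v : Coord n) : dot (ξ - η) v = dot ξ v - dot η v := by
  simp [dot, sub_mul, Finset.sum_sub_distrib]

theorem dot_smul_left (c : ℝ) (ξ : Covec n) (v : Coord n) : dot (c • ξ) v = c * dot ξ v := by
  simp [dot, Finset.mul_sum, mul_assoc]

theorem dot_sub_right (ξ : Covec n) (v w : Coord n) : dot ξ (v - w) = dot ξ v - dot ξ w := by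
  simp [dot, mul_sub, Finset.sum_sub_distrib]

theorem dot_zero_left (v : Coord n) : dot (0 : Covec n) v = 0 := by simp [dot]

theorem dot_basis (ξ : Covec n) (i : Fin n) : dot ξ (EuclideanSpace.single i 1) = ξ i := by
  simp [dot]

theorem eq_zero_of_dot_eq_zero {ξ : Covec n} (h : ∀ v, dot ξ v = 0) : ξ = 0 := by
  funext i
  exact (dot_basis ξ i).symm.trans (h _)

/-- The vector `♯β` with `⟨α, ♯β⟩ = B(α, β)`. -/
def sharp (B : Covec n →L[ℝ] Covec n →L[ℝ] ℝ) : Covec n →L[ℝ] Coord n :=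
  (PiLp.continuousLinearEquiv 2 ℝ fun _ : Fin n => ℝ).symm.toContinuousLinearMap.comp
    (ContinuousLinearMap.pi fun i => B (Pi.single i 1))

theorem sharp_apply (B : Covec n →L[ℝ] Covec n →L[ℝ] ℝ) (β : Covec n) (i : Fin n) :
    sharp B β i = B (Pi.single i 1) β := rfl

theorem covec_eq_sum (ξ : Covec n) : ξ = ∑ i, ξ i • (Pi.single i 1 : Covec n) := by
  funext j
  simp [Finset.sum_apply, Pi.single_apply]

theorem clm_covec {F : Type*} [NormedAddCommGroup F] [NormedSpace ℝ F] (L : Covec n →L[ℝ] F)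
    (ξ : Covec n) : L ξ = ∑ i, ξ i • L (Pi.single i 1) := by
  conv_lhs => rw [covec_eq_sum ξ]
  simp

theorem dot_sharp (B : Covec n →L[ℝ] Covec n →L[ℝ] ℝ) (α β : Covec n) :
    dot α (sharp B β) = B α β := by
  rw [clm_covec B α]
  simp [dot, sharp_apply]

end Algebra

theorem hasDerivAt_comp_curve {X F : Type*} [NormedAddCommGroup X] [NormedSpace ℝ X]
    [NormedAddCommGroup F] [NormedSpace ℝ F] {f : X → F} {f' : X →L[ℝ] F} {c : ℝ → X} {c' : X}
    {x : ℝ} (hf : HasFDerivAt f f' (c x)) (hc : HasDerivAt c c' x) :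
    HasDerivAt (fun y => f (c y)) (f' c') x :=
  hf.comp_hasDerivAt x hc

/-- A flat Fedosov structure on an open subset `U` of `ℝⁿ`: `Γ x v` is the endomorphism
`ξ_r ↦ Γ^r_{jk} v^k ξ_r` of the space of covectors and `W x` is the Poisson bivector. -/
structure FlatData {n : ℕ} (U : Set (Coord n))
    (Γ : Coord n → Coord n →L[ℝ] Covec n →L[ℝ] Covec n)
    (W : Coord n → Covec n →L[ℝ] Covec n →L[ℝ] ℝ) : Prop where
  isOpen : IsOpen U
  smooth_conn : ContDiffOn ℝ ∞ Γ U
  smooth_form : ContDiffOn ℝ ∞ W U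
  antisymm : ∀ x ∈ U, ∀ α β, W x α β = -W x β α
  nondegenerate : ∀ x ∈ U, ∀ α, (∀ β, W x α β = 0) → α = 0
  torsionFree : ∀ x ∈ U, ∀ ξ v w, dot (Γ x v ξ) w = dot (Γ x w ξ) v
  compat : ∀ x ∈ U, ∀ m α β, fderiv ℝ W x m α β = -W x (Γ x m α) β - W x α (Γ x m β)
  flat : ∀ x ∈ U, ∀ m v θ, fderiv ℝ Γ x m v θ - Γ x m (Γ x v θ)
    = fderiv ℝ Γ x v m θ - Γ x v (Γ x m θ)

section FlatData

variable {n : ℕ} {U : Set (Coord n)} {Γ : Coord n → Coord n →L[ℝ] Covec n →L[ℝ] Covec n}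
  {W : Coord n → Covec n →L[ℝ] Covec n →L[ℝ] ℝ} {u v : ℝ → Coord n} {ξ η θ : ℝ → Covec n}

/-- The covariant derivative of a covector field along a curve. -/
def covD (Γ : Coord n → Coord n →L[ℝ] Covec n →L[ℝ] Covec n) (u : ℝ → Coord n) (θ : ℝ → Covec n)
    (x : ℝ) : Covec n :=
  deriv θ x - Γ (u x) (deriv u x) (θ x)

/-- The operator `♯ ∇_x ∇_x`. -/
def flatOp (Γ : Coord n → Coord n →L[ℝ] Covec n →L[ℝ] Covec n)
    (W : Coord n → Covec n →L[ℝ] Covec n →L[ℝ] ℝ) : LoopOperator n :=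
  fun u ξ x i => W (u x) (Pi.single i 1) (covD Γ u (covD Γ u ξ) x)

theorem toVec_flatOp (u : ℝ → Coord n) (ξ : ℝ → Covec n) (x : ℝ) :
    toVec (flatOp Γ W u ξ) x = sharp (W (u x)) (covD Γ u (covD Γ u ξ) x) := rfl

theorem opForm_flatOp (ξ η : ℝ → Covec n) (u : ℝ → Coord n) : opForm (flatOp Γ W) ξ η u
    = ∫ x in (0 : ℝ)..1, W (u x) (ξ x) (covD Γ u (covD Γ u η) x) := by
  simp only [opForm]
  congr 1
  funext x
  rw [clm_covec (W (u x)) (ξ x)]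
  simp [flatOp]

namespace FlatData

theorem smoothPeriodic_conn (h : FlatData U Γ W) (hu : IsLoop U u) :
    SmoothPeriodic fun x => Γ (u x) :=
  ⟨h.smooth_conn.comp_contDiff hu.1 hu.2.2, fun x => by simp only [hu.2.1 x]⟩

theorem smoothPeriodic_form (h : FlatData U Γ W) (hu : IsLoop U u) :
    SmoothPeriodic fun x => W (u x) :=
  ⟨h.smooth_form.comp_contDiff hu.1 hu.2.2, fun x => by simp only [hu.2.1 x]⟩

theorem smoothPeriodic_conn_apply (h : FlatData U Γ W) (hu : IsLoop U u) (hv : SmoothPeriodic v)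
    (hθ : SmoothPeriodic θ) : SmoothPeriodic fun x => Γ (u x) (v x) (θ x) :=
  ((h.smoothPeriodic_conn hu).clm_apply hv).clm_apply hθ

theorem smoothPeriodic_form_apply (h : FlatData U Γ W) (hu : IsLoop U u)
    (hξ : SmoothPeriodic ξ) (hη : SmoothPeriodic η) :
    SmoothPeriodic fun x => W (u x) (ξ x) (η x) :=
  ((h.smoothPeriodic_form hu).clm_apply hξ).clm_apply hη

theorem smoothPeriodic_covD (h : FlatData U Γ W) (hu : IsLoop U u) (hθ : SmoothPeriodic θ) :
    SmoothPeriodic (covD Γ u θ) :=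
  hθ.deriv.sub (h.smoothPeriodic_conn_apply hu hu.smoothPeriodic.deriv hθ)

theorem smoothPeriodic_flatOp (h : FlatData U Γ W) (hu : IsLoop U u) (hθ : SmoothPeriodic θ) :
    SmoothPeriodic (flatOp Γ W u θ) :=
  SmoothPeriodic.pi_iff.2 fun _ => h.smoothPeriodic_form_apply hu (SmoothPeriodic.const _)
    (h.smoothPeriodic_covD hu (h.smoothPeriodic_covD hu hθ))

theorem hasFDerivAt_conn (h : FlatData U Γ W) {x : Coord n} (hx : x ∈ U) :
    HasFDerivAt Γ (fderiv ℝ Γ x) x :=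
  ((h.smooth_conn.contDiffAt (h.isOpen.mem_nhds hx)).differentiableAt (by simp)).hasFDerivAt

theorem hasFDerivAt_form (h : FlatData U Γ W) {x : Coord n} (hx : x ∈ U) :
    HasFDerivAt W (fderiv ℝ W x) x :=
  ((h.smooth_form.contDiffAt (h.isOpen.mem_nhds hx)).differentiableAt (by simp)).hasFDerivAt

/-- The bivector is parallel. -/
theorem hasDerivAt_form_apply (h : FlatData U Γ W) (hu : IsLoop U u) (hξ : SmoothPeriodic ξ)
    (hη : SmoothPeriodic η) (x : ℝ) :
    HasDerivAt (fun x => W (u x) (ξ x) (η x))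
      (W (u x) (covD Γ u ξ x) (η x) + W (u x) (ξ x) (covD Γ u η x)) x := by
  have hW : HasDerivAt (fun x => W (u x)) (fderiv ℝ W (u x) (deriv u x)) x :=
    hasDerivAt_comp_curve (f := W) (h.hasFDerivAt_form (hu.2.2 x)) (hu.smoothPeriodic.hasDerivAt x)
  refine ((hW.clm_apply (hξ.hasDerivAt x)).clm_apply (hη.hasDerivAt x)).congr_deriv ?_
  simp only [add_apply, h.compat _ (hu.2.2 x), covD, map_sub,
    sub_apply]
  ring

/-- Covariant integration by parts: as W is parallel, the two sides differ by the integral of the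
derivative of the periodic function W(ξ, η). -/
theorem integral_form_covD (h : FlatData U Γ W) (hu : IsLoop U u) (hξ : SmoothPeriodic ξ)
    (hη : SmoothPeriodic η) :
    ∫ x in (0 : ℝ)..1, W (u x) (ξ x) (covD Γ u η x)
      = -∫ x in (0 : ℝ)..1, W (u x) (covD Γ u ξ x) (η x) := by
  have h0 := (h.smoothPeriodic_form_apply hu hξ hη).integral_deriv_eq_zero
  have h1 : deriv (fun x => W (u x) (ξ x) (η x)) = fun x =>
      W (u x) (covD Γ u ξ x) (η x) + W (u x) (ξ x) (covD Γ u η x) :=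
    funext fun x => (h.hasDerivAt_form_apply hu hξ hη x).deriv
  rw [h1, intervalIntegral.integral_add
    ((h.smoothPeriodic_form_apply hu (h.smoothPeriodic_covD hu hξ)
      hη).continuous.intervalIntegrable _ _)
    ((h.smoothPeriodic_form_apply hu hξ
      (h.smoothPeriodic_covD hu hη)).continuous.intervalIntegrable _ _)] at h0
  linarith

end FlatData

/-- The density `-W(∇_x ξ, ∇_x η)`. -/
def flatDensity (Γ : Coord n → Coord n →L[ℝ] Covec n →L[ℝ] Covec n)
    (W : Coord n → Covec n →L[ℝ] Covec n →L[ℝ] ℝ)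
    (z : Coord n × Coord n × Covec n × Covec n × Covec n × Covec n) : ℝ :=
  -W z.1 (z.2.2.2.1 - Γ z.1 z.2.1 z.2.2.1) (z.2.2.2.2.2 - Γ z.1 z.2.1 z.2.2.2.2.1)

theorem hasDerivAt_integral_density
    {q : Coord n × Coord n × Covec n × Covec n × Covec n × Covec n → ℝ} (hU : IsOpen U)
    (hq : ContDiffOn ℝ ∞ q {z | z.1 ∈ U}) (hu : IsLoop U u) (hv : SmoothPeriodic v)
    (hξ : SmoothPeriodic ξ) (hη : SmoothPeriodic η) :
    HasDerivAt (fun s : ℝ => ∫ x in (0 : ℝ)..1, q (u x + s • v x, deriv u x + s • deriv v x,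
        ξ x, deriv ξ x, η x, deriv η x))
      (∫ x in (0 : ℝ)..1, deriv (fun s : ℝ => q (u x + s • v x, deriv u x + s • deriv v x,
        ξ x, deriv ξ x, η x, deriv η x)) 0) 0 := by
  obtain ⟨V, χ, hV, hKV, hVU, hχ, hχ1, hχs⟩ := exists_cutoff
    (isCompact_range_of_periodic hu.1.continuous hu.2.1) hU (range_subset_iff.2 hu.2.2)
  have hq' : ContDiff ℝ ∞ fun z => χ z.1 • q z :=
    contDiff_cutoff_smul hU hχ hχs contDiff_fst hq
  have cu := hu.1
  have cv := hv.1
  have cu' := hu.smoothPeriodic.deriv.1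
  have cv' := hv.deriv.1
  have cξ := hξ.1
  have cξ' := hξ.deriv.1
  have cη := hη.1
  have cη' := hη.deriv.1
  have harg : ContDiff ℝ ∞ fun z : ℝ × ℝ => (u z.2 + z.1 • v z.2, deriv u z.2 + z.1 • deriv v z.2,
      ξ z.2, deriv ξ z.2, η z.2, deriv η z.2) := by fun_prop
  have hd := hasDerivAt_integral_param ((hq'.comp harg).of_le (by simp)) 0
  have hmem := eventually_forall_add_smul_mem hV hu.smoothPeriodic hv (range_subset_iff.1 hKV)
  have heq : ∀ᶠ s : ℝ in 𝓝 0, ∀ x, χ (u x + s • v x) = 1 := by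
    filter_upwards [hmem] with s hs x using hχ1 _ (hs x)
  refine (hd.congr_of_eventuallyEq ?_).congr_deriv ?_
  · filter_upwards [heq] with s hs
    simp [hs]
  · congr 1
    funext x
    refine Filter.EventuallyEq.deriv_eq ?_
    filter_upwards [heq] with s hs
    simp [hs]

namespace FlatData

theorem contDiffOn_flatDensity (h : FlatData U Γ W) :
    ContDiffOn ℝ ∞ (flatDensity Γ W) {z | z.1 ∈ U} := by
  have hΓ : ContDiffOn ℝ ∞
      (fun z : Coord n × Coord n × Covec n × Covec n × Covec n × Covec n => Γ z.1) {z | z.1 ∈ U} :=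
    h.smooth_conn.comp contDiff_fst.contDiffOn fun z hz => hz
  have hW : ContDiffOn ℝ ∞
      (fun z : Coord n × Coord n × Covec n × Covec n × Covec n × Covec n => W z.1) {z | z.1 ∈ U} :=
    h.smooth_form.comp contDiff_fst.contDiffOn fun z hz => hz
  refine ((hW.clm_apply (ContDiffOn.sub ?_ ((hΓ.clm_apply ?_).clm_apply ?_))).clm_apply
    (ContDiffOn.sub ?_ ((hΓ.clm_apply ?_).clm_apply ?_))).neg
  all_goals exact ContDiff.contDiffOn (by fun_prop)

/-- One covariant integration by parts gives -∫ W(∇_x ξ, ∇_x η), which is antisymmetric in ξ and η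
because W is. -/
theorem isFirstOrderForm (h : FlatData U Γ W) :
    IsFirstOrderForm U (flatOp Γ W) (flatDensity Γ W) := by
  have hform : ∀ u ξ η, IsLoop U u → SmoothPeriodic ξ → SmoothPeriodic η →
      opForm (flatOp Γ W) ξ η u
        = -∫ x in (0 : ℝ)..1, W (u x) (covD Γ u ξ x) (covD Γ u η x) := by
    intro u ξ η hu hξ hη
    rw [opForm_flatOp, h.integral_form_covD hu hξ (h.smoothPeriodic_covD hu hη)]
  refine ⟨h.contDiffOn_flatDensity, fun u ξ hu hξ => h.smoothPeriodic_flatOp hu hξ,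
    fun u ξ η hu hξ hη => ?_, fun u ξ η hu hξ hη => ?_⟩
  · rw [hform u ξ η hu hξ hη, ← intervalIntegral.integral_neg]
    rfl
  · rw [hform u ξ η hu hξ hη, hform u η ξ hu hη hξ, neg_neg, ← intervalIntegral.integral_neg]
    congr 1
    funext x
    rw [h.antisymm _ (hu.2.2 x), neg_neg]

/-- Flatness trades the derivative of Γ(v) along u' for that of Γ(u') along v. The first two terms
on the right are then exactly the variation of Γ(u')ξ in the direction v, so the variation of ∇_x ξ
is Γ(v)∇_x ξ - ∇_x(Γ(v)ξ). -/
theorem covD_conn_apply (h : FlatData U Γ W) (hu : IsLoop U u) (hv : SmoothPeriodic v)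
    (hξ : SmoothPeriodic ξ) (x : ℝ) :
    covD Γ u (fun x => Γ (u x) (v x) (ξ x)) x
      = fderiv ℝ Γ (u x) (v x) (deriv u x) (ξ x) + Γ (u x) (deriv v x) (ξ x)
        + Γ (u x) (v x) (covD Γ u ξ x) := by
  have hΓ : HasDerivAt (fun x => Γ (u x)) (fderiv ℝ Γ (u x) (deriv u x)) x :=
    hasDerivAt_comp_curve (f := Γ) (h.hasFDerivAt_conn (hu.2.2 x)) (hu.smoothPeriodic.hasDerivAt x)
  have hd := ((hΓ.clm_apply (hv.hasDerivAt x)).clm_apply (hξ.hasDerivAt x)).deriv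
  have hf := h.flat (u x) (hu.2.2 x) (v x) (deriv u x) (ξ x)
  simp only [covD]
  rw [hd]
  simp only [add_apply, map_sub]
  rw [sub_eq_sub_iff_add_eq_add] at hf
  have : fderiv ℝ Γ (u x) (v x) (deriv u x) (ξ x) = fderiv ℝ Γ (u x) (deriv u x) (v x) (ξ x)
      + Γ (u x) (v x) (Γ (u x) (deriv u x) (ξ x)) - Γ (u x) (deriv u x) (Γ (u x) (v x) (ξ x)) :=
    eq_sub_of_add_eq hf
  rw [this]
  abel

/-- The derivative of the bilinear form of `♯ ∇_x ∇_x` with respect to the loop. -/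
theorem hasDerivAt_opForm (h : FlatData U Γ W) (hu : IsLoop U u) (hv : SmoothPeriodic v)
    (hξ : SmoothPeriodic ξ) (hη : SmoothPeriodic η) :
    HasDerivAt (fun s : ℝ => opForm (flatOp Γ W) ξ η (u + s • v))
      (∫ x in (0 : ℝ)..1, (W (u x) (Γ (u x) (v x) (η x)) (covD Γ u (covD Γ u ξ) x)
        - W (u x) (Γ (u x) (v x) (ξ x)) (covD Γ u (covD Γ u η) x))) 0 := by
  have hup := hu.smoothPeriodic
  have hd := hasDerivAt_integral_density h.isOpen h.contDiffOn_flatDensity hu hv hξ hη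
  refine (hd.congr_of_eventuallyEq ?_).congr_deriv ?_
  · filter_upwards [eventually_isLoop h.isOpen hu hv] with s hs
    rw [h.isFirstOrderForm.form_eq _ _ _ hs hξ hη]
    simp only [deriv_add_smul hup hv]
    rfl
  · have hbξ := h.smoothPeriodic_conn_apply hu hv hξ
    have hbη := h.smoothPeriodic_conn_apply hu hv hη
    -- The terms containing Γ(v)∇_x ξ and Γ(v)∇_x η cancel against the derivative of W, which is
    -- parallel.
    have hpt : ∀ x, deriv (fun s : ℝ => flatDensity Γ W (u x + s • v x,
        deriv u x + s • deriv v x, ξ x, deriv ξ x, η x, deriv η x)) 0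
        = W (u x) (covD Γ u (fun x => Γ (u x) (v x) (ξ x)) x) (covD Γ u η x)
          + W (u x) (covD Γ u ξ x) (covD Γ u (fun x => Γ (u x) (v x) (η x)) x) := by
      intro x
      have hl : HasDerivAt (fun s : ℝ => u x + s • v x) (v x) 0 := by
        simpa using ((hasDerivAt_id (0 : ℝ)).smul_const (v x)).const_add (u x)
      have hl' : HasDerivAt (fun s : ℝ => deriv u x + s • deriv v x) (deriv v x) 0 := by
        simpa using ((hasDerivAt_id (0 : ℝ)).smul_const (deriv v x)).const_add (deriv u x)
      have hΓ : HasDerivAt (fun s : ℝ => Γ (u x + s • v x)) (fderiv ℝ Γ (u x) (v x)) 0 := by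
        refine hasDerivAt_comp_curve (f := Γ) ?_ hl
        simpa using h.hasFDerivAt_conn (hu.2.2 x)
      have hW : HasDerivAt (fun s : ℝ => W (u x + s • v x)) (fderiv ℝ W (u x) (v x)) 0 := by
        refine hasDerivAt_comp_curve (f := W) ?_ hl
        simpa using h.hasFDerivAt_form (hu.2.2 x)
      have ha : ∀ c c' : Covec n, HasDerivAt
          (fun s : ℝ => c' - Γ (u x + s • v x) (deriv u x + s • deriv v x) c)
          (-(fderiv ℝ Γ (u x) (v x) (deriv u x) c + Γ (u x) (deriv v x) c)) 0 := by
        intro c c'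
        have := ((hΓ.clm_apply hl').clm_apply (hasDerivAt_const (0 : ℝ) c)).const_sub c'
        simpa using this
      have := ((hW.clm_apply (ha (ξ x) (deriv ξ x))).clm_apply (ha (η x) (deriv η x))).neg.deriv
      refine Eq.trans this ?_
      rw [h.covD_conn_apply hu hv hξ, h.covD_conn_apply hu hv hη]
      simp only [zero_smul, add_zero, add_apply, h.compat _ (hu.2.2 x),
        map_neg, map_add, neg_apply]
      simp only [covD]
      ring
    simp only [hpt]
    have hξ1 := h.smoothPeriodic_covD hu hξ
    have hη1 := h.smoothPeriodic_covD hu hη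
    have hξ2 := h.smoothPeriodic_covD hu hξ1
    have hη2 := h.smoothPeriodic_covD hu hη1
    have hi : ∀ {ξ η : ℝ → Covec n}, SmoothPeriodic ξ → SmoothPeriodic η →
        IntervalIntegrable (fun x => W (u x) (ξ x) (η x)) volume 0 1 := fun hξ hη =>
      (h.smoothPeriodic_form_apply hu hξ hη).continuous.intervalIntegrable _ _
    rw [intervalIntegral.integral_add (hi (h.smoothPeriodic_covD hu hbξ) hη1)
      (hi hξ1 (h.smoothPeriodic_covD hu hbη)), h.integral_form_covD hu hξ1 hbη,
      intervalIntegral.integral_sub (hi hbη hξ2) (hi hbξ hη2), h.integral_form_covD hu hbξ hη1]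
    have : ∫ x in (0 : ℝ)..1, W (u x) (covD Γ u (covD Γ u ξ) x) (Γ (u x) (v x) (η x))
        = -∫ x in (0 : ℝ)..1, W (u x) (Γ (u x) (v x) (η x)) (covD Γ u (covD Γ u ξ) x) := by
      rw [← intervalIntegral.integral_neg]
      congr 1
      funext x
      rw [h.antisymm _ (hu.2.2 x)]
    rw [this]
    ring

end FlatData

end FlatData

/-! ### Pencils of flat operators -/

section Pencil

variable {n : ℕ} {U : Set (Coord n)} {Γ₁ Γ₂ : Coord n → Coord n →L[ℝ] Covec n →L[ℝ] Covec n}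
  {W₁ W₂ : Coord n → Covec n →L[ℝ] Covec n →L[ℝ] ℝ} {P₁ P₂ : LoopOperator n}
  {u v : ℝ → Coord n} {ξ η ζ : ℝ → Covec n}

/-- The trilinear form `⟨(Γ₁ - Γ₂)(♯₁ p) ξ, ♯₂ q⟩` of a pair of structures. -/
def obstruction (Γ₁ Γ₂ : Coord n → Coord n →L[ℝ] Covec n →L[ℝ] Covec n)
    (W₁ W₂ : Coord n → Covec n →L[ℝ] Covec n →L[ℝ] ℝ) (x : Coord n) (p q ξ : Covec n) : ℝ :=
  dot ((Γ₁ x - Γ₂ x) (sharp (W₁ x) p) ξ) (sharp (W₂ x) q)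

/-- The coefficient of `-μν` in the Jacobi sum of `μ P₁ + ν P₂`, before symmetrization. -/
def mixedTerm (Γ₁ Γ₂ : Coord n → Coord n →L[ℝ] Covec n →L[ℝ] Covec n)
    (W₁ W₂ : Coord n → Covec n →L[ℝ] Covec n →L[ℝ] ℝ) (u : ℝ → Coord n) (ξ η ζ : ℝ → Covec n)
    (x : ℝ) : ℝ :=
  obstruction Γ₁ Γ₂ W₁ W₂ (u x) (covD Γ₁ u (covD Γ₁ u η) x) (covD Γ₂ u (covD Γ₂ u ζ) x) (ξ x)
    - obstruction Γ₁ Γ₂ W₁ W₂ (u x) (covD Γ₁ u (covD Γ₁ u ζ) x) (covD Γ₂ u (covD Γ₂ u η) x) (ξ x)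

theorem smoothPeriodic_dot (hξ : SmoothPeriodic ξ) (hv : SmoothPeriodic v) :
    SmoothPeriodic fun x => dot (ξ x) (v x) :=
  SmoothPeriodic.sum fun i _ => ((SmoothPeriodic.pi_iff.1 hξ) i).mul
    (hv.clm_comp (EuclideanSpace.proj i : Coord n →L[ℝ] ℝ))

theorem opForm_pencil (μ ν : ℝ) (hξ : SmoothPeriodic ξ) (h₁ : SmoothPeriodic (P₁ u η))
    (h₂ : SmoothPeriodic (P₂ u η)) :
    opForm (μ • P₁ + ν • P₂) ξ η u = μ * opForm P₁ ξ η u + ν * opForm P₂ ξ η u := by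
  have hi : ∀ {a : ℝ → Covec n}, SmoothPeriodic a →
      IntervalIntegrable (fun x => ∑ i, ξ x i * a x i) volume 0 1 := fun ha =>
    (SmoothPeriodic.sum fun i _ => ((SmoothPeriodic.pi_iff.1 hξ) i).mul
      ((SmoothPeriodic.pi_iff.1 ha) i)).continuous.intervalIntegrable _ _
  simp only [opForm]
  rw [← intervalIntegral.integral_const_mul, ← intervalIntegral.integral_const_mul,
    ← intervalIntegral.integral_add ((hi h₁).const_mul μ) ((hi h₂).const_mul ν)]
  congr 1
  funext x
  rw [Finset.mul_sum, Finset.mul_sum, ← Finset.sum_add_distrib]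
  refine Finset.sum_congr rfl fun i _ => ?_
  simp only [Pi.add_apply, Pi.smul_apply, smul_eq_mul]
  ring

theorem FlatData.isFirstOrderForm_of_eq {Γ : Coord n → Coord n →L[ℝ] Covec n →L[ℝ] Covec n}
    {W : Coord n → Covec n →L[ℝ] Covec n →L[ℝ] ℝ} {P : LoopOperator n} (h : FlatData U Γ W)
    (hP : ∀ u ξ, IsLoop U u → SmoothPeriodic ξ → P u ξ = flatOp Γ W u ξ) :
    IsFirstOrderForm U P (flatDensity Γ W) := by
  have hf : ∀ u ξ η, IsLoop U u → SmoothPeriodic η →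
      opForm P ξ η u = opForm (flatOp Γ W) ξ η u := fun u ξ η hu hη => by
    simp only [opForm, hP u η hu hη]
  have h0 := h.isFirstOrderForm
  refine ⟨h0.contDiffOn, fun u ξ hu hξ => ?_, fun u ξ η hu hξ hη => ?_, fun u ξ η hu hξ hη => ?_⟩
  · rw [hP u ξ hu hξ]
    exact h0.smoothPeriodic u ξ hu hξ
  · rw [hf u ξ η hu hη]
    exact h0.form_eq u ξ η hu hξ hη
  · rw [hf u ξ η hu hη, hf u η ξ hu hξ]
    exact h0.skew u ξ η hu hξ hη

theorem IsFirstOrderForm.pencil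
    {q₁ q₂ : Coord n × Coord n × Covec n × Covec n × Covec n × Covec n → ℝ}
    (h₁ : IsFirstOrderForm U P₁ q₁) (h₂ : IsFirstOrderForm U P₂ q₂) (μ ν : ℝ) :
    IsFirstOrderForm U (μ • P₁ + ν • P₂) fun z => μ * q₁ z + ν * q₂ z := by
  refine ⟨(contDiffOn_const.mul h₁.contDiffOn).add (contDiffOn_const.mul h₂.contDiffOn),
    fun u ξ hu hξ => ?_, fun u ξ η hu hξ hη => ?_, fun u ξ η hu hξ hη => ?_⟩
  · exact ((SmoothPeriodic.const μ).smul (h₁.smoothPeriodic u ξ hu hξ)).add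
      ((SmoothPeriodic.const ν).smul (h₂.smoothPeriodic u ξ hu hξ))
  · have hup := hu.smoothPeriodic
    have hi : ∀ {q : Coord n × Coord n × Covec n × Covec n × Covec n × Covec n → ℝ},
        ContDiffOn ℝ ∞ q {z | z.1 ∈ U} → IntervalIntegrable
        (fun x => q (u x, deriv u x, ξ x, deriv ξ x, η x, deriv η x)) volume 0 1 := by
      intro q hq
      refine (hq.continuousOn.comp_continuous ?_ hu.2.2).intervalIntegrable _ _
      exact hup.continuous.prodMk (hup.deriv.continuous.prodMk (hξ.continuous.prodMk
        (hξ.deriv.continuous.prodMk (hη.continuous.prodMk hη.deriv.continuous))))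
    rw [opForm_pencil μ ν hξ (h₁.smoothPeriodic u η hu hη) (h₂.smoothPeriodic u η hu hη),
      h₁.form_eq u ξ η hu hξ hη, h₂.form_eq u ξ η hu hξ hη,
      intervalIntegral.integral_add ((hi h₁.contDiffOn).const_mul μ)
        ((hi h₂.contDiffOn).const_mul ν),
      intervalIntegral.integral_const_mul, intervalIntegral.integral_const_mul]
  · rw [opForm_pencil μ ν hξ (h₁.smoothPeriodic u η hu hη) (h₂.smoothPeriodic u η hu hη),
      opForm_pencil μ ν hη (h₁.smoothPeriodic u ξ hu hξ) (h₂.smoothPeriodic u ξ hu hξ),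
      h₁.skew u ξ η hu hξ hη, h₂.skew u ξ η hu hξ hη]
    ring

/-- The integrand of the derivative of the bilinear form of `♯ ∇_x ∇_x` in the direction `v`. -/
def formVariation (Γ : Coord n → Coord n →L[ℝ] Covec n →L[ℝ] Covec n)
    (W : Coord n → Covec n →L[ℝ] Covec n →L[ℝ] ℝ) (u : ℝ → Coord n) (ξ η : ℝ → Covec n)
    (v : ℝ → Coord n) (x : ℝ) : ℝ :=
  dot (Γ (u x) (v x) (η x)) (toVec (flatOp Γ W u ξ) x)
    - dot (Γ (u x) (v x) (ξ x)) (toVec (flatOp Γ W u η) x)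

theorem FlatData.smoothPeriodic_formVariation
    {Γ : Coord n → Coord n →L[ℝ] Covec n →L[ℝ] Covec n}
    {W : Coord n → Covec n →L[ℝ] Covec n →L[ℝ] ℝ} (h : FlatData U Γ W)
    (hu : IsLoop U u) (hv : SmoothPeriodic v) (hξ : SmoothPeriodic ξ) (hη : SmoothPeriodic η) :
    SmoothPeriodic (formVariation Γ W u ξ η v) :=
  (smoothPeriodic_dot (h.smoothPeriodic_conn_apply hu hv hη)
    (h.smoothPeriodic_flatOp hu hξ).toVec).sub
    (smoothPeriodic_dot (h.smoothPeriodic_conn_apply hu hv hξ)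
      (h.smoothPeriodic_flatOp hu hη).toVec)

theorem FlatData.hasDerivAt_opForm_of_eq {Γ : Coord n → Coord n →L[ℝ] Covec n →L[ℝ] Covec n}
    {W : Coord n → Covec n →L[ℝ] Covec n →L[ℝ] ℝ} {P : LoopOperator n} (h : FlatData U Γ W)
    (hP : ∀ u ξ, IsLoop U u → SmoothPeriodic ξ → P u ξ = flatOp Γ W u ξ)
    (hu : IsLoop U u) (hv : SmoothPeriodic v) (hξ : SmoothPeriodic ξ) (hη : SmoothPeriodic η) :
    HasDerivAt (fun s : ℝ => opForm P ξ η (u + s • v))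
      (∫ x in (0 : ℝ)..1, formVariation Γ W u ξ η v x) 0 := by
  refine ((h.hasDerivAt_opForm hu hv hξ hη).congr_of_eventuallyEq ?_).congr_deriv ?_
  · filter_upwards [eventually_isLoop h.isOpen hu hv] with s hs
    simp only [opForm, hP _ η hs hη]
  · simp only [formVariation, toVec_flatOp, dot_sharp]

theorem hasDerivAt_opForm_pencil (h₁ : FlatData U Γ₁ W₁) (h₂ : FlatData U Γ₂ W₂)
    (hP₁ : ∀ u ξ, IsLoop U u → SmoothPeriodic ξ → P₁ u ξ = flatOp Γ₁ W₁ u ξ)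
    (hP₂ : ∀ u ξ, IsLoop U u → SmoothPeriodic ξ → P₂ u ξ = flatOp Γ₂ W₂ u ξ) (μ ν : ℝ)
    (hu : IsLoop U u) (hv : SmoothPeriodic v) (hξ : SmoothPeriodic ξ) (hη : SmoothPeriodic η) :
    HasDerivAt (fun s : ℝ => opForm (μ • P₁ + ν • P₂) ξ η (u + s • v))
      (∫ x in (0 : ℝ)..1, (μ * formVariation Γ₁ W₁ u ξ η v x
        + ν * formVariation Γ₂ W₂ u ξ η v x)) 0 := by
  rw [intervalIntegral.integral_add
    (((SmoothPeriodic.const μ).mul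
      (h₁.smoothPeriodic_formVariation hu hv hξ hη)).continuous.intervalIntegrable _ _)
    (((SmoothPeriodic.const ν).mul
      (h₂.smoothPeriodic_formVariation hu hv hξ hη)).continuous.intervalIntegrable _ _),
    intervalIntegral.integral_const_mul, intervalIntegral.integral_const_mul]
  refine (((h₁.hasDerivAt_opForm_of_eq hP₁ hu hv hξ hη).const_mul μ).add
    ((h₂.hasDerivAt_opForm_of_eq hP₂ hu hv hξ hη).const_mul ν)).congr_of_eventuallyEq ?_
  filter_upwards [eventually_isLoop h₁.isOpen hu hv] with s hs
  exact opForm_pencil μ ν hξ ((h₁.isFirstOrderForm_of_eq hP₁).smoothPeriodic _ _ hs hη)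
    ((h₂.isFirstOrderForm_of_eq hP₂).smoothPeriodic _ _ hs hη)

/-- The integrand of the Jacobi sum of a pencil. -/
theorem formVariation_cyclic_sum (h₁ : FlatData U Γ₁ W₁) (h₂ : FlatData U Γ₂ W₂) (μ ν : ℝ)
    (hu : IsLoop U u) (ξ η ζ : ℝ → Covec n) (x : ℝ) {a b c : ℝ → Coord n}
    (ha : a x = μ • toVec (flatOp Γ₁ W₁ u ξ) x + ν • toVec (flatOp Γ₂ W₂ u ξ) x)
    (hb : b x = μ • toVec (flatOp Γ₁ W₁ u η) x + ν • toVec (flatOp Γ₂ W₂ u η) x)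
    (hc : c x = μ • toVec (flatOp Γ₁ W₁ u ζ) x + ν • toVec (flatOp Γ₂ W₂ u ζ) x) :
    (μ * formVariation Γ₁ W₁ u ξ η c x + ν * formVariation Γ₂ W₂ u ξ η c x)
      + (μ * formVariation Γ₁ W₁ u η ζ a x + ν * formVariation Γ₂ W₂ u η ζ a x)
      + (μ * formVariation Γ₁ W₁ u ζ ξ b x + ν * formVariation Γ₂ W₂ u ζ ξ b x)
      = -(μ * ν) * (mixedTerm Γ₁ Γ₂ W₁ W₂ u ξ η ζ x + mixedTerm Γ₁ Γ₂ W₁ W₂ u η ζ ξ x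
        + mixedTerm Γ₁ Γ₂ W₁ W₂ u ζ ξ η x) := by
  simp only [formVariation, mixedTerm, obstruction, ha, hb, hc, ← toVec_flatOp]
  set X₁ := toVec (flatOp Γ₁ W₁ u ξ) x
  set X₂ := toVec (flatOp Γ₂ W₂ u ξ) x
  set Y₁ := toVec (flatOp Γ₁ W₁ u η) x
  set Y₂ := toVec (flatOp Γ₂ W₂ u η) x
  set Z₁ := toVec (flatOp Γ₁ W₁ u ζ) x
  set Z₂ := toVec (flatOp Γ₂ W₂ u ζ) x
  simp only [map_add, map_smul, add_apply, sub_apply, smul_apply, dot_add_left, dot_sub_left,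
    dot_smul_left]
  have t₁ := h₁.torsionFree (u x) (hu.2.2 x)
  have t₂ := h₂.torsionFree (u x) (hu.2.2 x)
  -- The squares of μ and ν are the Jacobi sums of the single operators and vanish by
  -- torsion-freeness. In the μν part, torsion-freeness of Γ₁ puts the ♯₁ vector into the connection
  -- slot, so that only Γ₁ - Γ₂ remains.
  linear_combination μ ^ 2 * (t₁ (ξ x) Y₁ Z₁ + t₁ (η x) Z₁ X₁ + t₁ (ζ x) X₁ Y₁)
    + ν ^ 2 * (t₂ (ξ x) Y₂ Z₂ + t₂ (η x) Z₂ X₂ + t₂ (ζ x) X₂ Y₂)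
    + μ * ν * (t₁ (ξ x) Y₂ Z₁ - t₁ (ξ x) Z₂ Y₁ + t₁ (η x) Z₂ X₁ - t₁ (η x) X₂ Z₁
      + t₁ (ζ x) X₂ Y₁ - t₁ (ζ x) Y₂ X₁)

/-- Compatibility of two flat operators in terms of the trilinear form `obstruction`. -/
theorem pencil_isHamiltonian_iff (h₁ : FlatData U Γ₁ W₁) (h₂ : FlatData U Γ₂ W₂)
    (hP₁ : ∀ u ξ, IsLoop U u → SmoothPeriodic ξ → P₁ u ξ = flatOp Γ₁ W₁ u ξ)
    (hP₂ : ∀ u ξ, IsLoop U u → SmoothPeriodic ξ → P₂ u ξ = flatOp Γ₂ W₂ u ξ) :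
    (∀ μ ν : ℝ, IsHamiltonian U (μ • P₁ + ν • P₂)) ↔
      ∀ u ξ η ζ, IsLoop U u → SmoothPeriodic ξ → SmoothPeriodic η → SmoothPeriodic ζ →
        ∫ x in (0 : ℝ)..1, (mixedTerm Γ₁ Γ₂ W₁ W₂ u ξ η ζ x + mixedTerm Γ₁ Γ₂ W₁ W₂ u η ζ ξ x
          + mixedTerm Γ₁ Γ₂ W₁ W₂ u ζ ξ η x) = 0 := by
  have f₁ := h₁.isFirstOrderForm_of_eq hP₁
  have f₂ := h₂.isFirstOrderForm_of_eq hP₂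
  have main : ∀ (μ ν : ℝ) u ξ η ζ, IsLoop U u → SmoothPeriodic ξ → SmoothPeriodic η →
      SmoothPeriodic ζ →
      deriv (fun s : ℝ => opForm (μ • P₁ + ν • P₂) ξ η
          (u + s • toVec ((μ • P₁ + ν • P₂) u ζ))) 0
        + deriv (fun s : ℝ => opForm (μ • P₁ + ν • P₂) η ζ
          (u + s • toVec ((μ • P₁ + ν • P₂) u ξ))) 0
        + deriv (fun s : ℝ => opForm (μ • P₁ + ν • P₂) ζ ξ
          (u + s • toVec ((μ • P₁ + ν • P₂) u η))) 0
      = -(μ * ν) * ∫ x in (0 : ℝ)..1, (mixedTerm Γ₁ Γ₂ W₁ W₂ u ξ η ζ x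
          + mixedTerm Γ₁ Γ₂ W₁ W₂ u η ζ ξ x + mixedTerm Γ₁ Γ₂ W₁ W₂ u ζ ξ η x) := by
    intro μ ν u ξ η ζ hu hξ hη hζ
    have hv : ∀ {θ}, SmoothPeriodic θ → SmoothPeriodic (toVec ((μ • P₁ + ν • P₂) u θ)) :=
      fun hθ => ((f₁.pencil f₂ μ ν).smoothPeriodic u _ hu hθ).toVec
    have hvx : ∀ {θ}, SmoothPeriodic θ → ∀ x, toVec ((μ • P₁ + ν • P₂) u θ) x
        = μ • toVec (flatOp Γ₁ W₁ u θ) x + ν • toVec (flatOp Γ₂ W₂ u θ) x := by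
      intro θ hθ x
      rw [← hP₁ u θ hu hθ, ← hP₂ u θ hu hθ]
      rfl
    have hi : ∀ {a b : ℝ → Covec n} {v : ℝ → Coord n}, SmoothPeriodic a → SmoothPeriodic b →
        SmoothPeriodic v → IntervalIntegrable (fun x => μ * formVariation Γ₁ W₁ u a b v x
          + ν * formVariation Γ₂ W₂ u a b v x) volume 0 1 := fun ha hb hv =>
      (((SmoothPeriodic.const μ).mul (h₁.smoothPeriodic_formVariation hu hv ha hb)).add
        ((SmoothPeriodic.const ν).mul
          (h₂.smoothPeriodic_formVariation hu hv ha hb))).continuous.intervalIntegrable _ _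
    rw [(hasDerivAt_opForm_pencil h₁ h₂ hP₁ hP₂ μ ν hu (hv hζ) hξ hη).deriv,
      (hasDerivAt_opForm_pencil h₁ h₂ hP₁ hP₂ μ ν hu (hv hξ) hη hζ).deriv,
      (hasDerivAt_opForm_pencil h₁ h₂ hP₁ hP₂ μ ν hu (hv hη) hζ hξ).deriv,
      ← intervalIntegral.integral_add (hi hξ hη (hv hζ)) (hi hη hζ (hv hξ)),
      ← intervalIntegral.integral_add ((hi hξ hη (hv hζ)).add (hi hη hζ (hv hξ)))
        (hi hζ hξ (hv hη)), ← intervalIntegral.integral_const_mul]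
    congr 1
    funext x
    exact formVariation_cyclic_sum h₁ h₂ μ ν hu ξ η ζ x (hvx hξ x) (hvx hη x) (hvx hζ x)
  constructor
  · intro h u ξ η ζ hu hξ hη hζ
    -- The Jacobi sum of the pencil is a multiple of μν, so the single member P₁ + P₂ already gives
    -- the condition.
    have := ((f₁.pencil f₂ 1 1).isHamiltonian_iff h₁.isOpen).1 (h 1 1) u ξ η ζ hu hξ hη hζ
    rw [main 1 1 u ξ η ζ hu hξ hη hζ] at this
    linarith
  · intro h μ ν
    refine ((f₁.pencil f₂ μ ν).isHamiltonian_iff h₁.isOpen).2 fun u ξ η ζ hu hξ hη hζ => ?_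
    rw [main μ ν u ξ η ζ hu hξ hη hζ, h u ξ η ζ hu hξ hη hζ, mul_zero]

end Pencil

/-! ### The algebraic conditions imply compatibility -/

section Sufficiency

variable {n : ℕ} {U : Set (Coord n)} {Γ₁ Γ₂ : Coord n → Coord n →L[ℝ] Covec n →L[ℝ] Covec n}
  {W₁ W₂ : Coord n → Covec n →L[ℝ] Covec n →L[ℝ] ℝ} {u : ℝ → Coord n} {ξ η ζ : ℝ → Covec n}

/-- The form `obstruction` is symmetric in its first two arguments, and the products of covectors
`J ∘ K = (Γ₁ - Γ₂)(♯₁ J) K` satisfy `(I ∘ J) ∘ K = 0`. -/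
structure AlgebraicConditions (U : Set (Coord n))
    (Γ₁ Γ₂ : Coord n → Coord n →L[ℝ] Covec n →L[ℝ] Covec n)
    (W₁ W₂ : Coord n → Covec n →L[ℝ] Covec n →L[ℝ] ℝ) : Prop where
  symm : ∀ x ∈ U, ∀ p q ξ, obstruction Γ₁ Γ₂ W₁ W₂ x p q ξ = obstruction Γ₁ Γ₂ W₁ W₂ x q p ξ
  nilpotent : ∀ x ∈ U, ∀ v J K,
    (Γ₁ x - Γ₂ x) (sharp (W₁ x) ((Γ₁ x - Γ₂ x) v J)) K = 0

/-- Nondegeneracy gives injectivity, and the dimensions agree. This allows every vector to be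
written as ♯a. -/
theorem FlatData.sharp_surjective {Γ : Coord n → Coord n →L[ℝ] Covec n →L[ℝ] Covec n}
    {W : Coord n → Covec n →L[ℝ] Covec n →L[ℝ] ℝ} (h : FlatData U Γ W) {x : Coord n}
    (hx : x ∈ U) : Function.Surjective (sharp (W x)) := by
  have hinj : Function.Injective (sharp (W x)).toLinearMap := by
    rw [injective_iff_map_eq_zero]
    intro β hβ
    refine h.nondegenerate x hx β fun α => ?_
    have : sharp (W x) β = 0 := hβ
    rw [h.antisymm x hx, ← dot_sharp, this]
    simp [dot]
  have hf : Module.finrank ℝ (Covec n) = Module.finrank ℝ (Coord n) := by simp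
  exact (LinearMap.injective_iff_surjective_of_finrank_eq_finrank hf).1 hinj

theorem hasDerivAt_sharp {W : ℝ → Covec n →L[ℝ] Covec n →L[ℝ] ℝ}
    {W' : Covec n →L[ℝ] Covec n →L[ℝ] ℝ} {t : ℝ} (hW : HasDerivAt W W' t) (a : Covec n) :
    HasDerivAt (fun s => sharp (W s) a) (sharp W' a) t := by
  have h : HasDerivAt (fun s => fun i => W s (Pi.single i 1) a)
      (fun i => W' (Pi.single i 1) a) t := by
    refine hasDerivAt_pi.2 fun i => ?_
    have := (hW.clm_apply (hasDerivAt_const t (Pi.single i 1 : Covec n))).clm_apply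
      (hasDerivAt_const t a)
    simpa using this
  exact (PiLp.continuousLinearEquiv 2 ℝ
    fun _ : Fin n => ℝ).symm.toContinuousLinearMap.hasFDerivAt.comp_hasDerivAt t h

theorem hasDerivAt_line (x m : Coord n) : HasDerivAt (fun t : ℝ => x + t • m) m 0 := by
  simpa using ((hasDerivAt_id (0 : ℝ)).smul_const m).const_add x

theorem eventually_line_mem (hU : IsOpen U) {x : Coord n} (hx : x ∈ U) (m : Coord n) :
    ∀ᶠ t : ℝ in 𝓝 0, x + t • m ∈ U :=
  (hasDerivAt_line x m).continuousAt.preimage_mem_nhds (hU.mem_nhds (by simpa using hx))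

theorem FlatData.hasDerivAt_conn_line {Γ : Coord n → Coord n →L[ℝ] Covec n →L[ℝ] Covec n}
    {W : Coord n → Covec n →L[ℝ] Covec n →L[ℝ] ℝ} (h : FlatData U Γ W) {x : Coord n}
    (hx : x ∈ U) (m : Coord n) :
    HasDerivAt (fun t : ℝ => Γ (x + t • m)) (fderiv ℝ Γ x m) 0 :=
  hasDerivAt_comp_curve (f := Γ) (by simpa using h.hasFDerivAt_conn hx) (hasDerivAt_line x m)

theorem FlatData.hasDerivAt_form_line {Γ : Coord n → Coord n →L[ℝ] Covec n →L[ℝ] Covec n}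
    {W : Coord n → Covec n →L[ℝ] Covec n →L[ℝ] ℝ} (h : FlatData U Γ W) {x : Coord n}
    (hx : x ∈ U) (m : Coord n) :
    HasDerivAt (fun t : ℝ => W (x + t • m)) (fderiv ℝ W x m) 0 :=
  hasDerivAt_comp_curve (f := W) (by simpa using h.hasFDerivAt_form hx) (hasDerivAt_line x m)

/-- Torsion-freeness holds on an open set, so it can be differentiated along a line. -/
theorem FlatData.torsionFree_fderiv {Γ : Coord n → Coord n →L[ℝ] Covec n →L[ℝ] Covec n}
    {W : Coord n → Covec n →L[ℝ] Covec n →L[ℝ] ℝ} (h : FlatData U Γ W) {x : Coord n}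
    (hx : x ∈ U) (m v w : Coord n) (θ : Covec n) :
    dot (fderiv ℝ Γ x m v θ) w = dot (fderiv ℝ Γ x m w θ) v := by
  have hd : ∀ v w : Coord n, HasDerivAt (fun t : ℝ => dot (Γ (x + t • m) v θ) w)
      (dot (fderiv ℝ Γ x m v θ) w) 0 := by
    intro v w
    have h1 := ((h.hasDerivAt_conn_line hx m).clm_apply (hasDerivAt_const (0 : ℝ) v)).clm_apply
      (hasDerivAt_const (0 : ℝ) θ)
    simp only [map_zero, add_zero] at h1
    have h2 := hasDerivAt_pi.1 h1
    exact HasDerivAt.fun_sum fun i _ => (h2 i).mul_const (w i)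
  refine (hd v w).unique ((hd w v).congr_of_eventuallyEq ?_)
  filter_upwards [eventually_line_mem h.isOpen hx m] with t ht
  exact h.torsionFree _ ht _ _ _

theorem obstruction_eq_form (x : Coord n) (p q ξ : Covec n) :
    obstruction Γ₁ Γ₂ W₁ W₂ x p q ξ = W₂ x ((Γ₁ x - Γ₂ x) (sharp (W₁ x) p) ξ) q := by
  rw [obstruction, dot_sharp]

/-! ### Isotropy of the products of covectors -/

namespace AlgebraicConditions

variable {x : Coord n}

theorem obstruction_eq (hc : AlgebraicConditions U Γ₁ Γ₂ W₁ W₂) (h₂ : FlatData U Γ₂ W₂)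
    (hx : x ∈ U) (p q ξ : Covec n) :
    obstruction Γ₁ Γ₂ W₁ W₂ x p q ξ = -W₂ x p ((Γ₁ x - Γ₂ x) (sharp (W₁ x) q) ξ) := by
  rw [hc.symm x hx, obstruction_eq_form, h₂.antisymm x hx]

/-- By symmetry of the obstruction, pairing p with q ∘ ξ is, up to sign, pairing p ∘ ξ with q. For p
= (Γ₁ - Γ₂)(v)J the product p ∘ ξ vanishes by nilpotency. -/
theorem form_eq_zero (hc : AlgebraicConditions U Γ₁ Γ₂ W₁ W₂) (h₂ : FlatData U Γ₂ W₂)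
    (hx : x ∈ U) (v : Coord n) (J q ξ : Covec n) :
    W₂ x ((Γ₁ x - Γ₂ x) v J) ((Γ₁ x - Γ₂ x) (sharp (W₁ x) q) ξ) = 0 := by
  have h := hc.obstruction_eq h₂ hx ((Γ₁ x - Γ₂ x) v J) q ξ
  rw [obstruction_eq_form, hc.nilpotent x hx] at h
  simp only [map_zero, zero_apply] at h
  linarith

end AlgebraicConditions

theorem hasDerivAt_sub_normed {F : Type*} [NormedAddCommGroup F] [NormedSpace ℝ F]
    {f g : ℝ → F} {f' g' : F} {t : ℝ} (hf : HasDerivAt f f' t) (hg : HasDerivAt g g' t) :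
    HasDerivAt (fun s => f s - g s) (f' - g') t :=
  hf.fun_sub hg

theorem hasDerivAt_prod_line (h₁ : FlatData U Γ₁ W₁) (h₂ : FlatData U Γ₂ W₂) {x : Coord n}
    (hx : x ∈ U) (m : Coord n) (a η : Covec n) : HasDerivAt
      (fun t : ℝ => (Γ₁ (x + t • m) - Γ₂ (x + t • m)) (sharp (W₁ (x + t • m)) a) η)
      ((fderiv ℝ Γ₁ x m - fderiv ℝ Γ₂ x m) (sharp (W₁ x) a) η
        + (Γ₁ x - Γ₂ x) (sharp (fderiv ℝ W₁ x m) a) η) 0 := by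
  have hA : HasDerivAt (fun t : ℝ => Γ₁ (x + t • m) - Γ₂ (x + t • m))
      (fderiv ℝ Γ₁ x m - fderiv ℝ Γ₂ x m) 0 := by
    have k₁ := h₁.hasDerivAt_conn_line hx m
    have k₂ := h₂.hasDerivAt_conn_line hx m
    exact hasDerivAt_sub_normed (F := Coord n →L[ℝ] Covec n →L[ℝ] Covec n) k₁ k₂
  have hS := hasDerivAt_sharp (h₁.hasDerivAt_form_line hx m) a
  have h := (hA.clm_apply hS).clm_apply (hasDerivAt_const (0 : ℝ) η)
  simp only [zero_smul, add_zero, map_zero, add_apply] at h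
  exact h

/-- The derivative of `(Γ₁ - Γ₂)(v) η` in the direction `m`, covariant with respect to its values. -/
def diffDeriv (Γ₁ Γ₂ : Coord n → Coord n →L[ℝ] Covec n →L[ℝ] Covec n) (x m v : Coord n)
    (η : Covec n) : Covec n :=
  fderiv ℝ Γ₁ x m v η - fderiv ℝ Γ₂ x m v η - Γ₂ x m ((Γ₁ x - Γ₂ x) v η)

/-! ### Exchange identities for the derivative of the difference tensor -/

namespace AlgebraicConditions

variable {x : Coord n}

/-- With A = Γ₁ - Γ₂, subtracting the two curvature identities leaves the antisymmetric part
A(m)Γ₁(v)η - A(v)Γ₁(m)η. This is a sum of values of A, hence W₂-orthogonal to every product q ∘ ξ.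
-/
theorem form_diffDeriv_swap (hc : AlgebraicConditions U Γ₁ Γ₂ W₁ W₂) (h₁ : FlatData U Γ₁ W₁)
    (h₂ : FlatData U Γ₂ W₂) (hx : x ∈ U) (m v : Coord n) (η q ξ : Covec n) :
    W₂ x (diffDeriv Γ₁ Γ₂ x m v η) ((Γ₁ x - Γ₂ x) (sharp (W₁ x) q) ξ)
      = W₂ x (diffDeriv Γ₁ Γ₂ x v m η) ((Γ₁ x - Γ₂ x) (sharp (W₁ x) q) ξ) := by
  have h : diffDeriv Γ₁ Γ₂ x m v η - diffDeriv Γ₁ Γ₂ x v m η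
      = (Γ₁ x - Γ₂ x) m (Γ₁ x v η) - (Γ₁ x - Γ₂ x) v (Γ₁ x m η) := by
    have f₁ := h₁.flat x hx m v η
    have f₂ := h₂.flat x hx m v η
    simp only [diffDeriv, sub_apply, map_sub]
    rw [← sub_eq_zero] at f₁ f₂ ⊢
    rw [← sub_eq_zero.2 (f₁.trans f₂.symm)]
    abel
  have h0 : W₂ x (diffDeriv Γ₁ Γ₂ x m v η - diffDeriv Γ₁ Γ₂ x v m η)
      ((Γ₁ x - Γ₂ x) (sharp (W₁ x) q) ξ) = 0 := by
    rw [h, map_sub, sub_apply, hc.form_eq_zero h₂ hx, hc.form_eq_zero h₂ hx, sub_zero]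
  rw [map_sub, sub_apply, sub_eq_zero] at h0
  exact h0

/-- This is the derivative along m of W₂(a ∘ η, q ∘ ξ) = 0. The derivative of W₂ supplies the Γ₂
terms of `diffDeriv`, and the derivatives of W₁ contribute only isotropic terms. Antisymmetry of W₂
removes the sign. -/
theorem form_diffDeriv_comm (hc : AlgebraicConditions U Γ₁ Γ₂ W₁ W₂) (h₁ : FlatData U Γ₁ W₁)
    (h₂ : FlatData U Γ₂ W₂) (hx : x ∈ U) (m : Coord n) (a η q ξ : Covec n) :
    W₂ x (diffDeriv Γ₁ Γ₂ x m (sharp (W₁ x) a) η) ((Γ₁ x - Γ₂ x) (sharp (W₁ x) q) ξ)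
      = W₂ x (diffDeriv Γ₁ Γ₂ x m (sharp (W₁ x) q) ξ) ((Γ₁ x - Γ₂ x) (sharp (W₁ x) a) η) := by
  have hprod := hasDerivAt_prod_line h₁ h₂ hx m
  have hd := ((h₂.hasDerivAt_form_line hx m).clm_apply (hprod a η)).clm_apply (hprod q ξ)
  have hz := hd.unique ((hasDerivAt_const (0 : ℝ) (0 : ℝ)).congr_of_eventuallyEq (by
    filter_upwards [eventually_line_mem h₁.isOpen hx m] with t ht
    exact hc.form_eq_zero h₂ ht _ _ _ _))
  simp only [zero_smul, add_zero, add_apply, map_add, h₂.compat x hx,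
    hc.form_eq_zero h₂ hx] at hz
  have hz2 := hc.form_eq_zero h₂ hx (sharp (fderiv ℝ W₁ x m) q) ξ a η
  rw [h₂.antisymm x hx] at hz2
  have hl := h₂.antisymm x hx (diffDeriv Γ₁ Γ₂ x m (sharp (W₁ x) q) ξ)
    ((Γ₁ x - Γ₂ x) (sharp (W₁ x) a) η)
  rw [hl]
  simp only [diffDeriv, map_sub, sub_apply] at hz hz2 ⊢
  linarith

theorem form_diffDeriv_symm (hc : AlgebraicConditions U Γ₁ Γ₂ W₁ W₂) (h₁ : FlatData U Γ₁ W₁)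
    (h₂ : FlatData U Γ₂ W₂) (hx : x ∈ U) (m v : Coord n) (η q ξ : Covec n) :
    W₂ x (diffDeriv Γ₁ Γ₂ x m v η) ((Γ₁ x - Γ₂ x) (sharp (W₁ x) q) ξ)
      = W₂ x (diffDeriv Γ₁ Γ₂ x m v ξ) ((Γ₁ x - Γ₂ x) (sharp (W₁ x) q) η) := by
  obtain ⟨c, rfl⟩ := h₁.sharp_surjective hx m
  obtain ⟨a, rfl⟩ := h₁.sharp_surjective hx v
  -- Denote the left side by (c; a, η | q, ξ). One exchange swaps the two pairs, the other swaps c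
  -- with a. Alternating them gives (c; q, ξ | a, η), (q; c, ξ | a, η), (q; a, η | c, ξ), (a; q, η |
  -- c, ξ), (a; c, ξ | q, η) and finally (c; a, ξ | q, η).
  rw [hc.form_diffDeriv_comm h₁ h₂ hx, hc.form_diffDeriv_swap h₁ h₂ hx,
    hc.form_diffDeriv_comm h₁ h₂ hx, hc.form_diffDeriv_swap h₁ h₂ hx,
    hc.form_diffDeriv_comm h₁ h₂ hx, hc.form_diffDeriv_swap h₁ h₂ hx]

end AlgebraicConditions

theorem FlatData.deriv_covD {n : ℕ} {U : Set (Coord n)}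
    {Γ : Coord n → Coord n →L[ℝ] Covec n →L[ℝ] Covec n}
    {W : Coord n → Covec n →L[ℝ] Covec n →L[ℝ] ℝ} (h : FlatData U Γ W) {u : ℝ → Coord n}
    {η : ℝ → Covec n} (hu : IsLoop U u) (hη : SmoothPeriodic η) (x : ℝ) :
    deriv (covD Γ u η) x = deriv (deriv η) x - (fderiv ℝ Γ (u x) (deriv u x) (deriv u x) (η x)
      + Γ (u x) (deriv (deriv u) x) (η x) + Γ (u x) (deriv u x) (deriv η x)) := by
  have hΓ : HasDerivAt (fun x => Γ (u x)) (fderiv ℝ Γ (u x) (deriv u x)) x :=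
    hasDerivAt_comp_curve (f := Γ) (h.hasFDerivAt_conn (hu.2.2 x)) (hu.smoothPeriodic.hasDerivAt x)
  have := ((hη.deriv.hasDerivAt x).sub ((hΓ.clm_apply
    (hu.smoothPeriodic.deriv.hasDerivAt x)).clm_apply (hη.hasDerivAt x))).deriv
  refine Eq.trans this ?_
  simp only [add_apply]

/-- Comparison of the second covariant derivatives of the two connections. -/
theorem covD_covD_sub (h₁ : FlatData U Γ₁ W₁) (h₂ : FlatData U Γ₂ W₂) (hu : IsLoop U u)
    (hη : SmoothPeriodic η) (x : ℝ) :
    covD Γ₁ u (covD Γ₁ u η) x = covD Γ₂ u (covD Γ₂ u η) x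
      - diffDeriv Γ₁ Γ₂ (u x) (deriv u x) (deriv u x) (η x)
      - (Γ₁ (u x) - Γ₂ (u x)) (deriv (deriv u) x) (η x)
      - (Γ₁ (u x) - Γ₂ (u x)) (deriv u x) (deriv η x)
      - (Γ₁ (u x) - Γ₂ (u x)) (deriv u x) (covD Γ₁ u η x) := by
  have e₁ : covD Γ₁ u (covD Γ₁ u η) x
      = deriv (covD Γ₁ u η) x - Γ₁ (u x) (deriv u x) (covD Γ₁ u η x) := rfl
  have e₂ : covD Γ₂ u (covD Γ₂ u η) x
      = deriv (covD Γ₂ u η) x - Γ₂ (u x) (deriv u x) (covD Γ₂ u η x) := rfl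
  rw [e₁, e₂, h₁.deriv_covD hu hη, h₂.deriv_covD hu hη]
  simp only [covD, diffDeriv, sub_apply, map_sub]
  abel

/-- The two second covariant derivatives differ by values of Γ₁ - Γ₂, which isotropy kills, and by
one `diffDeriv` term. This brings the whole Jacobi integrand to the single connection ∇². -/
theorem AlgebraicConditions.obstruction_covD (hc : AlgebraicConditions U Γ₁ Γ₂ W₁ W₂)
    (h₁ : FlatData U Γ₁ W₁) (h₂ : FlatData U Γ₂ W₂) (hu : IsLoop U u) (hη : SmoothPeriodic η)
    (q ξ : Covec n) (x : ℝ) :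
    obstruction Γ₁ Γ₂ W₁ W₂ (u x) (covD Γ₁ u (covD Γ₁ u η) x) q ξ
      = obstruction Γ₁ Γ₂ W₁ W₂ (u x) (covD Γ₂ u (covD Γ₂ u η) x) q ξ
        + W₂ (u x) (diffDeriv Γ₁ Γ₂ (u x) (deriv u x) (deriv u x) (η x))
          ((Γ₁ (u x) - Γ₂ (u x)) (sharp (W₁ (u x)) q) ξ) := by
  have hx := hu.2.2 x
  rw [hc.obstruction_eq h₂ hx, hc.obstruction_eq h₂ hx, covD_covD_sub h₁ h₂ hu hη]
  have hz := fun v J => hc.form_eq_zero h₂ hx v J q ξ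
  rw [map_sub, map_sub, map_sub, map_sub, sub_apply, sub_apply, sub_apply, sub_apply, hz, hz, hz]
  ring

/-- Under the algebraic conditions the Jacobi sum of the pencil vanishes pointwise. -/
theorem AlgebraicConditions.mixedTerm_cyclic_sum (hc : AlgebraicConditions U Γ₁ Γ₂ W₁ W₂)
    (h₁ : FlatData U Γ₁ W₁) (h₂ : FlatData U Γ₂ W₂) (hu : IsLoop U u) (hξ : SmoothPeriodic ξ)
    (hη : SmoothPeriodic η) (hζ : SmoothPeriodic ζ) (x : ℝ) :
    mixedTerm Γ₁ Γ₂ W₁ W₂ u ξ η ζ x + mixedTerm Γ₁ Γ₂ W₁ W₂ u η ζ ξ x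
      + mixedTerm Γ₁ Γ₂ W₁ W₂ u ζ ξ η x = 0 := by
  have hx := hu.2.2 x
  simp only [mixedTerm, hc.obstruction_covD h₁ h₂ hu hξ, hc.obstruction_covD h₁ h₂ hu hη,
    hc.obstruction_covD h₁ h₂ hu hζ]
  have s := hc.symm (u x) hx
  have d := fun η q ξ => hc.form_diffDeriv_symm h₁ h₂ hx (deriv u x) (deriv u x) η q ξ
  -- The terms with two ∇² second derivatives cancel by symmetry of the obstruction. The `diffDeriv`
  -- terms cancel between neighbouring cyclic terms once their two covector arguments are exchanged.
  rw [s (covD Γ₂ u (covD Γ₂ u η) x) (covD Γ₂ u (covD Γ₂ u ζ) x),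
    s (covD Γ₂ u (covD Γ₂ u ζ) x) (covD Γ₂ u (covD Γ₂ u ξ) x),
    s (covD Γ₂ u (covD Γ₂ u ξ) x) (covD Γ₂ u (covD Γ₂ u η) x),
    d (η x) _ (ξ x), d (ζ x) _ (η x), d (ξ x) _ (ζ x)]
  ring

/-! ### Symmetry of the covariant derivative of the product -/

/-- The covariant derivative in the direction `m` of the product `a ∘ η = (Γ₁ - Γ₂)(♯₁ a) η`,
with respect to the second connection, is symmetric. -/
theorem AlgebraicConditions.dot_covDeriv_prod_symm {x : Coord n}
    (hc : AlgebraicConditions U Γ₁ Γ₂ W₁ W₂) (h₁ : FlatData U Γ₁ W₁) (h₂ : FlatData U Γ₂ W₂)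
    (hx : x ∈ U) (m w : Coord n) (a η : Covec n) :
    dot ((fderiv ℝ Γ₁ x m - fderiv ℝ Γ₂ x m) (sharp (W₁ x) a) η
        + (Γ₁ x - Γ₂ x) (sharp (fderiv ℝ W₁ x m) a) η
        + (Γ₁ x - Γ₂ x) (sharp (W₁ x) (Γ₂ x m a)) η
        + (Γ₁ x - Γ₂ x) (sharp (W₁ x) a) (Γ₂ x m η)
        - Γ₂ x m ((Γ₁ x - Γ₂ x) (sharp (W₁ x) a) η)) w
      = dot ((fderiv ℝ Γ₁ x w - fderiv ℝ Γ₂ x w) (sharp (W₁ x) a) η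
        + (Γ₁ x - Γ₂ x) (sharp (fderiv ℝ W₁ x w) a) η
        + (Γ₁ x - Γ₂ x) (sharp (W₁ x) (Γ₂ x w a)) η
        + (Γ₁ x - Γ₂ x) (sharp (W₁ x) a) (Γ₂ x w η)
        - Γ₂ x w ((Γ₁ x - Γ₂ x) (sharp (W₁ x) a) η)) m := by
  have tA : ∀ v w θ, dot ((Γ₁ x - Γ₂ x) v θ) w = dot ((Γ₁ x - Γ₂ x) w θ) v := by
    intro v w θ
    simp only [sub_apply, dot_sub_left, h₁.torsionFree x hx θ v w, h₂.torsionFree x hx θ v w]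
  have key : ∀ m w : Coord n,
      dot ((fderiv ℝ Γ₁ x m - fderiv ℝ Γ₂ x m) (sharp (W₁ x) a) η
        + (Γ₁ x - Γ₂ x) (sharp (fderiv ℝ W₁ x m) a) η
        + (Γ₁ x - Γ₂ x) (sharp (W₁ x) (Γ₂ x m a)) η
        + (Γ₁ x - Γ₂ x) (sharp (W₁ x) a) (Γ₂ x m η)
        - Γ₂ x m ((Γ₁ x - Γ₂ x) (sharp (W₁ x) a) η)) w
      = dot (fderiv ℝ Γ₁ x m w η - fderiv ℝ Γ₂ x m w η) (sharp (W₁ x) a)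
        - dot (Γ₁ x m ((Γ₁ x - Γ₂ x) w η)) (sharp (W₁ x) a)
        + dot ((Γ₁ x - Γ₂ x) w (Γ₂ x m η)) (sharp (W₁ x) a)
        - dot (Γ₂ x m ((Γ₁ x - Γ₂ x) (sharp (W₁ x) a) η)) w := by
    intro m w
    have e0 : dot ((Γ₁ x - Γ₂ x) (sharp (fderiv ℝ W₁ x m) a) η) w
        = -dot (Γ₁ x m ((Γ₁ x - Γ₂ x) w η)) (sharp (W₁ x) a)
          - dot ((Γ₁ x - Γ₂ x) w η) (sharp (W₁ x) (Γ₁ x m a)) := by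
      rw [tA, dot_sharp, h₁.compat x hx, dot_sharp, dot_sharp]
    have e1 : dot ((Γ₁ x - Γ₂ x) (sharp (W₁ x) (Γ₂ x m a)) η) w
        = dot ((Γ₁ x - Γ₂ x) w η) (sharp (W₁ x) (Γ₂ x m a)) := tA _ _ _
    -- W₁ is parallel for ∇¹, whereas the covariant derivative is taken with ∇². The mismatch is
    -- ♯₁((Γ₁ - Γ₂)(m)a), which nilpotency annihilates.
    have e2 : dot ((Γ₁ x - Γ₂ x) w η) (sharp (W₁ x) (Γ₁ x m a))
        - dot ((Γ₁ x - Γ₂ x) w η) (sharp (W₁ x) (Γ₂ x m a)) = 0 := by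
      rw [← dot_sub_right, ← map_sub]
      have : Γ₁ x m a - Γ₂ x m a = (Γ₁ x - Γ₂ x) m a := rfl
      rw [this, ← tA, hc.nilpotent x hx, dot_zero_left]
    have e3 : dot ((fderiv ℝ Γ₁ x m - fderiv ℝ Γ₂ x m) (sharp (W₁ x) a) η) w
        = dot (fderiv ℝ Γ₁ x m w η - fderiv ℝ Γ₂ x m w η) (sharp (W₁ x) a) := by
      simp only [sub_apply, dot_sub_left, h₁.torsionFree_fderiv hx m (sharp (W₁ x) a) w,
        h₂.torsionFree_fderiv hx m (sharp (W₁ x) a) w]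
    have e4 := tA (sharp (W₁ x) a) w (Γ₂ x m η)
    rw [dot_sub_left, dot_add_left, dot_add_left, dot_add_left, e0, e1, e3, e4]
    linarith
  rw [key m w, key w m, h₂.torsionFree x hx _ m w]
  -- The curvature identities, paired with ♯₁a, account for all remaining antisymmetry in m and w.
  have f₁ := congrArg (fun α => dot α (sharp (W₁ x) a)) (h₁.flat x hx m w η)
  have f₂ := congrArg (fun α => dot α (sharp (W₁ x) a)) (h₂.flat x hx m w η)
  simp only [sub_apply, map_sub, dot_sub_left] at f₁ f₂ ⊢
  linarith

end Sufficiency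

/-! ### Compatibility implies the algebraic conditions -/

section Necessity

variable {n : ℕ} {U : Set (Coord n)} {Γ₁ Γ₂ : Coord n → Coord n →L[ℝ] Covec n →L[ℝ] Covec n}
  {W₁ W₂ : Coord n → Covec n →L[ℝ] Covec n →L[ℝ] ℝ}

theorem obstruction_sub_left (x : Coord n) (p p' q ξ : Covec n) :
    obstruction Γ₁ Γ₂ W₁ W₂ x (p - p') q ξ
      = obstruction Γ₁ Γ₂ W₁ W₂ x p q ξ - obstruction Γ₁ Γ₂ W₁ W₂ x p' q ξ := by
  simp only [obstruction_eq_form]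
  rw [map_sub, map_sub, sub_apply, map_sub, sub_apply]

theorem obstruction_sub_mid (x : Coord n) (p q q' ξ : Covec n) :
    obstruction Γ₁ Γ₂ W₁ W₂ x p (q - q') ξ
      = obstruction Γ₁ Γ₂ W₁ W₂ x p q ξ - obstruction Γ₁ Γ₂ W₁ W₂ x p q' ξ := by
  simp only [obstruction_eq_form, map_sub]

theorem obstruction_smul_left (x : Coord n) (c : ℝ) (p q ξ : Covec n) :
    obstruction Γ₁ Γ₂ W₁ W₂ x (c • p) q ξ = c * obstruction Γ₁ Γ₂ W₁ W₂ x p q ξ := by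
  simp only [obstruction_eq_form]
  rw [map_smul, map_smul, smul_apply, map_smul, smul_apply, smul_eq_mul]

theorem obstruction_smul_mid (x : Coord n) (c : ℝ) (p q ξ : Covec n) :
    obstruction Γ₁ Γ₂ W₁ W₂ x p (c • q) ξ = c * obstruction Γ₁ Γ₂ W₁ W₂ x p q ξ := by
  simp only [obstruction_eq_form, map_smul, smul_eq_mul]

theorem obstruction_smul_right (x : Coord n) (c : ℝ) (p q ξ : Covec n) :
    obstruction Γ₁ Γ₂ W₁ W₂ x p q (c • ξ) = c * obstruction Γ₁ Γ₂ W₁ W₂ x p q ξ := by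
  simp only [obstruction_eq_form, map_smul, smul_eq_mul, smul_apply]

theorem continuous_obstruction (h₁ : FlatData U Γ₁ W₁) (h₂ : FlatData U Γ₂ W₂) {T : Type*}
    [TopologicalSpace T] {y : T → Coord n} (hy : Continuous y) (hyU : ∀ t, y t ∈ U)
    {p q ξ : T → Covec n} (hp : Continuous p) (hq : Continuous q) (hξ : Continuous ξ) :
    Continuous fun t => obstruction Γ₁ Γ₂ W₁ W₂ (y t) (p t) (q t) (ξ t) := by
  have c₁ := h₁.smooth_conn.continuousOn.comp_continuous hy hyU
  have c₂ := h₂.smooth_conn.continuousOn.comp_continuous hy hyU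
  have w₁ := h₁.smooth_form.continuousOn.comp_continuous hy hyU
  have w₂ := h₂.smooth_form.continuousOn.comp_continuous hy hyU
  have hs : Continuous fun t => sharp (W₁ (y t)) (p t) :=
    (PiLp.continuousLinearEquiv 2 ℝ fun _ : Fin n => ℝ).symm.continuous.comp
      (continuous_pi fun i => (w₁.clm_apply continuous_const).clm_apply hp)
  simp only [obstruction_eq_form, sub_apply]
  have d₁ := (c₁.clm_apply hs).clm_apply hξ
  have d₂ := (c₂.clm_apply hs).clm_apply hξ
  exact (w₂.clm_apply (d₁.sub d₂)).clm_apply hq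

/-! #### Trigonometric test functions -/

theorem smoothPeriodic_sin : SmoothPeriodic fun x : ℝ => Real.sin (2 * Real.pi * x) := by
  refine ⟨by fun_prop, fun x => ?_⟩
  simp only [mul_add, mul_one, Real.sin_add_two_pi]

theorem smoothPeriodic_cos : SmoothPeriodic fun x : ℝ => Real.cos (2 * Real.pi * x) := by
  refine ⟨by fun_prop, fun x => ?_⟩
  simp only [mul_add, mul_one, Real.cos_add_two_pi]

theorem deriv_sin_two_pi : deriv (fun x : ℝ => Real.sin (2 * Real.pi * x))
    = fun x => 2 * Real.pi * Real.cos (2 * Real.pi * x) := by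
  funext x
  have h : HasDerivAt (fun x : ℝ => 2 * Real.pi * x) (2 * Real.pi) x := by
    simpa using (hasDerivAt_id x).const_mul (2 * Real.pi)
  rw [h.sin.deriv, mul_comm]

theorem deriv_cos_two_pi : deriv (fun x : ℝ => Real.cos (2 * Real.pi * x))
    = fun x => -(2 * Real.pi) * Real.sin (2 * Real.pi * x) := by
  funext x
  have h : HasDerivAt (fun x : ℝ => 2 * Real.pi * x) (2 * Real.pi) x := by
    simpa using (hasDerivAt_id x).const_mul (2 * Real.pi)
  rw [h.cos.deriv]
  ring

theorem deriv_deriv_cos : deriv (deriv fun x : ℝ => Real.cos (2 * Real.pi * x))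
    = fun x => -(2 * Real.pi) ^ 2 * Real.cos (2 * Real.pi * x) := by
  rw [deriv_cos_two_pi]
  funext x
  rw [deriv_const_mul _ (smoothPeriodic_sin.differentiable x), deriv_sin_two_pi]
  ring

theorem integral_cos_deriv_ne_zero :
    ∫ x in (0 : ℝ)..1, deriv (deriv fun x : ℝ => Real.cos (2 * Real.pi * x)) x
      * deriv (deriv fun x : ℝ => Real.cos (2 * Real.pi * x)) x ≠ 0 := by
  refine (intervalIntegral.integral_pos zero_lt_one ?_ (fun y _ => mul_self_nonneg _)
    ⟨0, by simp, ?_⟩).ne'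
  · exact (smoothPeriodic_cos.deriv.deriv.mul smoothPeriodic_cos.deriv.deriv).continuous.continuousOn
  · rw [deriv_deriv_cos]
    have := Real.pi_pos
    simp only [mul_zero, Real.cos_zero, mul_one, neg_mul_neg]
    positivity

/-! #### Constant loops -/

theorem deriv_smul_covec {g : ℝ → ℝ} (hg : SmoothPeriodic g) (J : Covec n) :
    deriv (fun y => g y • J) = fun y => deriv g y • J :=
  funext fun y => ((hg.hasDerivAt y).smul_const J).deriv

theorem covD_const (Γ : Coord n → Coord n →L[ℝ] Covec n →L[ℝ] Covec n) (x₀ : Coord n)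
    (θ : ℝ → Covec n) : covD Γ (fun _ => x₀) θ = deriv θ := by
  funext x
  simp [covD]

/-- The vanishing of the Jacobi sums of a pencil. -/
def MixedVanish (U : Set (Coord n)) (Γ₁ Γ₂ : Coord n → Coord n →L[ℝ] Covec n →L[ℝ] Covec n)
    (W₁ W₂ : Coord n → Covec n →L[ℝ] Covec n →L[ℝ] ℝ) : Prop :=
  ∀ u ξ η ζ, IsLoop U u → SmoothPeriodic ξ → SmoothPeriodic η → SmoothPeriodic ζ →
    ∫ x in (0 : ℝ)..1, (mixedTerm Γ₁ Γ₂ W₁ W₂ u ξ η ζ x + mixedTerm Γ₁ Γ₂ W₁ W₂ u η ζ ξ x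
      + mixedTerm Γ₁ Γ₂ W₁ W₂ u ζ ξ η x) = 0

/-- On a constant loop ∇_x is d/dx. With ξ = I constant, η = cJ and ζ = cK, every term containing
ξ'' drops out. The Jacobi integral is then ∫ (c'')² times the difference of the two sides, and c =
cos(2πx) makes the first factor nonzero. -/
theorem MixedVanish.obstruction_symm (h : MixedVanish U Γ₁ Γ₂ W₁ W₂) {x₀ : Coord n}
    (hx : x₀ ∈ U) (J K I : Covec n) :
    obstruction Γ₁ Γ₂ W₁ W₂ x₀ J K I = obstruction Γ₁ Γ₂ W₁ W₂ x₀ K J I := by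
  set c : ℝ → ℝ := fun x => Real.cos (2 * Real.pi * x) with hc_def
  have hc : SmoothPeriodic c := smoothPeriodic_cos
  have hI : SmoothPeriodic fun _ : ℝ => I := SmoothPeriodic.const I
  have hJ := hc.smul (SmoothPeriodic.const J)
  have hK := hc.smul (SmoothPeriodic.const K)
  have h0 := h (fun _ => x₀) _ _ _ ⟨contDiff_const, fun _ => rfl, fun _ => hx⟩ hI hJ hK
  have hd : deriv (fun _ : ℝ => I) = fun _ => 0 := by funext x; simp
  have hd0 : deriv (fun _ : ℝ => (0 : Covec n)) = fun _ => 0 := by funext x; simp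
  have hz₁ : ∀ q ξ, obstruction Γ₁ Γ₂ W₁ W₂ x₀ 0 q ξ = 0 := fun q ξ => by
    have := obstruction_smul_left (Γ₁ := Γ₁) (Γ₂ := Γ₂) (W₁ := W₁) (W₂ := W₂) x₀ 0 0 q ξ
    simpa using this
  have hz₂ : ∀ p ξ, obstruction Γ₁ Γ₂ W₁ W₂ x₀ p 0 ξ = 0 := fun p ξ => by
    have := obstruction_smul_mid (Γ₁ := Γ₁) (Γ₂ := Γ₂) (W₁ := W₁) (W₂ := W₂) x₀ 0 p 0 ξ
    simpa using this
  simp only [mixedTerm, covD_const, deriv_smul_covec hc, deriv_smul_covec hc.deriv, hd, hd0,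
    obstruction_smul_left, obstruction_smul_mid, hz₁, hz₂, sub_zero, add_zero] at h0
  have h1 : ∀ x, deriv (deriv c) x * (deriv (deriv c) x * obstruction Γ₁ Γ₂ W₁ W₂ x₀ J K I)
      - deriv (deriv c) x * (deriv (deriv c) x * obstruction Γ₁ Γ₂ W₁ W₂ x₀ K J I)
      = deriv (deriv c) x * deriv (deriv c) x * (obstruction Γ₁ Γ₂ W₁ W₂ x₀ J K I
        - obstruction Γ₁ Γ₂ W₁ W₂ x₀ K J I) := fun x => by ring
  simp only [h1, intervalIntegral.integral_mul_const] at h0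
  exact sub_eq_zero.1 ((mul_eq_zero.1 h0).resolve_left integral_cos_deriv_ne_zero)

/-! #### Loops on a line -/

/-- The deviation of the second covariant derivative of `g J` from `g'' J` along the curve
`x₀ + δ s v`, divided by `-δ`. -/
def lineTerm (Γ : Coord n → Coord n →L[ℝ] Covec n →L[ℝ] Covec n) (x₀ v : Coord n) (s g : ℝ → ℝ)
    (J : Covec n) (δ x : ℝ) : Covec n :=
  (2 * deriv s x * deriv g x + deriv (deriv s) x * g x) • Γ (x₀ + δ • s x • v) v J
    + (δ * deriv s x ^ 2 * g x) • (fderiv ℝ Γ (x₀ + δ • s x • v) v v J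
      - Γ (x₀ + δ • s x • v) v (Γ (x₀ + δ • s x • v) v J))

theorem FlatData.covD_covD_line {Γ : Coord n → Coord n →L[ℝ] Covec n →L[ℝ] Covec n}
    {W : Coord n → Covec n →L[ℝ] Covec n →L[ℝ] ℝ} (h : FlatData U Γ W) {x₀ v : Coord n}
    {s g : ℝ → ℝ} (hs : SmoothPeriodic s) (hg : SmoothPeriodic g) (J : Covec n) {δ : ℝ}
    (hU : ∀ x, x₀ + δ • s x • v ∈ U) (x : ℝ) :
    covD Γ (fun y => x₀ + δ • s y • v) (covD Γ (fun y => x₀ + δ • s y • v) fun y => g y • J) x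
      = deriv (deriv g) x • J - δ • lineTerm Γ x₀ v s g J δ x := by
  have hu : ∀ y, HasDerivAt (fun y => x₀ + δ • s y • v) (δ • deriv s y • v) y := fun y =>
    (((hs.hasDerivAt y).smul_const v).const_smul δ).const_add x₀
  have h1 : (covD Γ (fun y => x₀ + δ • s y • v) fun y => g y • J) = fun y =>
      deriv g y • J - (δ * deriv s y * g y) • Γ (x₀ + δ • s y • v) v J := by
    funext y
    rw [covD, (hu y).deriv, deriv_smul_covec hg]
    simp only [map_smul, smul_apply, smul_smul]
    congr 2
    ring
  have hΓ : HasDerivAt (fun y => Γ (x₀ + δ • s y • v))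
      (fderiv ℝ Γ (x₀ + δ • s x • v) (δ • deriv s x • v)) x :=
    hasDerivAt_comp_curve (f := Γ) (h.hasFDerivAt_conn (hU x)) (hu x)
  have hΓ' := (hΓ.clm_apply (hasDerivAt_const x v)).clm_apply (hasDerivAt_const x J)
  simp only [map_zero, add_zero] at hΓ'
  have hd := ((hg.deriv.hasDerivAt x).smul_const J).sub
    ((((hs.deriv.hasDerivAt x).const_mul δ).mul (hg.hasDerivAt x)).smul hΓ')
  rw [h1, covD, (hu x).deriv]
  have hd' := hd.deriv
  have e : deriv (fun y => deriv g y • J - (δ * deriv s y * g y) • Γ (x₀ + δ • s y • v) v J) x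
      = _ := hd'
  rw [e]
  simp only [lineTerm, map_smul, smul_apply, map_sub, Pi.mul_apply]
  module

/-- The Jacobi integrand of a pencil along `x₀ + δ s v`, divided by `δ`. -/
def lineMixed (Γ₁ Γ₂ : Coord n → Coord n →L[ℝ] Covec n →L[ℝ] Covec n)
    (W₁ W₂ : Coord n → Covec n →L[ℝ] Covec n →L[ℝ] ℝ) (x₀ v : Coord n) (s f g h : ℝ → ℝ)
    (I J K : Covec n) (δ x : ℝ) : ℝ :=
  obstruction Γ₁ Γ₂ W₁ W₂ (x₀ + δ • s x • v) (deriv (deriv g) x • J)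
      (lineTerm Γ₁ x₀ v s h K δ x - lineTerm Γ₂ x₀ v s h K δ x) (f x • I)
    - obstruction Γ₁ Γ₂ W₁ W₂ (x₀ + δ • s x • v)
      (lineTerm Γ₁ x₀ v s g J δ x - lineTerm Γ₂ x₀ v s g J δ x) (deriv (deriv h) x • K) (f x • I)
    + δ * (obstruction Γ₁ Γ₂ W₁ W₂ (x₀ + δ • s x • v) (lineTerm Γ₁ x₀ v s g J δ x)
        (lineTerm Γ₂ x₀ v s h K δ x) (f x • I)
      - obstruction Γ₁ Γ₂ W₁ W₂ (x₀ + δ • s x • v) (lineTerm Γ₂ x₀ v s g J δ x)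
        (lineTerm Γ₁ x₀ v s h K δ x) (f x • I))

/-- At δ = 0 both connections give the same second derivatives, so symmetry of the obstruction
cancels the zeroth order and a factor δ splits off exactly. -/
theorem mixedTerm_line (h₁ : FlatData U Γ₁ W₁) (h₂ : FlatData U Γ₂ W₂)
    (hsymm : ∀ x ∈ U, ∀ p q ξ,
      obstruction Γ₁ Γ₂ W₁ W₂ x p q ξ = obstruction Γ₁ Γ₂ W₁ W₂ x q p ξ)
    {x₀ v : Coord n} {s g h : ℝ → ℝ} (f : ℝ → ℝ) (hs : SmoothPeriodic s)
    (hg : SmoothPeriodic g) (hh : SmoothPeriodic h) (I J K : Covec n) {δ : ℝ}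
    (hU : ∀ x, x₀ + δ • s x • v ∈ U) (x : ℝ) :
    mixedTerm Γ₁ Γ₂ W₁ W₂ (fun y => x₀ + δ • s y • v) (fun y => f y • I) (fun y => g y • J)
      (fun y => h y • K) x = δ * lineMixed Γ₁ Γ₂ W₁ W₂ x₀ v s f g h I J K δ x := by
  simp only [mixedTerm, h₁.covD_covD_line hs hg J hU, h₁.covD_covD_line hs hh K hU,
    h₂.covD_covD_line hs hg J hU, h₂.covD_covD_line hs hh K hU]
  rw [hsymm _ (hU x) (deriv (deriv h) x • K - δ • lineTerm Γ₁ x₀ v s h K δ x)]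
  simp only [lineMixed, obstruction_sub_left, obstruction_sub_mid]
  simp only [obstruction_smul_left _ δ, obstruction_smul_mid _ δ]
  ring

theorem continuous_lineTerm {Γ : Coord n → Coord n →L[ℝ] Covec n →L[ℝ] Covec n}
    {W : Coord n → Covec n →L[ℝ] Covec n →L[ℝ] ℝ} (h : FlatData U Γ W) {x₀ v : Coord n}
    {s g : ℝ → ℝ} (hs : SmoothPeriodic s) (hg : SmoothPeriodic g) (J : Covec n) {T : Type*}
    [TopologicalSpace T] {δ x : T → ℝ} (hδ : Continuous δ) (hx : Continuous x)
    (hU : ∀ t, x₀ + δ t • s (x t) • v ∈ U) :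
    Continuous fun t => lineTerm Γ x₀ v s g J (δ t) (x t) := by
  have cs := hs.continuous.comp hx
  have cs' := hs.deriv.continuous.comp hx
  have cs'' := hs.deriv.deriv.continuous.comp hx
  have cg := hg.continuous.comp hx
  have cg' := hg.deriv.continuous.comp hx
  have cy : Continuous fun t => x₀ + δ t • s (x t) • v :=
    continuous_const.add (hδ.smul (cs.smul continuous_const))
  have cΓ := h.smooth_conn.continuousOn.comp_continuous cy hU
  have cD := (h.smooth_conn.continuousOn_fderiv_of_isOpen h.isOpen (by simp)).comp_continuous cy hU
  have cΓJ : ∀ {w : T → Covec n}, Continuous w →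
      Continuous fun t => Γ (x₀ + δ t • s (x t) • v) v (w t) := fun hw =>
    (cΓ.clm_apply continuous_const).clm_apply hw
  have cDJ : Continuous fun t => fderiv ℝ Γ (x₀ + δ t • s (x t) • v) v v J :=
    ((cD.clm_apply continuous_const).clm_apply continuous_const).clm_apply continuous_const
  have k₁ := (((continuous_const (y := (2 : ℝ))).mul cs').mul cg').add (cs''.mul cg)
  have k₂ := (hδ.mul (cs'.pow 2)).mul cg
  have cJ := cΓJ (continuous_const (y := J))
  exact (k₁.smul cJ).add (k₂.smul (cDJ.sub (cΓJ cJ)))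

theorem continuous_lineMixed (h₁ : FlatData U Γ₁ W₁) (h₂ : FlatData U Γ₂ W₂)
    {x₀ v : Coord n} {s f g h : ℝ → ℝ} (hs : SmoothPeriodic s) (hf : SmoothPeriodic f)
    (hg : SmoothPeriodic g) (hh : SmoothPeriodic h) (I J K : Covec n) {T : Type*}
    [TopologicalSpace T] {δ x : T → ℝ} (hδ : Continuous δ) (hx : Continuous x)
    (hU : ∀ t, x₀ + δ t • s (x t) • v ∈ U) :
    Continuous fun t => lineMixed Γ₁ Γ₂ W₁ W₂ x₀ v s f g h I J K (δ t) (x t) := by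
  have cy : Continuous fun t => x₀ + δ t • s (x t) • v :=
    continuous_const.add (hδ.smul ((hs.continuous.comp hx).smul continuous_const))
  have o := fun {p q ξ : T → Covec n} => continuous_obstruction h₁ h₂ cy hU (p := p) (q := q)
    (ξ := ξ)
  have l₁ := fun {g : ℝ → ℝ} (hg : SmoothPeriodic g) (J : Covec n) =>
    continuous_lineTerm h₁ (x₀ := x₀) (v := v) hs hg J hδ hx hU
  have l₂ := fun {g : ℝ → ℝ} (hg : SmoothPeriodic g) (J : Covec n) =>
    continuous_lineTerm h₂ (x₀ := x₀) (v := v) hs hg J hδ hx hU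
  have cI : Continuous fun t => f (x t) • I := (hf.continuous.comp hx).smul continuous_const
  have cJ : Continuous fun t => deriv (deriv g) (x t) • J :=
    (hg.deriv.deriv.continuous.comp hx).smul continuous_const
  have cK : Continuous fun t => deriv (deriv h) (x t) • K :=
    (hh.deriv.deriv.continuous.comp hx).smul continuous_const
  exact ((o cJ ((l₁ hh K).sub (l₂ hh K)) cI).sub (o ((l₁ hg J).sub (l₂ hg J)) cK cI)).add
    (hδ.mul ((o (l₁ hg J) (l₂ hh K) cI).sub (o (l₂ hg J) (l₁ hh K) cI)))

/-- The Jacobi identity along `x₀ + δ s v` to first order in `δ`. -/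
theorem MixedVanish.integral_lineMixed (h : MixedVanish U Γ₁ Γ₂ W₁ W₂) (h₁ : FlatData U Γ₁ W₁)
    (h₂ : FlatData U Γ₂ W₂) {x₀ v : Coord n} (hx₀ : x₀ ∈ U) {s a b c : ℝ → ℝ}
    (hs : SmoothPeriodic s) (ha : SmoothPeriodic a) (hb : SmoothPeriodic b)
    (hc : SmoothPeriodic c) (I J K : Covec n) :
    ∫ x in (0 : ℝ)..1, (lineMixed Γ₁ Γ₂ W₁ W₂ x₀ v s a b c I J K 0 x
      + lineMixed Γ₁ Γ₂ W₁ W₂ x₀ v s b c a J K I 0 x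
      + lineMixed Γ₁ Γ₂ W₁ W₂ x₀ v s c a b K I J 0 x) = 0 := by
  have hsv : SmoothPeriodic fun x => s x • v := hs.smul (SmoothPeriodic.const v)
  have hev := eventually_isLoop h₁.isOpen (u := fun _ => x₀)
    ⟨contDiff_const, fun _ => rfl, fun _ => hx₀⟩ hsv
  obtain ⟨ε, hε, hball⟩ := Metric.eventually_nhds_iff.1 hev
  -- The amplitude δ = (ε/2) sin t stays below ε for every real t, so the integrand is continuous on
  -- the whole (t, x)-plane; it vanishes at t = 0 and is positive for small t > 0.
  have hloop : ∀ t : ℝ, IsLoop U fun x => x₀ + (ε / 2 * Real.sin t) • s x • v := by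
    intro t
    refine hball ?_
    rw [Real.dist_eq, sub_zero, abs_mul, abs_of_pos (half_pos hε)]
    have := mul_le_mul_of_nonneg_left (Real.abs_sin_le_one t) (half_pos hε).le
    linarith
  set Ψ : ℝ → ℝ → ℝ := fun t x =>
    lineMixed Γ₁ Γ₂ W₁ W₂ x₀ v s a b c I J K (ε / 2 * Real.sin t) x
      + lineMixed Γ₁ Γ₂ W₁ W₂ x₀ v s b c a J K I (ε / 2 * Real.sin t) x
      + lineMixed Γ₁ Γ₂ W₁ W₂ x₀ v s c a b K I J (ε / 2 * Real.sin t) x with hΨ_def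
  have hΨ : Continuous Ψ.uncurry := by
    have hδ : Continuous fun z : ℝ × ℝ => ε / 2 * Real.sin z.1 := by fun_prop
    have hm : ∀ z : ℝ × ℝ, x₀ + (ε / 2 * Real.sin z.1) • s z.2 • v ∈ U := fun z =>
      (hloop z.1).2.2 z.2
    exact ((continuous_lineMixed h₁ h₂ hs ha hb hc I J K hδ continuous_snd hm).add
      (continuous_lineMixed h₁ h₂ hs hb hc ha J K I hδ continuous_snd hm)).add
      (continuous_lineMixed h₁ h₂ hs hc ha hb K I J hδ continuous_snd hm)
  have hcont := intervalIntegral.continuous_parametric_intervalIntegral_of_continuous'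
    (μ := volume) hΨ 0 1
  have hzero : ∀ t ∈ Ioo (0 : ℝ) 1, ∫ x in (0 : ℝ)..1, Ψ t x = 0 := by
    intro t ht
    have hsin : 0 < Real.sin t := Real.sin_pos_of_pos_of_lt_pi ht.1
      (ht.2.trans (by linarith [Real.pi_gt_three]))
    have h0 := h _ _ _ _ (hloop t) (ha.smul (SmoothPeriodic.const I))
      (hb.smul (SmoothPeriodic.const J)) (hc.smul (SmoothPeriodic.const K))
    have hsymm : ∀ x ∈ U, ∀ p q ξ,
        obstruction Γ₁ Γ₂ W₁ W₂ x p q ξ = obstruction Γ₁ Γ₂ W₁ W₂ x q p ξ :=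
      fun x hx p q ξ => h.obstruction_symm hx p q ξ
    simp only [mixedTerm_line h₁ h₂ hsymm _ hs hb hc I J K (hloop t).2.2,
      mixedTerm_line h₁ h₂ hsymm _ hs hc ha J K I (hloop t).2.2,
      mixedTerm_line h₁ h₂ hsymm _ hs ha hb K I J (hloop t).2.2, ← mul_add,
      intervalIntegral.integral_const_mul] at h0
    -- Division by δ is possible for t > 0; the value at δ = 0 follows by continuity.
    exact (mul_eq_zero.1 h0).resolve_left (mul_pos (half_pos hε) hsin).ne'
  have hlim : Tendsto (fun t => ∫ x in (0 : ℝ)..1, Ψ t x) (𝓝[>] 0)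
      (𝓝 (∫ x in (0 : ℝ)..1, Ψ 0 x)) := hcont.continuousAt.tendsto.mono_left nhdsWithin_le_nhds
  have hlim' : Tendsto (fun t => ∫ x in (0 : ℝ)..1, Ψ t x) (𝓝[>] 0) (𝓝 0) :=
    tendsto_const_nhds.congr' (by
      filter_upwards [Ioo_mem_nhdsGT (zero_lt_one (α := ℝ))] with t ht
      exact (hzero t ht).symm)
  have := tendsto_nhds_unique hlim hlim'
  simpa [hΨ_def] using this

/-- At δ = 0 the curvature-type terms disappear and only (Γ₁ - Γ₂)(v), with the scalar weight 2s'g'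
+ s''g, remains. The condition thus separates into test functions and tensors. -/
theorem lineMixed_zero {x₀ v : Coord n} (hsymm : ∀ p q ξ,
      obstruction Γ₁ Γ₂ W₁ W₂ x₀ p q ξ = obstruction Γ₁ Γ₂ W₁ W₂ x₀ q p ξ)
    (s f g h : ℝ → ℝ) (I J K : Covec n) (x : ℝ) :
    lineMixed Γ₁ Γ₂ W₁ W₂ x₀ v s f g h I J K 0 x
      = deriv (deriv g) x * (2 * deriv s x * deriv h x + deriv (deriv s) x * h x) * f x
          * obstruction Γ₁ Γ₂ W₁ W₂ x₀ ((Γ₁ x₀ - Γ₂ x₀) v K) J I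
        - (2 * deriv s x * deriv g x + deriv (deriv s) x * g x) * deriv (deriv h) x * f x
          * obstruction Γ₁ Γ₂ W₁ W₂ x₀ ((Γ₁ x₀ - Γ₂ x₀) v J) K I := by
  have hl : ∀ (g : ℝ → ℝ) (J : Covec n), lineTerm Γ₁ x₀ v s g J 0 x - lineTerm Γ₂ x₀ v s g J 0 x
      = (2 * deriv s x * deriv g x + deriv (deriv s) x * g x) • (Γ₁ x₀ - Γ₂ x₀) v J := by
    intro g J
    simp only [lineTerm, zero_smul, add_zero, zero_mul, sub_apply, smul_sub, sub_zero]
  simp only [lineMixed, hl, zero_smul, add_zero, zero_mul, obstruction_smul_left,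
    obstruction_smul_mid, obstruction_smul_right, hsymm J]
  ring

end Necessity

/-! ### Choice of test functions in the first-order Jacobi identity -/

section Necessity

variable {n : ℕ} {U : Set (Coord n)} {Γ₁ Γ₂ : Coord n → Coord n →L[ℝ] Covec n →L[ℝ] Covec n}
  {W₁ W₂ : Coord n → Covec n →L[ℝ] Covec n →L[ℝ] ℝ}

/-- The test functions 1, 1, c with s = c = cos(2πx) leave two terms, both with the weight (c'')²
and with opposite signs. -/
theorem MixedVanish.obstruction_diff_symm (h : MixedVanish U Γ₁ Γ₂ W₁ W₂)
    (h₁ : FlatData U Γ₁ W₁) (h₂ : FlatData U Γ₂ W₂) {x₀ : Coord n} (hx₀ : x₀ ∈ U) (v : Coord n)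
    (I J K : Covec n) :
    obstruction Γ₁ Γ₂ W₁ W₂ x₀ ((Γ₁ x₀ - Γ₂ x₀) v I) K J
      = obstruction Γ₁ Γ₂ W₁ W₂ x₀ ((Γ₁ x₀ - Γ₂ x₀) v J) K I := by
  have h0 := h.integral_lineMixed h₁ h₂ (v := v) hx₀ smoothPeriodic_cos (SmoothPeriodic.const 1)
    (SmoothPeriodic.const 1) smoothPeriodic_cos I J K
  have hsymm := fun p q ξ => h.obstruction_symm hx₀ p q ξ
  simp only [lineMixed_zero hsymm] at h0
  set c : ℝ → ℝ := fun x => Real.cos (2 * Real.pi * x) with hc_def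
  have hd : deriv (fun _ : ℝ => (1 : ℝ)) = fun _ => 0 := by funext x; simp
  have hd0 : deriv (fun _ : ℝ => (0 : ℝ)) = fun _ => 0 := by funext x; simp
  have h1 : ∀ a b x : ℝ, deriv (deriv c) x * deriv (deriv c) x * a
      - deriv (deriv c) x * deriv (deriv c) x * b
      = deriv (deriv c) x * deriv (deriv c) x * (a - b) := fun a b x => by ring
  simp only [hd, hd0, zero_mul, mul_zero, mul_one, zero_add, zero_sub, sub_zero, add_zero,
    neg_add_eq_sub, h1, intervalIntegral.integral_mul_const] at h0
  exact sub_eq_zero.1 ((mul_eq_zero.1 h0).resolve_left integral_cos_deriv_ne_zero)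

theorem integral_cos_sq_mul_sin_pow_ne_zero :
    ∫ x in (0 : ℝ)..1, Real.cos (2 * Real.pi * x) ^ 2 * Real.sin (2 * Real.pi * x) ^ 4 ≠ 0 := by
  refine (intervalIntegral.integral_pos zero_lt_one (by fun_prop) (fun y _ => by positivity)
    ⟨1 / 8, by norm_num, ?_⟩).ne'
  have h : 2 * Real.pi * (1 / 8) = Real.pi / 4 := by ring
  rw [h, Real.cos_pi_div_four, Real.sin_pi_div_four]
  positivity

theorem MixedVanish.obstruction_diff_eq_zero (h : MixedVanish U Γ₁ Γ₂ W₁ W₂)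
    (h₁ : FlatData U Γ₁ W₁) (h₂ : FlatData U Γ₂ W₂) {x₀ : Coord n} (hx₀ : x₀ ∈ U) (v : Coord n)
    (I J K : Covec n) :
    obstruction Γ₁ Γ₂ W₁ W₂ x₀ ((Γ₁ x₀ - Γ₂ x₀) v J) K I = 0 := by
  set S : ℝ → ℝ := fun x => Real.sin (2 * Real.pi * x) with hS_def
  set C : ℝ → ℝ := fun x => Real.cos (2 * Real.pi * x) with hC_def
  have hS : SmoothPeriodic S := smoothPeriodic_sin
  have hC : SmoothPeriodic C := smoothPeriodic_cos
  have hSd : ∀ x, HasDerivAt S (2 * Real.pi * C x) x := fun x => by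
    have := hS.hasDerivAt x
    rwa [show deriv S = fun x => 2 * Real.pi * C x from deriv_sin_two_pi] at this
  have hCd : ∀ x, HasDerivAt C (-(2 * Real.pi) * S x) x := fun x => by
    have := hC.hasDerivAt x
    rwa [show deriv C = fun x => -(2 * Real.pi) * S x from deriv_cos_two_pi] at this
  have hSC : ∀ x, C x ^ 2 = 1 - S x ^ 2 := fun x => Real.cos_sq' _
  -- For test functions 1, g, h the symmetry just found reduces the identity to ∫ (m₂ s'g''h' - m₁
  -- s'g'h'') = 0. The choice s = S, g' = 6πS³, h = 2SC makes s'g''h' a multiple of the derivative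
  -- of (SC)³ and s'g'h'' a negative multiple of C²S⁴. Only m₁ survives the integration.
  have hg : SmoothPeriodic fun x => C x * C x * C x - 3 * C x :=
    ((hC.mul hC).mul hC).sub ((SmoothPeriodic.const 3).mul hC)
  have hh : SmoothPeriodic fun x => 2 * (S x * C x) := (SmoothPeriodic.const 2).mul (hS.mul hC)
  have ds : deriv S = fun x => 2 * Real.pi * C x := funext fun x => (hSd x).deriv
  have dg : deriv (fun x => C x * C x * C x - 3 * C x) = fun x => 6 * Real.pi * S x ^ 3 := by
    funext x
    have := ((((hCd x).mul (hCd x)).mul (hCd x)).sub ((hCd x).const_mul 3)).deriv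
    refine Eq.trans this ?_
    simp only [Pi.mul_apply]
    linear_combination (-6 * Real.pi * S x) * hSC x
  have ddg : deriv (fun x => 6 * Real.pi * S x ^ 3)
      = fun x => 36 * Real.pi ^ 2 * S x ^ 2 * C x := by
    funext x
    refine Eq.trans (((hSd x).pow 3).const_mul (6 * Real.pi)).deriv ?_
    norm_num
    ring
  have dh : deriv (fun x => 2 * (S x * C x)) = fun x => 4 * Real.pi * (C x ^ 2 - S x ^ 2) := by
    funext x
    refine Eq.trans (((hSd x).mul (hCd x)).const_mul 2).deriv ?_
    ring
  have ddh : deriv (fun x => 4 * Real.pi * (C x ^ 2 - S x ^ 2))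
      = fun x => -32 * Real.pi ^ 2 * (S x * C x) := by
    funext x
    refine Eq.trans ((((hCd x).pow 2).sub ((hSd x).pow 2)).const_mul (4 * Real.pi)).deriv ?_
    norm_num
    ring
  have hcube : SmoothPeriodic fun x => S x * C x * (S x * C x) * (S x * C x) :=
    ((hS.mul hC).mul (hS.mul hC)).mul (hS.mul hC)
  have dcube : deriv (fun x => S x * C x * (S x * C x) * (S x * C x))
      = fun x => 6 * Real.pi * (S x ^ 2 * C x ^ 2 * (C x ^ 2 - S x ^ 2)) := by
    funext x
    have hp := (hSd x).mul (hCd x)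
    refine Eq.trans ((hp.mul hp).mul hp).deriv ?_
    simp only [Pi.mul_apply]
    ring
  have h0 := h.integral_lineMixed h₁ h₂ (v := v) hx₀ hS (SmoothPeriodic.const 1) hg hh I J K
  have hsymm := fun p q ξ => h.obstruction_symm hx₀ p q ξ
  have hd : deriv (fun _ : ℝ => (1 : ℝ)) = fun _ => 0 := by funext x; simp
  have hd0 : deriv (fun _ : ℝ => (0 : ℝ)) = fun _ => 0 := by funext x; simp
  simp only [lineMixed_zero hsymm, hd, hd0, dg, ddg, dh, ddh] at h0
  -- Exchanging the differentiated covector with the last argument leaves only the two values m₁ and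
  -- m₂; the terms with s'' then cancel.
  rw [h.obstruction_diff_symm h₁ h₂ hx₀ v I J K, h.obstruction_diff_symm h₁ h₂ hx₀ v K I J] at h0
  set m₁ := obstruction Γ₁ Γ₂ W₁ W₂ x₀ ((Γ₁ x₀ - Γ₂ x₀) v J) K I
  set m₂ := obstruction Γ₁ Γ₂ W₁ W₂ x₀ ((Γ₁ x₀ - Γ₂ x₀) v I) J K
  have hcs : SmoothPeriodic fun x => C x ^ 2 * S x ^ 4 :=
    ⟨(hC.1.pow 2).mul (hS.1.pow 4), fun x => by simp only [hC.2 x, hS.2 x]⟩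
  have h2 : ∫ x in (0 : ℝ)..1, (96 * Real.pi ^ 3 * m₂
        * deriv (fun x => S x * C x * (S x * C x) * (S x * C x)) x
      + 768 * Real.pi ^ 4 * m₁ * (C x ^ 2 * S x ^ 4)) = 0 := by
    rw [← h0]
    congr 1
    funext x
    rw [dcube, ds]
    ring
  rw [intervalIntegral.integral_add, intervalIntegral.integral_const_mul,
    intervalIntegral.integral_const_mul, hcube.integral_deriv_eq_zero, mul_zero, zero_add] at h2
  · have h3 := (mul_eq_zero.1 h2).resolve_right integral_cos_sq_mul_sin_pow_ne_zero
    exact (mul_eq_zero.1 h3).resolve_left (by have := Real.pi_pos; positivity)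
  · exact ((SmoothPeriodic.const _).mul hcube.deriv).continuous.intervalIntegrable _ _
  · exact ((SmoothPeriodic.const _).mul hcs).continuous.intervalIntegrable _ _

theorem MixedVanish.algebraicConditions (h : MixedVanish U Γ₁ Γ₂ W₁ W₂)
    (h₁ : FlatData U Γ₁ W₁) (h₂ : FlatData U Γ₂ W₂) : AlgebraicConditions U Γ₁ Γ₂ W₁ W₂ where
  symm x hx p q ξ := h.obstruction_symm hx p q ξ
  nilpotent x hx v J K := by
    refine eq_zero_of_dot_eq_zero fun w => ?_
    obtain ⟨q, rfl⟩ := h₂.sharp_surjective hx w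
    exact h.obstruction_diff_eq_zero h₁ h₂ hx v K J q

/-- Two flat operators are compatible if and only if the algebraic conditions hold. -/
theorem pencil_isHamiltonian_iff_algebraicConditions {P₁ P₂ : LoopOperator n}
    (h₁ : FlatData U Γ₁ W₁) (h₂ : FlatData U Γ₂ W₂)
    (hP₁ : ∀ u ξ, IsLoop U u → SmoothPeriodic ξ → P₁ u ξ = flatOp Γ₁ W₁ u ξ)
    (hP₂ : ∀ u ξ, IsLoop U u → SmoothPeriodic ξ → P₂ u ξ = flatOp Γ₂ W₂ u ξ) :
    (∀ μ ν : ℝ, IsHamiltonian U (μ • P₁ + ν • P₂)) ↔ AlgebraicConditions U Γ₁ Γ₂ W₁ W₂ := by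
  rw [pencil_isHamiltonian_iff h₁ h₂ hP₁ hP₂]
  refine ⟨fun h => MixedVanish.algebraicConditions h h₁ h₂,
    fun hc u ξ η ζ hu hξ hη hζ => ?_⟩
  simp only [hc.mixedTerm_cyclic_sum h₁ h₂ hu hξ hη hζ, intervalIntegral.integral_zero]

end Necessity

/-! ### Components of Fedosov structures -/

theorem contDiffOn_matrix_det {E ι : Type*} [NormedAddCommGroup E] [NormedSpace ℝ E] [Fintype ι]
    [DecidableEq ι] {U : Set E} {A : E → Matrix ι ι ℝ}
    (hA : ∀ i j, ContDiffOn ℝ ∞ (fun x => A x i j) U) :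
    ContDiffOn ℝ ∞ (fun x => (A x).det) U := by
  simp only [Matrix.det_apply]
  exact ContDiffOn.sum fun σ _ =>
    (contDiffOn_prod fun i _ => hA _ _).const_smul _

/-- Cramer's rule expresses the entries of the inverse through determinants, which are polynomials
in the entries. -/
theorem contDiffOn_matrix_inv {E ι : Type*} [NormedAddCommGroup E] [NormedSpace ℝ E] [Fintype ι]
    [DecidableEq ι] {U : Set E} {A : E → Matrix ι ι ℝ}
    (hA : ∀ i j, ContDiffOn ℝ ∞ (fun x => A x i j) U) (hdet : ∀ x ∈ U, (A x).det ≠ 0) (i j : ι) :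
    ContDiffOn ℝ ∞ (fun x => (A x)⁻¹ i j) U := by
  have h : ∀ x, (A x)⁻¹ i j = (A x).det⁻¹ * ((A x).updateRow j (Pi.single i 1)).det := fun x => by
    rw [Matrix.inv_def, Matrix.smul_apply, Ring.inverse_eq_inv', Matrix.adjugate_apply, smul_eq_mul]
  simp only [h]
  refine ((contDiffOn_matrix_det hA).inv hdet).mul (contDiffOn_matrix_det fun k l => ?_)
  by_cases hk : k = j
  · subst hk
    simp only [Matrix.updateRow_self]
    exact contDiffOn_const
  · simp only [Matrix.updateRow_ne hk]
    exact hA k l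

theorem fderiv_apply_eq_sum_pd {n : ℕ} (f : Coord n → ℝ) (x m : Coord n) :
    fderiv ℝ f x m = ∑ l, m l * pd l f x := by
  have h : m = ∑ l, m l • (EuclideanSpace.single l (1 : ℝ) : Coord n) := by
    ext i
    simp [Finset.sum_apply, Pi.single_apply]
  conv_lhs => rw [h]
  simp [pd]

theorem differentiableAt_of_contDiffOn {n : ℕ} {M : Type*} [TopologicalSpace M]
    {e : OpenPartialHomeomorph M (Coord n)} {f : Coord n → ℝ} {x : Coord n}
    (hf : ContDiffOn ℝ ∞ f e.target) (hx : x ∈ e.target) : DifferentiableAt ℝ f x :=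
  (hf.contDiffAt (e.open_target.mem_nhds hx)).differentiableAt (by simp)

namespace FedosovStructure

variable {n : ℕ} {M : Type*} [TopologicalSpace M] [ChartedSpace (Coord n) M]
  [IsManifold (𝓡 n) ∞ M] {S : FedosovStructure n M} {e : OpenPartialHomeomorph M (Coord n)}
  {x : Coord n}

theorem lower_antisymm (i j : Fin n) : S.lower e x i j = -S.lower e x j i := by
  simp only [lower, formComp, Matrix.of_apply]
  exact S.form_antisymm _ _ _

/-- The differential of the chart is invertible, so the coordinate fields form a basis. A kernel
vector of the matrix would then be a nonzero tangent vector in the radical of the form. -/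
theorem det_lower_ne_zero (he : e ∈ IsManifold.maximalAtlas (𝓡 n) ∞ M) (hx : x ∈ e.target) :
    (S.lower e x).det ≠ 0 := by
  have hp : e.symm x ∈ e.source := e.map_target hx
  have hmd : e.MDifferentiable (𝓡 n) 𝓘(ℝ, Coord n) :=
    ⟨(contMDiffOn_of_mem_maximalAtlas he).mdifferentiableOn (by simp),
      (contMDiffOn_symm_of_mem_maximalAtlas he).mdifferentiableOn (by simp)⟩
  have hφ : ∃ φ : TangentSpace (𝓡 n) (e.symm x) ≃L[ℝ] Coord n,
      ∀ i, coordField e i (e.symm x) = φ.symm (EuclideanSpace.single i (1 : ℝ)) := by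
    refine ⟨hmd.mfderiv hp, fun i => ?_⟩
    have : mfderiv (𝓡 n) 𝓘(ℝ, Coord n) e (e.symm x) = (hmd.mfderiv hp : _ →L[ℝ] _) := rfl
    rw [coordField, this]
    exact congrArg (fun L : Coord n →L[ℝ] TangentSpace (𝓡 n) (e.symm x) =>
      L (EuclideanSpace.single i (1 : ℝ))) (ContinuousLinearMap.inverse_equiv _)
  obtain ⟨φ, hφ⟩ := hφ
  intro hdet
  obtain ⟨c, hc, hc0⟩ := Matrix.exists_mulVec_eq_zero_iff.2 hdet
  have hexp : ∀ y : Coord n, φ.symm y = ∑ i, y i • coordField e i (e.symm x) := by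
    intro y
    have h : y = ∑ l, y l • (EuclideanSpace.single l (1 : ℝ) : Coord n) := by
      ext i
      simp [Finset.sum_apply, Pi.single_apply]
    conv_lhs => rw [h]
    simp only [map_sum, map_smul, hφ]
  have hv : φ.symm (WithLp.toLp 2 c) = 0 := by
    refine S.form_nondegenerate _ _ fun w => ?_
    rw [S.form_antisymm, ← φ.symm_apply_apply w, hexp (φ w), hexp]
    simp only [map_sum, map_smul, sum_apply, smul_apply, smul_eq_mul]
    have hi : ∀ i, ∑ j, c j * S.form (e.symm x) (coordField e i (e.symm x))
        (coordField e j (e.symm x)) = 0 := by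
      intro i
      have := congrFun hc0 i
      simp only [Matrix.mulVec, dotProduct, lower, formComp, Matrix.of_apply, Pi.zero_apply] at this
      rw [← this]
      exact Finset.sum_congr rfl fun j _ => mul_comm _ _
    simp only [Finset.mul_sum]
    rw [Finset.sum_comm, neg_eq_zero]
    refine Finset.sum_eq_zero fun i _ => ?_
    rw [← mul_zero (φ w i), ← hi i, Finset.mul_sum]
    exact Finset.sum_congr rfl fun j _ => mul_left_comm _ _ _
  have : (WithLp.toLp 2 c : Coord n) = 0 := by simpa using hv
  exact hc (by simpa using congrArg WithLp.ofLp this)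

theorem isUnit_det_lower (he : e ∈ IsManifold.maximalAtlas (𝓡 n) ∞ M) (hx : x ∈ e.target) :
    IsUnit (S.lower e x).det :=
  isUnit_iff_ne_zero.2 (det_lower_ne_zero he hx)

theorem lower_mul_upper (he : e ∈ IsManifold.maximalAtlas (𝓡 n) ∞ M) (hx : x ∈ e.target) :
    S.lower e x * S.upper e x = 1 :=
  Matrix.mul_nonsing_inv _ (isUnit_det_lower he hx)

theorem upper_mul_lower (he : e ∈ IsManifold.maximalAtlas (𝓡 n) ∞ M) (hx : x ∈ e.target) :
    S.upper e x * S.lower e x = 1 :=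
  Matrix.nonsing_inv_mul _ (isUnit_det_lower he hx)

theorem upper_antisymm (i j : Fin n) : S.upper e x i j = -S.upper e x j i := by
  have h : (S.lower e x).transpose = -S.lower e x := by
    ext i j
    exact lower_antisymm j i
  have h2 : (S.upper e x).transpose = -S.upper e x := by
    rw [upper, Matrix.transpose_nonsing_inv, h, ← neg_one_smul ℝ (S.lower e x)]
    by_cases hd : IsUnit (S.lower e x).det
    · rw [Matrix.inv_eq_right_inv (B := -(S.lower e x)⁻¹)]
      simp [Matrix.mul_nonsing_inv _ hd]
    -- For a singular matrix the inverse is zero by convention, so antisymmetry needs no restriction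
    -- on x.
    · rw [Matrix.nonsing_inv_apply_not_isUnit _ hd, Matrix.nonsing_inv_apply_not_isUnit, neg_zero]
      rw [Matrix.det_smul]
      intro h3
      exact hd (isUnit_of_mul_isUnit_right h3)
  have := congrFun (congrFun h2 j) i
  simpa using this

theorem contDiffOn_lower (he : e ∈ IsManifold.maximalAtlas (𝓡 n) ∞ M) (i j : Fin n) :
    ContDiffOn ℝ ∞ (fun x => S.lower e x i j) e.target :=
  S.form_smooth e he i j

theorem contDiffOn_upper (he : e ∈ IsManifold.maximalAtlas (𝓡 n) ∞ M) (i j : Fin n) :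
    ContDiffOn ℝ ∞ (fun x => S.upper e x i j) e.target :=
  contDiffOn_matrix_inv (contDiffOn_lower he) (fun _ hx => det_lower_ne_zero he hx) i j

theorem contDiffOn_Γ (he : e ∈ IsManifold.maximalAtlas (𝓡 n) ∞ M) (k i j : Fin n) :
    ContDiffOn ℝ ∞ (fun x => S.Γ e x k i j) e.target :=
  S.conn_smooth e he k i j

theorem contDiffOn_Γup (he : e ∈ IsManifold.maximalAtlas (𝓡 n) ∞ M) (i j k : Fin n) :
    ContDiffOn ℝ ∞ (fun x => S.Γup e x i j k) e.target :=
  (ContDiffOn.sum fun r _ => (contDiffOn_upper he i r).mul (contDiffOn_Γ he j r k)).neg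

theorem Γ_symm (he : e ∈ IsManifold.maximalAtlas (𝓡 n) ∞ M) (hx : x ∈ e.target) (k i j : Fin n) :
    S.Γ e x k i j = S.Γ e x k j i :=
  S.conn_torsionFree e he x hx k i j

theorem pd_Γ_symm (he : e ∈ IsManifold.maximalAtlas (𝓡 n) ∞ M) (hx : x ∈ e.target)
    (s k i j : Fin n) : pd s (fun y => S.Γ e y k i j) x = pd s (fun y => S.Γ e y k j i) x := by
  have h : (fun y => S.Γ e y k i j) =ᶠ[𝓝 x] fun y => S.Γ e y k j i := by
    filter_upwards [e.open_target.mem_nhds hx] with y hy using Γ_symm he hy k i j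
  rw [pd, pd, h.fderiv_eq]

/-- The contravariant form of `∇ω = 0`. -/
theorem pd_upper (he : e ∈ IsManifold.maximalAtlas (𝓡 n) ∞ M) (hx : x ∈ e.target)
    (k i j : Fin n) : pd k (fun y => S.upper e y i j) x
      = -∑ r, S.Γ e x i r k * S.upper e x r j - ∑ r, S.Γ e x j r k * S.upper e x i r := by
  have hsum : ∀ a j, ∑ b, (pd k (fun y => S.lower e y a b) x * S.upper e x b j
      + S.lower e x a b * pd k (fun y => S.upper e y b j) x) = 0 := by
    intro a j
    have h0 : (fun y => ∑ b, S.lower e y a b * S.upper e y b j)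
        =ᶠ[𝓝 x] fun _ => (1 : Matrix (Fin n) (Fin n) ℝ) a j := by
      filter_upwards [e.open_target.mem_nhds hx] with y hy
      rw [← lower_mul_upper he hy, Matrix.mul_apply]
    have h1 : HasFDerivAt (fun y => ∑ b, S.lower e y a b * S.upper e y b j) _ x :=
      HasFDerivAt.fun_sum fun b _ =>
        (differentiableAt_of_contDiffOn (contDiffOn_lower (S := S) he a b) hx).hasFDerivAt.mul
        (differentiableAt_of_contDiffOn (contDiffOn_upper (S := S) he b j) hx).hasFDerivAt
    have h2 := h1.unique ((hasFDerivAt_const _ x).congr_of_eventuallyEq h0)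
    have h3 := congrArg (fun L : Coord n →L[ℝ] ℝ => L (EuclideanSpace.single k 1)) h2
    simp only [sum_apply, add_apply, smul_apply, smul_eq_mul, zero_apply] at h3
    rw [← h3]
    exact Finset.sum_congr rfl fun b _ => by simp only [pd]; ring
  let L : Matrix (Fin n) (Fin n) ℝ := Matrix.of fun a b => pd k (fun y => S.lower e y a b) x
  let V : Matrix (Fin n) (Fin n) ℝ := Matrix.of fun a b => pd k (fun y => S.upper e y a b) x
  let G : Matrix (Fin n) (Fin n) ℝ := Matrix.of fun a b => S.Γ e x a b k
  -- The derivative of ω·ω⁻¹ = 1; inserting ∇ω = 0 and multiplying by ω⁻¹ isolates the derivative of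
  -- ω⁻¹.
  have hLV : L * S.upper e x + S.lower e x * V = 0 := by
    ext a j
    rw [Matrix.add_apply, Matrix.mul_apply, Matrix.mul_apply, ← Finset.sum_add_distrib]
    exact hsum a j
  have hL : L = G.transpose * S.lower e x + S.lower e x * G := by
    ext a b
    rw [Matrix.add_apply, Matrix.mul_apply, Matrix.mul_apply]
    have := S.conn_compat e he x hx k a b
    have e1 : ∑ r, G.transpose a r * S.lower e x r b
        = ∑ r, christoffel S.conn e x r k a * formComp S.form e x r b :=
      Finset.sum_congr rfl fun r _ => congrArg (· * S.lower e x r b) (Γ_symm he hx r a k)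
    have e2 : ∑ r, S.lower e x a r * G r b
        = ∑ r, christoffel S.conn e x r k b * formComp S.form e x a r :=
      Finset.sum_congr rfl fun r _ => (mul_comm _ _).trans
        (congrArg (· * S.lower e x a r) (Γ_symm he hx r b k))
    rw [e1, e2]
    have e3 : L a b = pd k (fun y => formComp S.form e y a b) x := rfl
    rw [e3]
    linarith
  have hV : V = -(S.upper e x * G.transpose) - G * S.upper e x := by
    have h1 : V = S.upper e x * (S.lower e x * V) := by
      rw [← Matrix.mul_assoc, upper_mul_lower he hx, Matrix.one_mul]
    rw [h1, eq_neg_of_add_eq_zero_right hLV, hL, Matrix.add_mul, Matrix.mul_neg, Matrix.mul_add,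
      Matrix.mul_assoc, lower_mul_upper he hx, Matrix.mul_one, Matrix.mul_assoc,
      ← Matrix.mul_assoc (S.upper e x) (S.lower e x), upper_mul_lower he hx, Matrix.one_mul]
    abel
  have := congrFun (congrFun hV i) j
  rw [Matrix.sub_apply, Matrix.neg_apply, Matrix.mul_apply, Matrix.mul_apply] at this
  have e4 : ∑ r, S.upper e x i r * G.transpose r j = ∑ r, S.Γ e x j r k * S.upper e x i r :=
    Finset.sum_congr rfl fun r _ => mul_comm _ _
  rw [e4] at this
  have e5 : ∑ r, G i r * S.upper e x r j = ∑ r, S.Γ e x i r k * S.upper e x r j := rfl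
  rw [e5] at this
  have e6 : V i j = pd k (fun y => S.upper e y i j) x := rfl
  rw [← e6]
  linarith

end FedosovStructure

/-! ### The flat data of a flat Fedosov structure in a chart -/

section Tensors

theorem contDiffOn_sum_smul {E F ι : Type*} [NormedAddCommGroup E] [NormedSpace ℝ E]
    [NormedAddCommGroup F] [NormedSpace ℝ F] [Fintype ι] {U : Set E} {f : E → ι → ℝ} (c : ι → F)
    (hf : ∀ i, ContDiffOn ℝ ∞ (fun y => f y i) U) :
    ContDiffOn ℝ ∞ (fun y => ∑ i, f y i • c i) U :=
  ContDiffOn.sum fun i _ => (hf i).smul contDiffOn_const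

theorem fderiv_sum_smul {E F ι : Type*} [NormedAddCommGroup E] [NormedSpace ℝ E]
    [NormedAddCommGroup F] [NormedSpace ℝ F] [Fintype ι] {x : E} {f : E → ι → ℝ} (c : ι → F)
    (hf : ∀ i, DifferentiableAt ℝ (fun y => f y i) x) (m : E) :
    fderiv ℝ (fun y => ∑ i, f y i • c i) x m = ∑ i, fderiv ℝ (fun y => f y i) x m • c i := by
  have h : HasFDerivAt (fun y => ∑ i, f y i • c i)
      (∑ i, (fderiv ℝ (fun y => f y i) x).smulRight (c i)) x :=
    HasFDerivAt.fun_sum fun i _ => (hf i).hasFDerivAt.smul_const (c i)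
  rw [h.fderiv]
  simp only [sum_apply, ContinuousLinearMap.smulRight_apply]

variable {n : ℕ}

/-- The elementary tensor `v, θ ↦ v_k θ_r e^j`. -/
def connBasis (r j k : Fin n) : Coord n →L[ℝ] Covec n →L[ℝ] Covec n :=
  (EuclideanSpace.proj k : Coord n →L[ℝ] ℝ).smulRight
    ((ContinuousLinearMap.proj r : Covec n →L[ℝ] ℝ).smulRight (Pi.single j 1 : Covec n))

/-- The map `v, θ ↦ (G^r_{jk} v^k θ_r)_j`. -/
def connOf (G : Fin n → Fin n → Fin n → ℝ) : Coord n →L[ℝ] Covec n →L[ℝ] Covec n :=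
  ∑ r, ∑ j, ∑ k, G r j k • connBasis r j k

theorem connOf_apply (G : Fin n → Fin n → Fin n → ℝ) (v : Coord n) (θ : Covec n) (j : Fin n) :
    connOf G v θ j = ∑ r, ∑ k, G r j k * v k * θ r := by
  simp only [connOf, connBasis, sum_apply, smul_apply, ContinuousLinearMap.smulRight_apply,
    Finset.sum_apply, Pi.smul_apply, smul_eq_mul, PiLp.proj_apply,
    ContinuousLinearMap.proj_apply]
  refine Finset.sum_congr rfl fun r _ => ?_
  rw [Finset.sum_eq_single j]
  · exact Finset.sum_congr rfl fun k _ => by rw [Pi.single_eq_same]; ring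
  · intro b _ hb
    simp [hb.symm]
  · simp

theorem connOf_single (G : Fin n → Fin n → Fin n → ℝ) (v : Coord n) (r j : Fin n) :
    connOf G v (Pi.single r 1) j = ∑ k, G r j k * v k := by
  rw [connOf_apply, Finset.sum_eq_single r]
  · simp
  · intro b _ hb
    simp [hb]
  · simp

/-- The elementary tensor `α, β ↦ α_i β_j`. -/
def formBasis (i j : Fin n) : Covec n →L[ℝ] Covec n →L[ℝ] ℝ :=
  (ContinuousLinearMap.proj i : Covec n →L[ℝ] ℝ).smulRight
    (ContinuousLinearMap.proj j : Covec n →L[ℝ] ℝ)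

/-- The bilinear form `A^{ij} α_i β_j` on covectors. -/
def formOf (A : Matrix (Fin n) (Fin n) ℝ) : Covec n →L[ℝ] Covec n →L[ℝ] ℝ :=
  ∑ i, ∑ j, A i j • formBasis i j

theorem formOf_apply (A : Matrix (Fin n) (Fin n) ℝ) (α β : Covec n) :
    formOf A α β = ∑ i, ∑ j, A i j * α i * β j := by
  simp only [formOf, formBasis, sum_apply, smul_apply, ContinuousLinearMap.smulRight_apply,
    smul_eq_mul, ContinuousLinearMap.proj_apply, mul_assoc]

theorem formOf_single (A : Matrix (Fin n) (Fin n) ℝ) (i : Fin n) (β : Covec n) :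
    formOf A (Pi.single i 1) β = ∑ j, A i j * β j := by
  rw [formOf_apply, Finset.sum_eq_single i]
  · simp
  · intro b _ hb
    simp [hb]
  · simp

theorem formOf_eq_dotProduct (A : Matrix (Fin n) (Fin n) ℝ) (α β : Covec n) :
    formOf A α β = α ⬝ᵥ A.mulVec β := by
  simp only [formOf_apply, dotProduct, Matrix.mulVec, Finset.mul_sum]
  exact Finset.sum_congr rfl fun i _ => Finset.sum_congr rfl fun j _ => by ring

variable {U : Set (Coord n)} {G : Coord n → Fin n → Fin n → Fin n → ℝ}
  {A : Coord n → Matrix (Fin n) (Fin n) ℝ} {x : Coord n}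

theorem connOf_eq_sum (G : Fin n → Fin n → Fin n → ℝ) :
    connOf G = ∑ i : Fin n × Fin n × Fin n, G i.1 i.2.1 i.2.2 • connBasis i.1 i.2.1 i.2.2 := by
  simp only [connOf, Fintype.sum_prod_type]

theorem formOf_eq_sum (A : Matrix (Fin n) (Fin n) ℝ) :
    formOf A = ∑ i : Fin n × Fin n, A i.1 i.2 • formBasis i.1 i.2 := by
  simp only [formOf, Fintype.sum_prod_type]

theorem contDiffOn_connOf (hG : ∀ r j k, ContDiffOn ℝ ∞ (fun y => G y r j k) U) :
    ContDiffOn ℝ ∞ (fun y => connOf (G y)) U := by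
  simp only [connOf_eq_sum]
  exact contDiffOn_sum_smul (F := Coord n →L[ℝ] Covec n →L[ℝ] Covec n) _ fun i => hG _ _ _

theorem contDiffOn_formOf (hA : ∀ i j, ContDiffOn ℝ ∞ (fun y => A y i j) U) :
    ContDiffOn ℝ ∞ (fun y => formOf (A y)) U := by
  simp only [formOf_eq_sum]
  exact contDiffOn_sum_smul (F := Covec n →L[ℝ] Covec n →L[ℝ] ℝ) _ fun i => hA _ _

theorem fderiv_connOf (hG : ∀ r j k, DifferentiableAt ℝ (fun y => G y r j k) x) (m : Coord n) :
    fderiv ℝ (fun y => connOf (G y)) x m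
      = connOf fun r j k => ∑ s, m s * pd s (fun y => G y r j k) x := by
  simp only [connOf_eq_sum, ← fderiv_apply_eq_sum_pd]
  exact fderiv_sum_smul (F := Coord n →L[ℝ] Covec n →L[ℝ] Covec n)
    (f := fun y (i : Fin n × Fin n × Fin n) => G y i.1 i.2.1 i.2.2) _ (fun i => hG _ _ _) m

theorem fderiv_formOf (hA : ∀ i j, DifferentiableAt ℝ (fun y => A y i j) x) (m : Coord n) :
    fderiv ℝ (fun y => formOf (A y)) x m
      = formOf (Matrix.of fun i j => ∑ s, m s * pd s (fun y => A y i j) x) := by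
  simp only [formOf_eq_sum, ← fderiv_apply_eq_sum_pd, Matrix.of_apply]
  exact fderiv_sum_smul (F := Covec n →L[ℝ] Covec n →L[ℝ] ℝ)
    (f := fun y (i : Fin n × Fin n) => A y i.1 i.2) _ (fun i => hA _ _) m

end Tensors

namespace FedosovStructure

variable {n : ℕ} {M : Type*} [TopologicalSpace M] [ChartedSpace (Coord n) M]
  [IsManifold (𝓡 n) ∞ M] {S : FedosovStructure n M} {e : OpenPartialHomeomorph M (Coord n)}
  {x : Coord n}

/-- The connection in the chart `e`, acting on covectors. -/
def chartConn (S : FedosovStructure n M) (e : OpenPartialHomeomorph M (Coord n)) (x : Coord n) :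
    Coord n →L[ℝ] Covec n →L[ℝ] Covec n :=
  connOf (S.Γ e x)

/-- The Poisson bivector in the chart `e`. -/
def chartForm (S : FedosovStructure n M) (e : OpenPartialHomeomorph M (Coord n)) (x : Coord n) :
    Covec n →L[ℝ] Covec n →L[ℝ] ℝ :=
  formOf (S.upper e x)

theorem chartForm_antisymm (α β : Covec n) :
    S.chartForm e x α β = -S.chartForm e x β α := by
  simp only [chartForm, formOf_apply]
  rw [Finset.sum_comm, ← Finset.sum_neg_distrib]
  refine Finset.sum_congr rfl fun j _ => ?_
  rw [← Finset.sum_neg_distrib]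
  refine Finset.sum_congr rfl fun i _ => ?_
  rw [upper_antisymm]
  ring

theorem eq_zero_of_chartForm_eq_zero (he : e ∈ IsManifold.maximalAtlas (𝓡 n) ∞ M)
    (hx : x ∈ e.target) {β : Covec n} (h : ∀ α, S.chartForm e x α β = 0) : β = 0 := by
  have h1 : (S.upper e x).mulVec β = 0 := by
    funext i
    have := h (Pi.single i 1)
    rw [chartForm, formOf_single] at this
    exact this
  have h2 := congrArg (S.lower e x).mulVec h1
  rwa [Matrix.mulVec_mulVec, lower_mul_upper he hx, Matrix.one_mulVec, Matrix.mulVec_zero] at h2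

theorem chartConn_torsionFree (he : e ∈ IsManifold.maximalAtlas (𝓡 n) ∞ M) (hx : x ∈ e.target)
    (ξ : Covec n) (v w : Coord n) :
    dot (S.chartConn e x v ξ) w = dot (S.chartConn e x w ξ) v := by
  have key : ∀ v w, dot (S.chartConn e x v ξ) w
      = ∑ r, ∑ j, ∑ k, S.Γ e x r j k * v k * ξ r * w j := by
    intro v w
    simp only [dot, chartConn, connOf_apply, Finset.sum_mul]
    rw [Finset.sum_comm]
  rw [key, key]
  refine Finset.sum_congr rfl fun r _ => ?_
  rw [Finset.sum_comm]
  refine Finset.sum_congr rfl fun j _ => Finset.sum_congr rfl fun k _ => ?_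
  rw [Γ_symm he hx]
  ring

theorem fderiv_chartConn (he : e ∈ IsManifold.maximalAtlas (𝓡 n) ∞ M) (hx : x ∈ e.target)
    (m : Coord n) : fderiv ℝ (S.chartConn e) x m
      = connOf fun r j k => ∑ s, m s * pd s (fun y => S.Γ e y r j k) x :=
  fderiv_connOf (fun r j k => differentiableAt_of_contDiffOn (contDiffOn_Γ he r j k) hx) m

theorem fderiv_chartForm (he : e ∈ IsManifold.maximalAtlas (𝓡 n) ∞ M) (hx : x ∈ e.target)
    (m : Coord n) : fderiv ℝ (S.chartForm e) x m
      = formOf (Matrix.of fun i j => ∑ s, m s * pd s (fun y => S.upper e y i j) x) :=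
  fderiv_formOf (fun i j => differentiableAt_of_contDiffOn (contDiffOn_upper he i j) hx) m

/-- The matrix of the endomorphism `Γ x m` of the space of covectors. -/
theorem chartConn_eq_mulVec (m : Coord n) (α : Covec n) : S.chartConn e x m α
    = (Matrix.of fun i r => ∑ k, m k * S.Γ e x r i k).mulVec α := by
  funext i
  simp only [chartConn, connOf_apply, Matrix.mulVec, dotProduct, Matrix.of_apply, Finset.sum_mul]
  exact Finset.sum_congr rfl fun r _ => Finset.sum_congr rfl fun k _ => by ring

theorem chartForm_parallel (he : e ∈ IsManifold.maximalAtlas (𝓡 n) ∞ M) (hx : x ∈ e.target)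
    (m : Coord n) (α β : Covec n) : fderiv ℝ (S.chartForm e) x m α β
      = -S.chartForm e x (S.chartConn e x m α) β - S.chartForm e x α (S.chartConn e x m β) := by
  let C : Matrix (Fin n) (Fin n) ℝ := Matrix.of fun i r => ∑ k, m k * S.Γ e x r i k
  have hC : ∀ α, S.chartConn e x m α = C.mulVec α := chartConn_eq_mulVec m
  have hV : (Matrix.of fun i j => ∑ s, m s * pd s (fun y => S.upper e y i j) x)
      = -(C.transpose * S.upper e x) - S.upper e x * C := by
    ext i j
    simp only [Matrix.of_apply, pd_upper he hx, Matrix.sub_apply, Matrix.neg_apply,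
      Matrix.mul_apply, Matrix.transpose_apply, C, Finset.sum_mul, Finset.mul_sum, mul_sub,
      mul_neg, Finset.sum_sub_distrib, Finset.sum_neg_distrib]
    rw [Finset.sum_comm, Finset.sum_comm (γ := Fin n) (s := Finset.univ) (t := Finset.univ)
      (f := fun s r => m s * (S.Γ e x j r s * S.upper e x i r))]
    congr 1
    · congr 1
      exact Finset.sum_congr rfl fun r _ => Finset.sum_congr rfl fun k _ => by ring
    · exact Finset.sum_congr rfl fun r _ => Finset.sum_congr rfl fun k _ => by ring
  rw [fderiv_chartForm he hx, hV, hC, hC, chartForm, formOf_eq_dotProduct, formOf_eq_dotProduct,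
    formOf_eq_dotProduct, Matrix.sub_mulVec, Matrix.neg_mulVec, dotProduct_sub, dotProduct_neg,
    ← Matrix.mulVec_mulVec, ← Matrix.mulVec_mulVec, Matrix.dotProduct_mulVec α C.transpose,
    Matrix.vecMul_transpose]

/-- In components this is the vanishing of the curvature of the dual connection, which becomes R = 0
after lower indices are exchanged by torsion-freeness. -/
theorem chartConn_flat (he : e ∈ IsManifold.maximalAtlas (𝓡 n) ∞ M) (hS : S.IsFlat)
    (hx : x ∈ e.target) (m v : Coord n) (θ : Covec n) :
    fderiv ℝ (S.chartConn e) x m v θ - S.chartConn e x m (S.chartConn e x v θ)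
      = fderiv ℝ (S.chartConn e) x v m θ - S.chartConn e x v (S.chartConn e x m θ) := by
  have key : ∀ m v j, (fderiv ℝ (S.chartConn e) x m v θ
      - S.chartConn e x m (S.chartConn e x v θ)) j
      = ∑ r, ∑ k, ∑ s, (pd s (fun y => S.Γ e y r j k) x - ∑ t, S.Γ e x t j s * S.Γ e x r t k)
        * m s * v k * θ r := by
    intro m v j
    have e1 : S.chartConn e x m (S.chartConn e x v θ) j
        = ∑ r, ∑ k, ∑ s, (∑ t, S.Γ e x t j s * S.Γ e x r t k) * m s * v k * θ r := by
      simp only [chartConn, connOf_apply, Finset.mul_sum, Finset.sum_mul]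
      rw [Finset.sum_congr rfl fun t _ => Finset.sum_comm]
      rw [Finset.sum_comm]
      refine Finset.sum_congr rfl fun r _ => ?_
      rw [Finset.sum_congr rfl fun t _ => Finset.sum_comm]
      rw [Finset.sum_comm]
      refine Finset.sum_congr rfl fun k _ => ?_
      rw [Finset.sum_comm]
      exact Finset.sum_congr rfl fun s _ => Finset.sum_congr rfl fun t _ => by ring
    rw [Pi.sub_apply, e1, fderiv_chartConn he hx, connOf_apply, ← Finset.sum_sub_distrib]
    refine Finset.sum_congr rfl fun r _ => ?_
    rw [← Finset.sum_sub_distrib]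
    refine Finset.sum_congr rfl fun k _ => ?_
    rw [Finset.sum_mul, Finset.sum_mul, ← Finset.sum_sub_distrib]
    exact Finset.sum_congr rfl fun s _ => by ring
  funext j
  rw [key, key]
  refine Finset.sum_congr rfl fun r _ => ?_
  rw [Finset.sum_comm]
  refine Finset.sum_congr rfl fun s _ => Finset.sum_congr rfl fun k _ => ?_
  have hf := hS e he x hx r s k j
  have e1 : ∑ t, S.Γ e x r s t * S.Γ e x t k j = ∑ t, S.Γ e x t j k * S.Γ e x r t s :=
    Finset.sum_congr rfl fun t _ => by rw [Γ_symm he hx r s t, Γ_symm he hx t k j, mul_comm]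
  have e2 : ∑ t, S.Γ e x r k t * S.Γ e x t s j = ∑ t, S.Γ e x t j s * S.Γ e x r t k :=
    Finset.sum_congr rfl fun t _ => by rw [Γ_symm he hx r k t, Γ_symm he hx t s j, mul_comm]
  rw [e1, e2, pd_Γ_symm he hx s r k j, pd_Γ_symm he hx k r s j] at hf
  have : pd s (fun y => S.Γ e y r j k) x - ∑ t, S.Γ e x t j s * S.Γ e x r t k
      = pd k (fun y => S.Γ e y r j s) x - ∑ t, S.Γ e x t j k * S.Γ e x r t s := by linarith
  rw [this]
  ring

theorem flatData (he : e ∈ IsManifold.maximalAtlas (𝓡 n) ∞ M) (hS : S.IsFlat) :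
    FlatData e.target (S.chartConn e) (S.chartForm e) where
  isOpen := e.open_target
  smooth_conn := contDiffOn_connOf (contDiffOn_Γ he)
  smooth_form := contDiffOn_formOf (contDiffOn_upper he)
  antisymm _ _ := chartForm_antisymm
  nondegenerate x hx α h := eq_zero_of_chartForm_eq_zero he hx fun β => by
    rw [chartForm_antisymm, h, neg_zero]
  torsionFree _ hx := chartConn_torsionFree he hx
  compat _ hx := chartForm_parallel he hx
  flat _ hx := chartConn_flat he hS hx

end FedosovStructure

/-! ### The operator of a flat Fedosov structure -/

theorem deriv_coord {n : ℕ} {u : ℝ → Coord n} (hu : SmoothPeriodic u) (k : Fin n) :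
    deriv (fun y => u y k) = fun x => deriv u x k :=
  funext fun x => ((EuclideanSpace.proj k : Coord n →L[ℝ] ℝ).hasFDerivAt.comp_hasDerivAt x
    (hu.hasDerivAt x)).deriv

theorem deriv_covec {n : ℕ} {ξ : ℝ → Covec n} (hξ : SmoothPeriodic ξ) (k : Fin n) :
    deriv (fun y => ξ y k) = fun x => deriv ξ x k :=
  funext fun x => (hasDerivAt_pi.1 (hξ.hasDerivAt x) k).deriv

namespace FedosovStructure

variable {n : ℕ} {M : Type*} [TopologicalSpace M] [ChartedSpace (Coord n) M]
  [IsManifold (𝓡 n) ∞ M] {S : FedosovStructure n M} {e : OpenPartialHomeomorph M (Coord n)}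
  {x : Coord n}

theorem sum_Γup_mul (x v : Coord n) (i j : Fin n) : ∑ k, S.Γup e x i j k * v k
    = -S.chartForm e x (Pi.single i 1) (S.chartConn e x v (Pi.single j 1)) := by
  simp only [Γup, chartForm, formOf_single, chartConn, connOf_single, neg_mul,
    Finset.sum_neg_distrib, Finset.sum_mul, Finset.mul_sum, mul_assoc]
  rw [Finset.sum_comm]

/-- Each contravariant symbol is W applied to Γ(v)e^i or Γ(v)e^j; of the two factors W, one is
cancelled by its inverse ω. -/
theorem sum_lower_Γup_mul (he : e ∈ IsManifold.maximalAtlas (𝓡 n) ∞ M) (hx : x ∈ e.target)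
    (v : Coord n) (i j : Fin n) :
    ∑ p, ∑ r, S.lower e x p r * (∑ k, S.Γup e x r i k * v k) * (∑ k, S.Γup e x p j k * v k)
      = S.chartForm e x (S.chartConn e x v (Pi.single i 1))
        (S.chartConn e x v (Pi.single j 1)) := by
  have hm : ∀ β i, S.chartForm e x (Pi.single i 1) β = (S.upper e x).mulVec β i := fun β i => by
    rw [chartForm, formOf_single, Matrix.mulVec, dotProduct]
  simp only [sum_Γup_mul, hm]
  generalize S.chartConn e x v (Pi.single i 1) = α
  generalize S.chartConn e x v (Pi.single j 1) = β
  have h : α = (S.lower e x).mulVec ((S.upper e x).mulVec α) := by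
    rw [Matrix.mulVec_mulVec, lower_mul_upper he hx, Matrix.one_mulVec]
  rw [chartForm, formOf_eq_dotProduct]
  conv_rhs => rw [h]
  generalize (S.upper e x).mulVec α = a
  simp only [Matrix.mulVec, dotProduct]
  refine Finset.sum_congr rfl fun p _ => ?_
  rw [Finset.sum_mul]
  exact Finset.sum_congr rfl fun r _ => by ring

theorem sum_sum_symm_part (a : Fin n → Fin n → ℝ) (v : Coord n) :
    ∑ k, ∑ l, (a k l + a l k) / 2 * v k * v l = ∑ k, ∑ l, a k l * v k * v l := by
  have h1 : ∑ k, ∑ l, (a k l + a l k) / 2 * v k * v l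
      = (∑ k, ∑ l, a k l * v k * v l + ∑ k, ∑ l, a l k * v l * v k) / 2 := by
    rw [← Finset.sum_add_distrib, Finset.sum_div]
    refine Finset.sum_congr rfl fun k _ => ?_
    rw [← Finset.sum_add_distrib, Finset.sum_div]
    exact Finset.sum_congr rfl fun l _ => by ring
  rw [h1, Finset.sum_comm (f := fun k l => a l k * v l * v k)]
  ring

/-- Differentiate Γ^{ij}_k v^k = -W(e^i, Γ(v)e^j) along x + t v with v frozen. The first two terms
come from the derivative of the parallel W, the last from that of Γ. -/
theorem sum_pd_Γup_mul (he : e ∈ IsManifold.maximalAtlas (𝓡 n) ∞ M) (hS : S.IsFlat)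
    (hx : x ∈ e.target) (v : Coord n) (i j : Fin n) :
    ∑ k, ∑ l, pd l (fun y => S.Γup e y i j k) x * v k * v l
      = S.chartForm e x (S.chartConn e x v (Pi.single i 1)) (S.chartConn e x v (Pi.single j 1))
        + S.chartForm e x (Pi.single i 1) (S.chartConn e x v (S.chartConn e x v (Pi.single j 1)))
        - S.chartForm e x (Pi.single i 1) (fderiv ℝ (S.chartConn e) x v v (Pi.single j 1)) := by
  have h := flatData he hS
  have hl := hasDerivAt_line x v
  have hd : HasDerivAt (fun t : ℝ => ∑ k, S.Γup e (x + t • v) i j k * v k)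
      (∑ k, (fderiv ℝ (fun y => S.Γup e y i j k) x v) * v k) 0 := by
    refine HasDerivAt.fun_sum fun k _ => HasDerivAt.mul_const ?_ _
    refine hasDerivAt_comp_curve (f := fun y => S.Γup e y i j k) ?_ hl
    simpa using (differentiableAt_of_contDiffOn (contDiffOn_Γup (S := S) he i j k) hx).hasFDerivAt
  simp only [sum_Γup_mul] at hd
  have hd2 := ((h.hasDerivAt_form_line hx v).clm_apply
    (hasDerivAt_const (0 : ℝ) (Pi.single i 1 : Covec n))).clm_apply
    (((h.hasDerivAt_conn_line hx v).clm_apply (hasDerivAt_const (0 : ℝ) v)).clm_apply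
      (hasDerivAt_const (0 : ℝ) (Pi.single j 1 : Covec n)))
  have hu := hd.unique hd2.neg
  simp only [zero_smul, add_zero, map_zero, h.compat x hx] at hu
  have e1 : ∑ k, ∑ l, pd l (fun y => S.Γup e y i j k) x * v k * v l
      = ∑ k, (fderiv ℝ (fun y => S.Γup e y i j k) x v) * v k := by
    refine Finset.sum_congr rfl fun k _ => ?_
    rw [fderiv_apply_eq_sum_pd, Finset.sum_mul]
    exact Finset.sum_congr rfl fun l _ => by ring
  rw [e1, hu]
  ring

/-- Symmetrization is invisible on v ⊗ v, and the term ω Γ Γ in c cancels W(Γ(v)e^i, Γ(v)e^j). What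
is left is the zeroth-order part of ♯∇_x∇_x quadratic in u_x. -/
theorem sum_c_mul (he : e ∈ IsManifold.maximalAtlas (𝓡 n) ∞ M) (hS : S.IsFlat)
    (hx : x ∈ e.target) (v : Coord n) (i j : Fin n) :
    ∑ k, ∑ l, S.c e x i j k l * v k * v l = S.chartForm e x (Pi.single i 1)
      (S.chartConn e x v (S.chartConn e x v (Pi.single j 1))
        - fderiv ℝ (S.chartConn e) x v v (Pi.single j 1)) := by
  let a : Fin n → Fin n → ℝ := fun k l => pd l (fun y => S.Γup e y i j k) x
    - ∑ p, ∑ r, S.lower e x p r * (S.Γup e x r i k * S.Γup e x p j l)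
  have hc : ∀ k l, S.c e x i j k l = (a k l + a l k) / 2 := by
    intro k l
    have : ∑ p, ∑ r, S.lower e x p r *
          ((S.Γup e x r i k * S.Γup e x p j l + S.Γup e x r i l * S.Γup e x p j k) / 2)
        = (∑ p, ∑ r, S.lower e x p r * (S.Γup e x r i k * S.Γup e x p j l)
          + ∑ p, ∑ r, S.lower e x p r * (S.Γup e x r i l * S.Γup e x p j k)) / 2 := by
      rw [← Finset.sum_add_distrib, Finset.sum_div]
      refine Finset.sum_congr rfl fun k _ => ?_
      rw [← Finset.sum_add_distrib, Finset.sum_div]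
      exact Finset.sum_congr rfl fun l _ => by ring
    rw [c, this]
    simp only [a]
    ring
  have hq : ∑ k, ∑ l, (∑ p, ∑ r, S.lower e x p r * (S.Γup e x r i k * S.Γup e x p j l)) * v k * v l
      = ∑ p, ∑ r, S.lower e x p r * (∑ k, S.Γup e x r i k * v k)
        * (∑ k, S.Γup e x p j k * v k) := by
    simp only [Finset.sum_mul, Finset.mul_sum]
    rw [Finset.sum_congr rfl fun k _ => Finset.sum_comm, Finset.sum_comm]
    refine Finset.sum_congr rfl fun p _ => ?_
    rw [Finset.sum_congr rfl fun k _ => Finset.sum_comm, Finset.sum_comm]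
    refine Finset.sum_congr rfl fun r _ => ?_
    rw [Finset.sum_comm]
    exact Finset.sum_congr rfl fun k _ => Finset.sum_congr rfl fun l _ => by ring
  simp only [hc]
  rw [sum_sum_symm_part]
  simp only [a, sub_mul, Finset.sum_sub_distrib]
  rw [hq, sum_lower_Γup_mul he hx, sum_pd_Γup_mul he hS hx, map_sub]
  ring

theorem operator_eq_flatOp (he : e ∈ IsManifold.maximalAtlas (𝓡 n) ∞ M) (hS : S.IsFlat)
    {u : ℝ → Coord n} {ξ : ℝ → Covec n} (hu : IsLoop e.target u) (hξ : SmoothPeriodic ξ) :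
    S.operator e u ξ = flatOp (S.chartConn e) (S.chartForm e) u ξ := by
  have h := flatData he hS
  funext x i
  have hup := hu.smoothPeriodic
  simp only [operator, flatOp, iteratedDeriv_succ, iteratedDeriv_zero, deriv_coord hup,
    deriv_covec hξ, deriv_coord hup.deriv, deriv_covec hξ.deriv, sum_Γup_mul,
    sum_c_mul he hS (hu.2.2 x)]
  have hrhs : covD (S.chartConn e) u (covD (S.chartConn e) u ξ) x = deriv (deriv ξ) x
      - (2 : ℝ) • S.chartConn e (u x) (deriv u x) (deriv ξ x)
      + (S.chartConn e (u x) (deriv u x) (S.chartConn e (u x) (deriv u x) (ξ x))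
        - fderiv ℝ (S.chartConn e) (u x) (deriv u x) (deriv u x) (ξ x))
      - S.chartConn e (u x) (deriv (deriv u) x) (ξ x) := by
    rw [covD, h.deriv_covD hu hξ, covD, map_sub, two_smul]
    abel
  rw [hrhs]
  have expand : ∀ (L : Covec n →L[ℝ] ℝ) (β : Covec n), L β = ∑ j, β j * L (Pi.single j 1) :=
    fun L β => by simpa using clm_covec L β
  let B := S.chartForm e (u x) (Pi.single i 1)
  let G := S.chartConn e (u x) (deriv u x)
  let G' := S.chartConn e (u x) (deriv (deriv u) x)
  let D := fderiv ℝ (S.chartConn e) (u x) (deriv u x) (deriv u x)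
  have e1 : B (deriv (deriv ξ) x) = ∑ j, S.upper e (u x) i j * deriv (deriv ξ) x j :=
    formOf_single _ _ _
  have e2 : B (G (deriv ξ x)) = ∑ j, deriv ξ x j * B (G (Pi.single j 1)) := expand (B.comp G) _
  have e3 : B (G (G (ξ x)) - D (ξ x)) = ∑ j, ξ x j * B (G (G (Pi.single j 1)) - D (Pi.single j 1)) :=
    expand (B.comp (G.comp G - D)) _
  have e4 : B (G' (ξ x)) = ∑ j, ξ x j * B (G' (Pi.single j 1)) := expand (B.comp G') _
  change _ = B (deriv (deriv ξ) x - (2 : ℝ) • G (deriv ξ x) + (G (G (ξ x)) - D (ξ x)) - G' (ξ x))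
  rw [map_sub, map_add, map_sub B (deriv (deriv ξ) x), map_smul, e1, e2, e3, e4, smul_eq_mul,
    Finset.mul_sum, ← Finset.sum_sub_distrib, ← Finset.sum_add_distrib, ← Finset.sum_sub_distrib]
  refine Finset.sum_congr rfl fun j _ => ?_
  simp only [B, G, G', D]
  ring

end FedosovStructure

open FedosovStructure

/-! ### The multiplication of covectors -/

section Multiplication

variable {n : ℕ} {M : Type*} [TopologicalSpace M] [ChartedSpace (Coord n) M]
  [IsManifold (𝓡 n) ∞ M] {S₁ S₂ : FedosovStructure n M} {e : OpenPartialHomeomorph M (Coord n)}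
  {x : Coord n}

theorem pairing_eq_chartForm (S : FedosovStructure n M) (x : Coord n) (α β : Covec n) :
    pairing S e x α β = S.chartForm e x α β := by
  rw [pairing, chartForm, formOf_apply]
  exact Finset.sum_congr rfl fun r _ => Finset.sum_congr rfl fun s _ => by ring

/-- The minus sign appears because ♯ fills the second slot of W. -/
theorem sharp_chartForm_single (S : FedosovStructure n M) (x : Coord n) (j r : Fin n) :
    sharp (S.chartForm e x) (Pi.single j 1) r = -S.upper e x j r := by
  rw [sharp_apply, chartForm, formOf_single, ← upper_antisymm]
  simp [Pi.single_apply]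

/-- Both terms of Δ pair a connection with one ♯₁ and one ♯₂ vector, in opposite order.
Torsion-freeness of Γ₁ aligns them, and Γ₁ - Γ₂ appears. -/
theorem Δup_eq_obstruction (he : e ∈ IsManifold.maximalAtlas (𝓡 n) ∞ M) (hx : x ∈ e.target)
    (s j k : Fin n) : Δup S₁ S₂ e x s j k
      = -obstruction (S₁.chartConn e) (S₂.chartConn e) (S₁.chartForm e) (S₂.chartForm e) x
        (Pi.single s 1) (Pi.single j 1) (Pi.single k 1) := by
  have key : ∀ (S T : FedosovStructure n M) (s j : Fin n),
      ∑ r, T.upper e x j r * S.Γup e x s k r = -dot (S.chartConn e x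
        (sharp (T.chartForm e x) (Pi.single j 1)) (Pi.single k 1))
        (sharp (S.chartForm e x) (Pi.single s 1)) := by
    intro S T s j
    have h := S.sum_Γup_mul (e := e) x (sharp (T.chartForm e x) (Pi.single j 1)) s k
    rw [chartForm_antisymm, ← dot_sharp, neg_neg] at h
    rw [← h, ← Finset.sum_neg_distrib]
    refine Finset.sum_congr rfl fun r _ => ?_
    rw [sharp_chartForm_single]
    ring
  rw [Δup, Finset.sum_sub_distrib, key S₁ S₂ s j, key S₂ S₁ j s, obstruction, sub_apply,
    sub_apply, dot_sub_left, chartConn_torsionFree he hx]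
  ring

theorem circ_eq_sum (J K : Covec n) : circ S₁ S₂ e x J K
    = ∑ j, ∑ k, (J j * K k) • (fun i => Δ S₁ S₂ e x j k i : Covec n) := by
  funext i
  simp only [circ, Finset.sum_apply, Pi.smul_apply, smul_eq_mul]

theorem circ_single (j k i : Fin n) :
    circ S₁ S₂ e x (Pi.single j 1) (Pi.single k 1) i = Δ S₁ S₂ e x j k i := by
  rw [circ, Finset.sum_eq_single j, Finset.sum_eq_single k]
  · simp
  · intro b _ hb
    simp [hb]
  · simp
  · intro b _ hb
    simp [hb]
  · simp

theorem chartForm_Δ (he : e ∈ IsManifold.maximalAtlas (𝓡 n) ∞ M) (hx : x ∈ e.target)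
    (s j k : Fin n) :
    S₂.chartForm e x (Pi.single s 1) (fun i => Δ S₁ S₂ e x j k i) = Δup S₁ S₂ e x s j k := by
  have h : (fun i => Δ S₁ S₂ e x j k i) = (S₂.lower e x).mulVec fun s => Δup S₁ S₂ e x s j k := rfl
  have h2 : ∀ β, S₂.chartForm e x (Pi.single s 1) β = (S₂.upper e x).mulVec β s := fun β => by
    rw [chartForm, formOf_single, Matrix.mulVec, dotProduct]
  rw [h2, h, Matrix.mulVec_mulVec, upper_mul_lower he hx, Matrix.one_mulVec]

/-- The lowering by ω₂ in Δ^{jk}_i is undone by W₂, and the identity on basis covectors extends by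
trilinearity. The first identity of the theorem is thereby the symmetry of the obstruction. -/
theorem chartForm_circ (he : e ∈ IsManifold.maximalAtlas (𝓡 n) ∞ M) (hx : x ∈ e.target)
    (I J K : Covec n) : S₂.chartForm e x I (circ S₁ S₂ e x J K)
      = -obstruction (S₁.chartConn e) (S₂.chartConn e) (S₁.chartForm e) (S₂.chartForm e) x
        I J K := by
  let B := S₂.chartForm e x
  let A := S₁.chartConn e x - S₂.chartConn e x
  have hobs : ∀ I J K, obstruction (S₁.chartConn e) (S₂.chartConn e) (S₁.chartForm e)
      (S₂.chartForm e) x I J K = B (A (sharp (S₁.chartForm e x) I) K) J := fun I J K =>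
    obstruction_eq_form _ _ _ _
  have e1 : B I (circ S₁ S₂ e x J K)
      = ∑ s, I s * B (Pi.single s 1) (circ S₁ S₂ e x J K) := by
    simpa using clm_covec (B.flip (circ S₁ S₂ e x J K)) I
  have e2 : ∀ s, B (Pi.single s 1) (circ S₁ S₂ e x J K)
      = ∑ j, ∑ k, J j * K k * -B (A (sharp (S₁.chartForm e x) (Pi.single s 1)) (Pi.single k 1))
        (Pi.single j 1) := by
    intro s
    rw [circ_eq_sum]
    simp only [map_sum, map_smul, smul_eq_mul, B, chartForm_Δ he hx, Δup_eq_obstruction he hx, hobs]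
  have e3 : B (A (sharp (S₁.chartForm e x) I) K) J = ∑ s, I s * ∑ k, K k * ∑ j, J j *
      B (A (sharp (S₁.chartForm e x) (Pi.single s 1)) (Pi.single k 1)) (Pi.single j 1) := by
    have f1 := clm_covec (((B.flip J).comp (A.flip K)).comp (sharp (S₁.chartForm e x))) I
    have f2 := fun s => clm_covec ((B.flip J).comp (A (sharp (S₁.chartForm e x) (Pi.single s 1)))) K
    have f3 := fun s k => clm_covec (B (A (sharp (S₁.chartForm e x) (Pi.single s 1))
      (Pi.single k 1))) J
    simp only [ContinuousLinearMap.comp_apply, ContinuousLinearMap.flip_apply, smul_eq_mul]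
      at f1 f2 f3
    rw [f1]
    simp only [f2, f3]
  rw [hobs, e3]
  change B I _ = _
  rw [e1, ← Finset.sum_neg_distrib]
  refine Finset.sum_congr rfl fun s _ => ?_
  rw [e2, ← mul_neg, ← Finset.sum_neg_distrib, Finset.sum_comm]
  refine congrArg _ (Finset.sum_congr rfl fun k _ => ?_)
  rw [Finset.mul_sum, ← Finset.sum_neg_distrib]
  exact Finset.sum_congr rfl fun j _ => by ring

/-- If the obstruction is symmetric, then `J ∘ K = (Γ₁ - Γ₂)(♯₁ J) K`. -/
theorem circ_eq (he : e ∈ IsManifold.maximalAtlas (𝓡 n) ∞ M) (hx : x ∈ e.target)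
    (hs : ∀ I J K, obstruction (S₁.chartConn e) (S₂.chartConn e) (S₁.chartForm e)
      (S₂.chartForm e) x I J K = obstruction (S₁.chartConn e) (S₂.chartConn e) (S₁.chartForm e)
      (S₂.chartForm e) x J I K) (J K : Covec n) :
    circ S₁ S₂ e x J K
      = (S₁.chartConn e x - S₂.chartConn e x) (sharp (S₁.chartForm e x) J) K := by
  rw [← sub_eq_zero]
  refine eq_zero_of_chartForm_eq_zero (S := S₂) he hx fun I => ?_
  rw [map_sub, chartForm_circ he hx, hs, obstruction_eq_form, chartForm_antisymm]
  ring

/-- Once the obstruction is symmetric, J ∘ K = (Γ₁ - Γ₂)(♯₁J)K. The two nilpotency conditions then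
agree, because every vector v is ♯₁I for some I. -/
theorem algebraicConditions_iff (he : e ∈ IsManifold.maximalAtlas (𝓡 n) ∞ M) (h₁ : S₁.IsFlat) :
    AlgebraicConditions e.target (S₁.chartConn e) (S₂.chartConn e) (S₁.chartForm e)
        (S₂.chartForm e)
      ↔ ∀ x ∈ e.target, ∀ I J K : Covec n,
        pairing S₂ e x I (circ S₁ S₂ e x J K) = pairing S₂ e x J (circ S₁ S₂ e x I K) ∧
        circ S₁ S₂ e x (circ S₁ S₂ e x I J) K = 0 := by
  have hp : ∀ x ∈ e.target, ∀ I J K : Covec n,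
      pairing S₂ e x I (circ S₁ S₂ e x J K) = -obstruction (S₁.chartConn e) (S₂.chartConn e)
        (S₁.chartForm e) (S₂.chartForm e) x I J K := fun x hx I J K => by
    rw [pairing_eq_chartForm, chartForm_circ he hx]
  constructor
  · intro hc x hx I J K
    refine ⟨by rw [hp x hx, hp x hx, hc.symm x hx], ?_⟩
    rw [circ_eq he hx (hc.symm x hx), circ_eq he hx (hc.symm x hx), hc.nilpotent x hx]
  · intro h
    have hs : ∀ x ∈ e.target, ∀ I J K, obstruction (S₁.chartConn e) (S₂.chartConn e)
        (S₁.chartForm e) (S₂.chartForm e) x I J K = obstruction (S₁.chartConn e) (S₂.chartConn e)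
        (S₁.chartForm e) (S₂.chartForm e) x J I K := fun x hx I J K => by
      have := (h x hx I J K).1
      rw [hp x hx, hp x hx] at this
      exact neg_injective this
    refine ⟨hs, fun x hx v J K => ?_⟩
    obtain ⟨I, rfl⟩ := (flatData he h₁).sharp_surjective hx v
    rw [← circ_eq he hx (hs x hx), ← circ_eq he hx (hs x hx)]
    exact (h x hx I J K).2

/-! ### The covariant derivative of Δ -/

theorem contDiffOn_Δ (he : e ∈ IsManifold.maximalAtlas (𝓡 n) ∞ M) (j k i : Fin n) :
    ContDiffOn ℝ ∞ (fun y => Δ S₁ S₂ e y j k i) e.target :=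
  ContDiffOn.sum fun s _ => (contDiffOn_lower he i s).mul <| ContDiffOn.sum fun r _ =>
    ((contDiffOn_upper he j r).mul (contDiffOn_Γup he s k r)).sub
      ((contDiffOn_upper he s r).mul (contDiffOn_Γup he j k r))

theorem chartConn_basis_single (S : FedosovStructure n M)
    (he : e ∈ IsManifold.maximalAtlas (𝓡 n) ∞ M) (hx : x ∈ e.target) (l i r : Fin n) :
    S.chartConn e x (EuclideanSpace.single l 1) (Pi.single i 1) r = S.Γ e x i l r := by
  rw [chartConn, connOf_single, Γ_symm he hx]
  simp

/-- The algebraic conditions hold on the whole chart, so Δ^{ij}_k = ((Γ₁ - Γ₂)(♯₁e^i)e^j)_k may be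
differentiated by the product rule. The three Christoffel sums are the actions of Γ₂ on the two
factors and on the value. -/
theorem covΔ_eq (he : e ∈ IsManifold.maximalAtlas (𝓡 n) ∞ M) (h₁ : S₁.IsFlat) (h₂ : S₂.IsFlat)
    (hc : AlgebraicConditions e.target (S₁.chartConn e) (S₂.chartConn e) (S₁.chartForm e)
      (S₂.chartForm e)) (hx : x ∈ e.target) (l i j k : Fin n) :
    let m : Coord n := EuclideanSpace.single l 1
    let a : Covec n := Pi.single i 1
    let η : Covec n := Pi.single j 1
    covΔ S₁ S₂ e x l i j k =
      dot ((fderiv ℝ (S₁.chartConn e) x m - fderiv ℝ (S₂.chartConn e) x m)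
            (sharp (S₁.chartForm e x) a) η
          + (S₁.chartConn e x - S₂.chartConn e x)
            (sharp (fderiv ℝ (S₁.chartForm e) x m) a) η
          + (S₁.chartConn e x - S₂.chartConn e x)
            (sharp (S₁.chartForm e x) (S₂.chartConn e x m a)) η
          + (S₁.chartConn e x - S₂.chartConn e x) (sharp (S₁.chartForm e x) a)
            (S₂.chartConn e x m η)
          - S₂.chartConn e x m ((S₁.chartConn e x - S₂.chartConn e x)
            (sharp (S₁.chartForm e x) a) η)) (EuclideanSpace.single k 1) := by
  intro m a η
  have hΔ : ∀ y ∈ e.target, ∀ i j k, Δ S₁ S₂ e y i j k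
      = ((S₁.chartConn e y - S₂.chartConn e y) (sharp (S₁.chartForm e y) (Pi.single i 1))
        (Pi.single j 1)) k := fun y hy i j k => by
    rw [← circ_eq he hy (hc.symm y hy), circ_single]
  have hder : pd l (fun y => Δ S₁ S₂ e y i j k) x
      = ((fderiv ℝ (S₁.chartConn e) x m - fderiv ℝ (S₂.chartConn e) x m)
            (sharp (S₁.chartForm e x) a) η
          + (S₁.chartConn e x - S₂.chartConn e x)
            (sharp (fderiv ℝ (S₁.chartForm e) x m) a) η) k := by
    have hd : HasDerivAt (fun t : ℝ => Δ S₁ S₂ e (x + t • m) i j k)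
        (fderiv ℝ (fun y => Δ S₁ S₂ e y i j k) x m) 0 := by
      refine hasDerivAt_comp_curve (f := fun y => Δ S₁ S₂ e y i j k) ?_ (hasDerivAt_line x m)
      simpa using (differentiableAt_of_contDiffOn
        (contDiffOn_Δ (S₁ := S₁) (S₂ := S₂) he i j k) hx).hasFDerivAt
    refine hd.unique ((hasDerivAt_pi.1 (hasDerivAt_prod_line (flatData he h₁) (flatData he h₂)
      hx m a η) k).congr_of_eventuallyEq ?_)
    filter_upwards [eventually_line_mem e.open_target hx m] with t ht
    exact hΔ _ ht i j k
  let A := S₁.chartConn e x - S₂.chartConn e x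
  let B := sharp (S₁.chartForm e x)
  have s1 : (A (B (S₂.chartConn e x m a)) η) k
      = ∑ r, S₂.Γ e x i l r * Δ S₁ S₂ e x r j k := by
    have := congrFun (clm_covec ((A.flip η).comp B) (S₂.chartConn e x m a)) k
    simp only [ContinuousLinearMap.comp_apply, ContinuousLinearMap.flip_apply, Finset.sum_apply,
      Pi.smul_apply, smul_eq_mul, m, a, chartConn_basis_single S₂ he hx] at this
    rw [this]
    exact Finset.sum_congr rfl fun r _ => by rw [hΔ x hx]
  have s2 : (A (B a) (S₂.chartConn e x m η)) k = ∑ r, S₂.Γ e x j l r * Δ S₁ S₂ e x i r k := by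
    have := congrFun (clm_covec (A (B a)) (S₂.chartConn e x m η)) k
    simp only [Finset.sum_apply, Pi.smul_apply, smul_eq_mul, m, η,
      chartConn_basis_single S₂ he hx] at this
    rw [this]
    exact Finset.sum_congr rfl fun r _ => by rw [hΔ x hx]
  have s3 : (S₂.chartConn e x m (A (B a) η)) k = ∑ r, S₂.Γ e x r l k * Δ S₁ S₂ e x i j r := by
    have := congrFun (clm_covec (S₂.chartConn e x m) (A (B a) η)) k
    simp only [Finset.sum_apply, Pi.smul_apply, smul_eq_mul, m,
      chartConn_basis_single S₂ he hx] at this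
    rw [this]
    exact Finset.sum_congr rfl fun r _ => by rw [hΔ x hx, mul_comm]
  rw [dot_basis, covΔ, hder, ← s1, ← s2, ← s3]
  rfl

theorem covΔ_symm (he : e ∈ IsManifold.maximalAtlas (𝓡 n) ∞ M) (h₁ : S₁.IsFlat) (h₂ : S₂.IsFlat)
    (hc : AlgebraicConditions e.target (S₁.chartConn e) (S₂.chartConn e) (S₁.chartForm e)
      (S₂.chartForm e)) (hx : x ∈ e.target) (i j k l : Fin n) :
    covΔ S₁ S₂ e x l i j k = covΔ S₁ S₂ e x k i j l := by
  exact (covΔ_eq he h₁ h₂ hc hx l i j k).trans <| (hc.dot_covDeriv_prod_symm (flatData he h₁)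
    (flatData he h₂) hx _ _ _ _).trans (covΔ_eq he h₁ h₂ hc hx k i j l).symm

theorem compatible_iff_algebraicConditions (h₁ : S₁.IsFlat) (h₂ : S₂.IsFlat) :
    Compatible S₁ S₂ ↔ ∀ e ∈ IsManifold.maximalAtlas (𝓡 n) ∞ M,
      AlgebraicConditions e.target (S₁.chartConn e) (S₂.chartConn e) (S₁.chartForm e)
        (S₂.chartForm e) :=
  forall₂_congr fun _ he => pencil_isHamiltonian_iff_algebraicConditions (flatData he h₁)
    (flatData he h₂) (fun _ _ hu hξ => operator_eq_flatOp he h₁ hu hξ)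
    fun _ _ hu hξ => operator_eq_flatOp he h₂ hu hξ

end Multiplication

end Degree2

end

theorem mainTheorem1 (n : ℕ) (M : Type*) [TopologicalSpace M]
    [ChartedSpace (Degree2.Coord n) M] [IsManifold (𝓡 n) ∞ M]
    (S₁ S₂ : Degree2.FedosovStructure n M) (h₁ : S₁.IsFlat) (h₂ : S₂.IsFlat) :
    (Degree2.Compatible S₁ S₂ ↔
      ∀ e ∈ IsManifold.maximalAtlas (𝓡 n) ∞ M, ∀ x ∈ e.target, ∀ I J K : Fin n → ℝ,
        Degree2.pairing S₂ e x I (Degree2.circ S₁ S₂ e x J K)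
            = Degree2.pairing S₂ e x J (Degree2.circ S₁ S₂ e x I K) ∧
        Degree2.circ S₁ S₂ e x (Degree2.circ S₁ S₂ e x I J) K = 0) ∧
    (Degree2.Compatible S₁ S₂ →
      ∀ e ∈ IsManifold.maximalAtlas (𝓡 n) ∞ M, ∀ x ∈ e.target, ∀ i j k l,
        Degree2.covΔ S₁ S₂ e x l i j k = Degree2.covΔ S₁ S₂ e x k i j l) := by
  have hc := Degree2.compatible_iff_algebraicConditions h₁ h₂
  refine ⟨hc.trans (forall₂_congr fun e he => Degree2.algebraicConditions_iff he h₁), ?_⟩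
  intro h e he x hx i j k l
  exact Degree2.covΔ_symm he h₁ h₂ (hc.1 h e he) hx i j k l
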